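/- Let $d\ge 0$ be an integer, $T>0$, and let $H_i\in[0,1]$, $K_i\in(0,1]$ satisfy $2H_iK_i>1$ for $i=1,\dots,d$. Let $B=(B^1,\dots,B^d)$ be a $d$-dimensional bifractional Brownian motion on $[0,T]$: the components $B^i$ are independent centred Gaussian processes with almost surely continuous paths and $$E[B^i_tB^i_s]=R_i(t,s)=2^{-K_i}\big((t^{2H_i}+s^{2H_i})^{K_i}-|t-s|^{2H_iK_i}\big),\qquad s,t\in[0,T].$$ Let $\mathcal H_i$ be the completion of the step functions on $[0,T]$ for $\langle 1_{[0,t]},1_{[0,s]}\rangle=R_i(t,s)$, and $\mathcal H=\bigoplus_i\mathcal H_i$, with the isometry $\varphi\mapsto B(\varphi)$ into $L^2(\Omega)$ sending $1_{[0,s]}\in\mathcal H_i$ to $B^i_s$. For $F=g(B(\varphi_1),\dots,B(\varphi_n))$ with $g\in C_b^\infty(\mathbb R^n)$ and $\varphi_k\in\mathcal H$ put $DF=\sum_k\partial_kg(B(\varphi_1),\dots,B(\varphi_n))\,\varphi_k$. For $u\in L^2(\Omega;\mathcal H_i)$ we say that $u\in\mathrm{Dom}\,\delta^{B^i}$ with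 $\delta^{B^i}(u)=G$ if $G\in L^2(\Omega,\sigma(B),P)$ and $E[FG]=E\langle DF,u\rangle_{\mathcal H}$ for all such $F$. Let $\mathbb D^{1,2}(\mathcal H_i)$ be the closure of the variables $\sum_jF_jh_j$ (finite sums, $F_j$ as above, $h_j\in\mathcal H_i$) for the norm $(E\|u\|^2+E\|Du\|^2_{\mathcal H\otimes\mathcal H_i})^{1/2}$. The integral is extended by localization: $\delta^{B^i}(u)=G$ if there are events $A_n$ increasing to $\Omega$ up to a null set and $u_n\in\mathbb D^{1,2}(\mathcal H_i)\cap\mathrm{Dom}\,\delta^{B^i}$ such that $u=u_n$ and $G=\delta^{B^i}(u_n)$ a.s. on $A_n$. A measurable function $\varphi$ on $[0,T]$ with $\int_0^T\!\int_0^T|\varphi(u)||\varphi(v)|\,\big|\tfrac{\partial^2R_i}{\partial u\partial v}(u,v)\big|\,du\,dv<\infty$ is identified with the element of $\mathcal H_i$ whose inner product with $1_{[0,r]}$ is $\int_0^T\!\int_0^r\varphi(u)\tfrac{\partial^2R_i}{\partial u\partial v}(u,v)\,dv\,du$ for every $r\in[0,T]$. Let $f\in C^2(\mathbb R^d)$ and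 $t\in[0,T]$. Then, for every $i$, almost every path of the process $s\mapsto 1_{[0,t]}(s)\,\partial_if(B_s)$ defines an element of $\mathcal H_i$ in this sense, the divergence integral $$\int_0^t\partial_if(B_s)\,\delta B^i_s:=\delta^{B^i}\big(1_{[0,t]}(\cdot)\,\partial_if(B_\cdot)\big)$$ exists (by localization), and almost surely $$f(B_t)=f(0)+\sum_{i=1}^d\int_0^t\partial_if(B_s)\,\delta B^i_s+\sum_{i=1}^dH_iK_i\int_0^t\partial_{ii}f(B_s)\,s^{2H_iK_i-1}\,ds .$$ If the first and second order partial derivatives of $f$ are bounded, no localization is needed: then $1_{[0,t]}\,\partial_if(B_\cdot)\in\mathbb D^{1,2}(\mathcal H_i)\cap\mathrm{Dom}\,\delta^{B^i}$ and the integrals are the values of $\delta^{B^i}$ itself. -/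

import Mathlib

open MeasureTheory ProbabilityTheory

namespace BifBm

noncomputable section

/-- The covariance of bifractional Brownian motion with parameters `H`, `K`. -/
def cov (H K t s : ℝ) : ℝ :=
  1 / (2 : ℝ) ^ K * ((t ^ (2 * H) + s ^ (2 * H)) ^ K - |t - s| ^ (2 * H * K))

/-- The mixed second derivative `∂²R/∂u∂v (u, v)` of the covariance. -/
def covMixedDeriv (H K u v : ℝ) : ℝ :=
  deriv (fun x => deriv (fun y => cov H K x y) v) u

/-- The partial derivative of `f` in the `i`-th coordinate direction. -/
def partialDeriv {n : ℕ} (i : Fin n) (f : (Fin n → ℝ) → ℝ) (x : Fin n → ℝ) : ℝ :=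
  fderiv ℝ f x (Pi.single i 1)

variable {Ω : Type*} [MeasurableSpace Ω]

/-- `B = (B 0, …, B (d-1))` is a `d`-dimensional bifractional Brownian motion on `[0, T]`: its
components are independent centred Gaussian processes with almost surely continuous paths, the
`i`-th one having the bifractional covariance with parameters `H i`, `K i`. (That `B i 0 = 0`
almost surely follows from the covariance.) -/
structure IsBifBm {d : ℕ} (P : Measure Ω) (H K : Fin d → ℝ) (T : ℝ)
    (B : Fin d → ℝ → Ω → ℝ) : Prop where
  measurable : ∀ i, ∀ t ∈ Set.Icc 0 T, Measurable (B i t)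
  continuous_paths : ∀ i, ∀ᵐ ω ∂P, ContinuousOn (fun t => B i t ω) (Set.Icc 0 T)
  gaussian : ∀ i, IsGaussianProcess (fun (t : Set.Icc (0 : ℝ) T) (ω : Ω) => B i t ω) P
  centered : ∀ i, ∀ t ∈ Set.Icc 0 T, ∫ ω, B i t ω ∂P = 0
  covariance : ∀ i, ∀ t ∈ Set.Icc 0 T, ∀ s ∈ Set.Icc 0 T,
    ∫ ω, B i t ω * B i s ω ∂P = cov (H i) (K i) t s
  independent : iIndepFun (fun (i : Fin d) (ω : Ω) (t : Set.Icc (0 : ℝ) T) => B i t ω) P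

section Malliavin

variable {d : ℕ} (P : Measure Ω) (T : ℝ) (B : Fin d → ℝ → Ω → ℝ)

/-- The σ-algebra generated by the process on `[0, T]`. -/
def sigmaAlg : MeasurableSpace Ω :=
  ⨆ (i : Fin d) (t : Set.Icc (0 : ℝ) T), MeasurableSpace.comap (B i t) inferInstance

open Classical in
/-- The class of `B i s` in `L²(Ω)`: the image of the indicator `1_{[0,s]}` (in the `i`-th
component) under the isometry `φ ↦ B(φ)` from the canonical Hilbert space into `L²(Ω)`. -/
def ind (i : Fin d) (s : ℝ) : Lp ℝ 2 P :=
  if h : MemLp (B i s) 2 P then h.toLp (B i s) else 0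

/-- The canonical Hilbert space `ℋ_i` of the `i`-th component, that is, the completion of the step
functions on `[0, T]` for `⟨1_{[0,t]}, 1_{[0,s]}⟩ = R_i(t, s) = E[B i t * B i s]`. It is realised
through the isometry `φ ↦ B(φ)`, i.e. as the Gaussian space generated by the `i`-th component; so
an element `φ` of the space and the random variable `B(φ)` are the same thing here. -/
def hilb (i : Fin d) : Submodule ℝ (Lp ℝ 2 P) :=
  (Submodule.span ℝ {h | ∃ s ∈ Set.Icc 0 T, h = ind P B i s}).topologicalClosure

/-- The canonical Hilbert space `ℋ` of the whole process (for independent components, the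
orthogonal sum of the `ℋ_i`), realised in the same way. -/
def hilbAll : Submodule ℝ (Lp ℝ 2 P) :=
  (Submodule.span ℝ {h | ∃ i, ∃ s ∈ Set.Icc 0 T, h = ind P B i s}).topologicalClosure

/-- A smooth functional `g (B(φ₁), …, B(φₙ))` with `g ∈ C_b^∞(ℝⁿ)` and `φ₁, …, φₙ ∈ ℋ`. -/
structure SmoothFunctional where
  n : ℕ
  g : (Fin n → ℝ) → ℝ
  φ : Fin n → hilbAll P T B
  smooth : ContDiff ℝ (⊤ : ℕ∞) g
  bounded : ∀ m : ℕ, ∃ C : ℝ, ∀ x, ‖iteratedFDeriv ℝ m g x‖ ≤ C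

variable {P T B}

/-- The vector `(B(φ₁), …, B(φₙ))` at `ω`. -/
def SmoothFunctional.vec (F : SmoothFunctional P T B) (ω : Ω) : Fin F.n → ℝ :=
  fun k => (F.φ k : Lp ℝ 2 P) ω

/-- The value of a smooth functional. -/
def SmoothFunctional.eval (F : SmoothFunctional P T B) (ω : Ω) : ℝ := F.g (F.vec ω)

/-- The Malliavin derivative `DF = ∑ₖ ∂ₖg (B(φ₁), …, B(φₙ)) φₖ`, an `ℋ`-valued random variable.
Its derivative with respect to the `i`-th component alone is the orthogonal projection of `DF`
onto `ℋ_i`. -/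
def SmoothFunctional.D (F : SmoothFunctional P T B) (ω : Ω) : Lp ℝ 2 P :=
  ∑ k, partialDeriv k F.g (F.vec ω) • (F.φ k : Lp ℝ 2 P)

variable (P T B)

/-- `δ^{B^i}(u) = G`: the random variable `u` belongs to `L²(Ω; ℋ_i)` and to the domain of the
divergence operator with respect to the `i`-th component, with divergence `G ∈ L²(Ω, σ(B), P)`,
so that `E[F G] = E⟨DF, u⟩` for all smooth functionals `F` of the whole process. As `u` takes its
values in `ℋ_i`, only the derivative with respect to the `i`-th component enters. -/
structure IsDivergence (i : Fin d) (u : Ω → Lp ℝ 2 P) (G : Ω → ℝ) : Prop where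
  mem_hilb : ∀ᵐ ω ∂P, u ω ∈ hilb P T B i
  memLp_integrand : MemLp u 2 P
  memLp : MemLp G 2 P
  measurable : AEStronglyMeasurable[sigmaAlg T B] G P
  duality : ∀ F : SmoothFunctional P T B,
    ∫ ω, F.eval ω * G ω ∂P = ∫ ω, inner ℝ (F.D ω) (u ω) ∂P

/-- A smooth elementary `ℋ_i`-valued random variable `∑ⱼ Fⱼ hⱼ`. -/
structure SmoothElem (i : Fin d) where
  m : ℕ
  F : Fin m → SmoothFunctional P T B
  h : Fin m → hilb P T B i

variable {P T B}

/-- The value of a smooth elementary random variable. -/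
def SmoothElem.eval {i : Fin d} (V : SmoothElem P T B i) (ω : Ω) : Lp ℝ 2 P :=
  ∑ j, (V.F j).eval ω • (V.h j : Lp ℝ 2 P)

/-- The inner product `⟨DV, DW⟩` in `ℋ ⊗ ℋ_i`, where `DV = ∑ⱼ DFⱼ ⊗ hⱼ`. -/
def SmoothElem.innerD {i : Fin d} (V W : SmoothElem P T B i) (ω : Ω) : ℝ :=
  ∑ j, ∑ k, inner ℝ ((V.F j).D ω) ((W.F k).D ω) *
    inner ℝ (V.h j : Lp ℝ 2 P) (W.h k : Lp ℝ 2 P)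

/-- The squared norm `‖DV - DW‖²` in `ℋ ⊗ ℋ_i`. -/
def SmoothElem.distDSq {i : Fin d} (V W : SmoothElem P T B i) (ω : Ω) : ℝ :=
  V.innerD V ω - 2 * V.innerD W ω + W.innerD W ω

variable (P T B)

/-- The Sobolev space `𝔻^{1,2}(ℋ_i)`: the closure of the smooth elementary random variables for
the norm `(E‖u‖² + E‖Du‖²)^{1/2}`. That is, `u` is an `L²(Ω; ℋ_i)`-limit of smooth elementary
variables whose derivatives form a Cauchy sequence in `L²(Ω; ℋ ⊗ ℋ_i)`. -/
def MemSobolev (i : Fin d) (u : Ω → Lp ℝ 2 P) : Prop :=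
  MemLp u 2 P ∧ ∃ V : ℕ → SmoothElem P T B i,
    Filter.Tendsto (fun n => ∫ ω, ‖(V n).eval ω - u ω‖ ^ 2 ∂P) Filter.atTop (nhds 0) ∧
    Filter.Tendsto (fun p : ℕ × ℕ => ∫ ω, (V p.1).distDSq (V p.2) ω ∂P)
      Filter.atTop (nhds 0)

/-- The divergence integral extended by localization: `u` belongs to `𝔻^{1,2}_loc(ℋ_i)` and
`δ^{B^i}(u) = G`. There are events `A n` increasing to `Ω` up to a null set and
`v n ∈ 𝔻^{1,2}(ℋ_i)` such that, almost surely on `A n`, one has `u = v n` and `G = δ^{B^i}(v n)`.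
(Since the divergence is local on `𝔻^{1,2}(ℋ_i)`, this determines `G` almost surely.) -/
def IsLocalDivergence (i : Fin d) (u : Ω → Lp ℝ 2 P) (G : Ω → ℝ) : Prop :=
  ∃ (A : ℕ → Set Ω) (v : ℕ → Ω → Lp ℝ 2 P) (g : ℕ → Ω → ℝ),
    (∀ n, MeasurableSet (A n)) ∧ Monotone A ∧ (∀ᵐ ω ∂P, ∃ n, ω ∈ A n) ∧
    (∀ n, MemSobolev P T B i (v n)) ∧ (∀ n, IsDivergence P T B i (v n) (g n)) ∧
    (∀ n, ∀ᵐ ω ∂P, ω ∈ A n → v n ω = u ω ∧ g n ω = G ω)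

/-- The Banach space `|ℋ|` of functions on `[0, T]`: measurable `φ` with
`∫∫ |φ(u)| |φ(v)| |∂²R/∂u∂v (u,v)| du dv < ∞`. -/
def MemAbs (T H K : ℝ) (φ : ℝ → ℝ) : Prop :=
  AEMeasurable φ (volume.restrict (Set.Icc 0 T)) ∧
  ∫⁻ u in Set.Icc 0 T, ∫⁻ v in Set.Icc 0 T,
    ENNReal.ofReal (|φ u| * |φ v| * |covMixedDeriv H K u v|) < ⊤

/-- The element `h` of `ℋ_i` is the function `φ ∈ |ℋ_i|` under the inclusion `|ℋ_i| ⊆ ℋ_i`, for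
which `⟨φ, ψ⟩ = ∫∫ φ(u) ψ(v) ∂²R_i/∂u∂v (u,v) du dv`. The element `h` is determined by its inner
products with the indicators `ψ = 1_{[0,r]}`. -/
structure IsFunction (H K : Fin d → ℝ) (i : Fin d) (φ : ℝ → ℝ) (h : Lp ℝ 2 P) : Prop where
  mem_hilb : h ∈ hilb P T B i
  memAbs : MemAbs T (H i) (K i) φ
  inner_ind : ∀ r ∈ Set.Icc 0 T,
    inner ℝ h (ind P B i r) = ∫ u in (0 : ℝ)..T, ∫ v in (0 : ℝ)..r,
      φ u * covMixedDeriv (H i) (K i) u v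

end Malliavin

end

end BifBm

/-! Since 2HK > 1, the mixed derivative ∂²R/∂u∂v is integrable on the square and R is its double
integral (`integrable_covMixedDeriv`, `integral_covMixedDeriv`). Inner products of step processes in
ℋ_i are therefore integrals against an integrable kernel, and uniform convergence of integrands
along a path gives convergence in ℋ_i by dominated convergence (`IsBifBm.tendsto_stepInner`). The
same lemma, for processes with values in L²(Ω) instead of ℝ, controls Malliavin derivatives in ℋ ⊗
ℋ_i.

Let q be C¹, bounded, with bounded partial derivatives. Mollify q at scale 1/(n+1) and freeze it at
the left end points of the partition of [0,t] into n+1 intervals. This produces smooth elementary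
variables that converge to q(B) in 𝔻^{1,2}, with the explicit divergence Σ q_n(B_a)(B^i_b − B^i_a) −
Σ ∂_i q_n(B_a)(R(a,b) − R(a,a)), summed over the intervals (a,b]. Gaussian integration by parts
gives E δ(V)² = E‖V‖² + E tr((DV)²) ≤ E‖V‖² + E‖DV‖². So these divergences are Cauchy in L², and
their limit is the divergence of q(B) (`exists_isDivergence_of_tendsto`,
`IsBifBm.exists_divergence`).

Now let q = ∂_i f. In the second order Taylor expansion of the mollified f along the partition, the
first order terms are exactly these divergences plus the trace sums Σ ∂_ii f_n(B_a)(R(a,b) −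
R(a,a)). With α = 2HK one has R(a,b) − R(a,a) = ½(b^α − a^α) − ½E(B_b − B_a)², so the trace sums
converge to HK∫∂_ii f(B_s)s^{α−1}ds (`IsBifBm.tendsto_trace`). The remainder is at most a constant
times the sum of squared increments, whose expectation is O((n+1)(t/(n+1))^α) and vanishes because α
> 1. An almost surely convergent subsequence gives the formula (`IsBifBm.ito_formula`).

For general f, cut f off outside a ball of radius comparable to m. On the event that the path stays
in the ball of radius m, the discrete divergences of all later cutoffs coincide path by path, hence
so do their limits. This consistency replaces an abstract locality theorem for the divergence. -/

namespace BifBm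

/-! ### The covariance and its mixed second derivative. -/

section Kernel

open Set

/-- Explicit form of the mixed second derivative of the covariance off the diagonal. -/
noncomputable def covKernel (H K u v : ℝ) : ℝ :=
  1 / (2 : ℝ) ^ K * (4 * H ^ 2 * K * (K - 1) *
      ((u ^ (2 * H) + v ^ (2 * H)) ^ (K - 2) * (u ^ (2 * H - 1) * v ^ (2 * H - 1))) +
    2 * H * K * (2 * H * K - 1) * |u - v| ^ (2 * H * K - 2))

/-- The first-order derivative in the second variable of the covariance. -/
noncomputable def covDeriv (H K u v : ℝ) : ℝ :=
  1 / (2 : ℝ) ^ K * (2 * H * K * ((u ^ (2 * H) + v ^ (2 * H)) ^ (K - 1) * v ^ (2 * H - 1)) +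
    2 * H * K * (|u - v| ^ (2 * H * K - 2) * (u - v)))

/-- The diagonal u = v is included, because |x|^p is differentiable at 0 for p = 2HK > 1. Only the
second differentiation has to avoid it. -/
lemma hasDerivAt_cov_right {H K u v : ℝ} (hα : 1 < 2 * H * K) (hu : 0 < u) (hv : 0 < v) :
    HasDerivAt (fun y => cov H K u y) (covDeriv H K u v) v := by
  have h1 : HasDerivAt (fun y : ℝ => y ^ (2 * H)) (2 * H * v ^ (2 * H - 1)) v :=
    Real.hasDerivAt_rpow_const (Or.inl hv.ne')
  have hpos : 0 < u ^ (2 * H) + v ^ (2 * H) :=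
    add_pos (Real.rpow_pos_of_pos hu _) (Real.rpow_pos_of_pos hv _)
  have h2 := (h1.const_add (u ^ (2 * H))).rpow_const (p := K) (Or.inl hpos.ne')
  have h3 := (hasDerivAt_abs_rpow (u - v) hα).comp v ((hasDerivAt_id v).const_sub u)
  refine ((h2.sub h3).const_mul (1 / (2 : ℝ) ^ K)).congr_deriv ?_
  simp only [covDeriv]
  ring

lemma hasDerivAt_mul_abs_rpow {p w : ℝ} (hw : w ≠ 0) :
    HasDerivAt (fun x : ℝ => |x| ^ p * x) ((p + 1) * |w| ^ p) w := by
  have habs : HasDerivAt (fun x : ℝ => |x|) (SignType.sign w : ℝ) w := hasDerivAt_abs hw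
  have h := (habs.rpow_const (p := p) (Or.inl (abs_ne_zero.2 hw))).mul (hasDerivAt_id w)
  refine h.congr_deriv ?_
  have e : |w| ^ p = |w| ^ (p - 1) * |w| := by
    rw [← Real.rpow_add_one (abs_ne_zero.2 hw)]; ring_nf
  have e2 : (SignType.sign w : ℝ) * w = |w| := by
    rw [mul_comm]; exact self_mul_sign w
  simp only [id]
  rw [e]
  linear_combination (p * |w| ^ (p - 1)) * e2

lemma hasDerivAt_covDeriv_left {H K u v : ℝ} (hu : 0 < u) (hv : 0 < v) (huv : u ≠ v) :
    HasDerivAt (fun x => covDeriv H K x v) (covKernel H K u v) u := by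
  have h1 : HasDerivAt (fun y : ℝ => y ^ (2 * H)) (2 * H * u ^ (2 * H - 1)) u :=
    Real.hasDerivAt_rpow_const (Or.inl hu.ne')
  have hpos : 0 < u ^ (2 * H) + v ^ (2 * H) :=
    add_pos (Real.rpow_pos_of_pos hu _) (Real.rpow_pos_of_pos hv _)
  have h2 := (((h1.add_const (v ^ (2 * H))).rpow_const (p := K - 1) (Or.inl hpos.ne')).mul_const
    (v ^ (2 * H - 1))).const_mul (2 * H * K)
  have h3 := ((hasDerivAt_mul_abs_rpow (p := 2 * H * K - 2) (sub_ne_zero.2 huv)).comp u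
    ((hasDerivAt_id u).sub_const v)).const_mul (2 * H * K)
  refine ((h2.add h3).const_mul (1 / (2 : ℝ) ^ K)).congr_deriv ?_
  simp only [covKernel]
  rw [show K - 1 - 1 = K - 2 by ring]
  ring

lemma covMixedDeriv_eq {H K u v : ℝ} (hα : 1 < 2 * H * K) (hu : 0 < u) (hv : 0 < v)
    (huv : u ≠ v) : covMixedDeriv H K u v = covKernel H K u v := by
  have h : (fun x => deriv (fun y => cov H K x y) v) =ᶠ[nhds u] fun x => covDeriv H K x v := by
    filter_upwards [lt_mem_nhds hu] with x hx
    exact (hasDerivAt_cov_right hα hx hv).deriv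
  rw [covMixedDeriv, h.deriv_eq, (hasDerivAt_covDeriv_left hu hv huv).deriv]

lemma intervalIntegrable_abs_rpow {r : ℝ} (hr : -1 < r) (a b : ℝ) :
    IntervalIntegrable (fun x : ℝ => |x| ^ r) volume a b := by
  have h1 : ∀ c : ℝ, 0 ≤ c → IntervalIntegrable (fun x : ℝ => |x| ^ r) volume 0 c := by
    intro c hc
    refine (intervalIntegral.intervalIntegrable_rpow' hr (a := 0) (b := c)).congr_uIoo ?_
    intro x hx
    rw [uIoo_of_le hc] at hx
    simp only [abs_of_pos hx.1]
  have h2 : ∀ c : ℝ, IntervalIntegrable (fun x : ℝ => |x| ^ r) volume 0 c := by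
    intro c
    rcases le_total 0 c with hc | hc
    · exact h1 c hc
    · rw [IntervalIntegrable.iff_comp_neg]
      simpa using h1 (-c) (by linarith)
  exact (h2 a).symm.trans (h2 b)

lemma integrable_covKernel {H K : ℝ} (hK : K ∈ Ioc (0 : ℝ) 1)
    (hα : 1 < 2 * H * K) {T : ℝ} (hT : 0 ≤ T) :
    Integrable (fun z : ℝ × ℝ => covKernel H K z.1 z.2)
      ((volume.restrict (Ioc 0 T)).prod (volume.restrict (Ioc 0 T))) := by
  have hb : Integrable (fun u : ℝ => u ^ (H * K - 1)) (volume.restrict (Ioc 0 T)) :=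
    (intervalIntegrable_iff_integrableOn_Ioc_of_le hT).1
      (intervalIntegral.intervalIntegrable_rpow' (by linarith))
  -- The singular term is the convolution integrand of 1_{(0,T]} with |x|^{2HK−2} cut off to [−T,T];
  -- it is integrable because 2HK − 2 > −1.
  have hg : Integrable ((Icc (-T) T).indicator fun x : ℝ => |x| ^ (2 * H * K - 2)) volume := by
    rw [integrable_indicator_iff measurableSet_Icc,
      ← intervalIntegrable_iff_integrableOn_Icc_of_le (by linarith)]
    exact intervalIntegrable_abs_rpow (by linarith) _ _
  have hf : Integrable ((Ioc 0 T).indicator fun _ : ℝ => (1 : ℝ)) volume := by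
    rw [integrable_indicator_iff measurableSet_Ioc]
    exact integrableOn_const (by simp) (by simp)
  have hc := hf.convolution_integrand (ContinuousLinearMap.mul ℝ ℝ) hg
  have h2 : Integrable (fun z : ℝ × ℝ => |z.1 - z.2| ^ (2 * H * K - 2))
      ((volume.restrict (Ioc 0 T)).prod (volume.restrict (Ioc 0 T))) := by
    rw [Measure.prod_restrict]
    refine (hc.integrableOn (s := Ioc 0 T ×ˢ Ioc 0 T)).congr_fun ?_
      (measurableSet_Ioc.prod measurableSet_Ioc)
    rintro ⟨x, y⟩ ⟨hx, hy⟩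
    simp only [mem_Ioc] at hx hy
    have : x - y ∈ Icc (-T) T := ⟨by linarith, by linarith⟩
    simp [indicator_of_mem this, hy.1, hy.2]
  have h1 : Integrable (fun z : ℝ × ℝ => (z.1 ^ (2 * H) + z.2 ^ (2 * H)) ^ (K - 2) *
      (z.1 ^ (2 * H - 1) * z.2 ^ (2 * H - 1)))
      ((volume.restrict (Ioc 0 T)).prod (volume.restrict (Ioc 0 T))) := by
    refine (hb.mul_prod hb).mono' (by fun_prop) ?_
    rw [Measure.prod_restrict]
    refine (ae_restrict_iff' (measurableSet_Ioc.prod measurableSet_Ioc)).2 (.of_forall ?_)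
    rintro ⟨x, y⟩ ⟨hx, hy⟩
    have hx0 : 0 < x := hx.1
    have hy0 : 0 < y := hy.1
    have px := Real.rpow_pos_of_pos hx0
    have py := Real.rpow_pos_of_pos hy0
    have sx : x ^ (2 * H) = x ^ H * x ^ H := by rw [← Real.rpow_add hx0]; ring_nf
    have sy : y ^ (2 * H) = y ^ H * y ^ H := by rw [← Real.rpow_add hy0]; ring_nf
    -- The arithmetic–geometric inequality, raised to the nonpositive power K − 2, separates the
    -- variables: the regular term is dominated by x^{HK−1}y^{HK−1}, integrable since HK > 0.
    have hle : x ^ H * y ^ H ≤ x ^ (2 * H) + y ^ (2 * H) := by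
      rw [sx, sy]
      nlinarith [sq_nonneg (x ^ H - y ^ H), mul_pos (px H) (py H)]
    have hmono := Real.rpow_le_rpow_of_nonpos (mul_pos (px H) (py H)) hle
      (by linarith [hK.2] : K - 2 ≤ 0)
    rw [Real.norm_of_nonneg (by positivity)]
    calc _ ≤ (x ^ H * y ^ H) ^ (K - 2) * (x ^ (2 * H - 1) * y ^ (2 * H - 1)) := by gcongr
      _ = x ^ (H * K - 1) * y ^ (H * K - 1) := by
        rw [Real.mul_rpow (px H).le (py H).le, ← Real.rpow_mul hx0.le, ← Real.rpow_mul hy0.le,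
          mul_mul_mul_comm, ← Real.rpow_add hx0, ← Real.rpow_add hy0]
        ring_nf
  exact (((h1.const_mul (4 * H ^ 2 * K * (K - 1))).add
    (h2.const_mul (2 * H * K * (2 * H * K - 1)))).const_mul (1 / (2 : ℝ) ^ K))

/-- The diagonal is a null set and the axes are excluded by the half-open intervals. -/
lemma ae_covMixedDeriv_eq {H K : ℝ} (hα : 1 < 2 * H * K) (T T' : ℝ) :
    ∀ᵐ z ∂(volume.restrict (Ioc 0 T)).prod (volume.restrict (Ioc 0 T')),
      covMixedDeriv H K z.1 z.2 = covKernel H K z.1 z.2 := by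
  have hd : ∀ᵐ z ∂(volume.restrict (Ioc 0 T)).prod (volume.restrict (Ioc (0 : ℝ) T')),
      z.1 ≠ z.2 := by
    rw [Measure.ae_prod_iff_ae_ae (p := fun z : ℝ × ℝ => z.1 ≠ z.2)
      ((measurableSet_eq_fun measurable_fst measurable_snd).compl)]
    refine .of_forall fun x => ?_
    refine ae_restrict_of_ae ?_
    filter_upwards [Measure.ae_ne volume x] with y hy using hy.symm
  have hp : ∀ᵐ z ∂(volume.restrict (Ioc 0 T)).prod (volume.restrict (Ioc (0 : ℝ) T')),
      z ∈ Ioc 0 T ×ˢ Ioc 0 T' := by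
    rw [Measure.prod_restrict]
    exact ae_restrict_mem (measurableSet_Ioc.prod measurableSet_Ioc)
  filter_upwards [hd, hp] with z h1 h2
  exact covMixedDeriv_eq hα h2.1.1 h2.2.1 h1

lemma integrable_covMixedDeriv {H K : ℝ} (hK : K ∈ Ioc (0 : ℝ) 1)
    (hα : 1 < 2 * H * K) {T : ℝ} (hT : 0 ≤ T) :
    Integrable (fun z : ℝ × ℝ => covMixedDeriv H K z.1 z.2)
      ((volume.restrict (Ioc 0 T)).prod (volume.restrict (Ioc 0 T))) :=
  (integrable_covKernel hK hα hT).congr (by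
    filter_upwards [ae_covMixedDeriv_eq hα T T] with z hz using hz.symm)

/-- Up to the factor p this is the derivative of the C¹ function |x|^p. It makes the first
derivative of the covariance continuous across the diagonal. -/
lemma continuous_mul_abs_rpow {p : ℝ} (hp : 1 < p) :
    Continuous fun x : ℝ => |x| ^ (p - 2) * x := by
  have h := (contDiff_norm_rpow (E := ℝ) hp).continuous_deriv le_rfl
  have e : deriv (fun x : ℝ => ‖x‖ ^ p) = fun x => p * |x| ^ (p - 2) * x := by
    ext x; exact (hasDerivAt_abs_rpow x hp).deriv
  rw [e] at h
  refine (h.const_mul p⁻¹).congr fun x => ?_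
  field_simp

/-- Fundamental theorem of calculus with the single exceptional point u = v, where `covDeriv` is
still continuous and the kernel has an integrable singularity. The boundary value at u = 0 vanishes
because both terms of `covDeriv` reduce to multiples of v^{2HK−1} with opposite signs. -/
lemma integral_covKernel_left {H K : ℝ} (hH : 0 < H) (hα : 1 < 2 * H * K)
    (hK : K ∈ Ioc (0 : ℝ) 1) {a v : ℝ} (ha : 0 ≤ a) (hv : 0 < v) :
    ∫ u in Ioc 0 a, covKernel H K u v = covDeriv H K a v := by
  have hH2 : 0 < 2 * H - 1 := by nlinarith [hK.1, hK.2]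
  have hvp : 0 < v ^ (2 * H) := Real.rpow_pos_of_pos hv _
  have hpos : ∀ x ∈ Icc 0 a, x ^ (2 * H) + v ^ (2 * H) ≠ 0 := fun x hx =>
    (add_pos_of_nonneg_of_pos (Real.rpow_nonneg hx.1 _) hvp).ne'
  have c1 : Continuous fun x : ℝ => x ^ (2 * H) :=
    Real.continuous_rpow_const (by linarith)
  have c2 : Continuous fun x : ℝ => x ^ (2 * H - 1) :=
    Real.continuous_rpow_const hH2.le
  have hc : ContinuousOn (fun x => covDeriv H K x v) (Icc 0 a) := by
    have c3 : Continuous fun x : ℝ => |x - v| ^ (2 * H * K - 2) * (x - v) :=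
      (continuous_mul_abs_rpow hα).comp (continuous_id.sub continuous_const)
    have c4 : ContinuousOn (fun x : ℝ => (x ^ (2 * H) + v ^ (2 * H)) ^ (K - 1)) (Icc 0 a) :=
      (c1.add continuous_const).continuousOn.rpow_const fun x hx => Or.inl (hpos x hx)
    unfold covDeriv
    exact continuousOn_const.mul ((continuousOn_const.mul (c4.mul continuousOn_const)).add
      (continuousOn_const.mul c3.continuousOn))
  have hi : IntervalIntegrable (fun u => covKernel H K u v) volume 0 a := by
    have c4 : ContinuousOn (fun x : ℝ => (x ^ (2 * H) + v ^ (2 * H)) ^ (K - 2)) (uIcc 0 a) := by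
      rw [uIcc_of_le ha]
      exact (c1.add continuous_const).continuousOn.rpow_const fun x hx => Or.inl (hpos x hx)
    have i1 : IntervalIntegrable (fun u : ℝ => (u ^ (2 * H) + v ^ (2 * H)) ^ (K - 2) *
        (u ^ (2 * H - 1) * v ^ (2 * H - 1))) volume 0 a :=
      (c4.mul (c2.mul continuous_const).continuousOn).intervalIntegrable
    have i2 : IntervalIntegrable (fun u : ℝ => |u - v| ^ (2 * H * K - 2)) volume 0 a := by
      have := (intervalIntegrable_abs_rpow (r := 2 * H * K - 2) (by linarith)
        (0 - v) (a - v)).comp_sub_right v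
      simpa using this
    exact ((i1.const_mul _).add (i2.const_mul _)).const_mul _
  have hz : covDeriv H K 0 v = 0 := by
    have e1 : (v ^ (2 * H)) ^ (K - 1) * v ^ (2 * H - 1) = v ^ (2 * H * K - 1) := by
      rw [← Real.rpow_mul hv.le, ← Real.rpow_add hv]; ring_nf
    have e2 : v ^ (2 * H * K - 2) * v = v ^ (2 * H * K - 1) := by
      rw [← Real.rpow_add_one hv.ne']; ring_nf
    rw [covDeriv, Real.zero_rpow (by linarith), zero_add, zero_sub, abs_neg, abs_of_pos hv, e1,
      mul_neg, e2]
    ring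
  have := integral_eq_of_hasDerivAt_off_countable_of_le (fun u => covDeriv H K u v)
    (fun u => covKernel H K u v) ha (countable_singleton v) hc
    (fun x hx => hasDerivAt_covDeriv_left hx.1.1 hv hx.2) hi
  rw [← intervalIntegral.integral_of_le ha, this, hz, sub_zero]

lemma integral_covDeriv_right {H K : ℝ} (hH : 0 < H) (hα : 1 < 2 * H * K)
    (hK : K ∈ Ioc (0 : ℝ) 1) {a b : ℝ} (ha : 0 < a) (hb : 0 ≤ b) :
    ∫ v in Ioc 0 b, covDeriv H K a v = cov H K a b := by
  have hH2 : 0 < 2 * H - 1 := by nlinarith [hK.1, hK.2]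
  have hap : 0 < a ^ (2 * H) := Real.rpow_pos_of_pos ha _
  have hpos : ∀ x ∈ Icc 0 b, a ^ (2 * H) + x ^ (2 * H) ≠ 0 := fun x hx =>
    (add_pos_of_pos_of_nonneg hap (Real.rpow_nonneg hx.1 _)).ne'
  have c1 : Continuous fun x : ℝ => x ^ (2 * H) :=
    Real.continuous_rpow_const (by linarith)
  have c2 : Continuous fun x : ℝ => x ^ (2 * H - 1) :=
    Real.continuous_rpow_const hH2.le
  have hc : ContinuousOn (fun x => cov H K a x) (Icc 0 b) := by
    have c3 : Continuous fun x : ℝ => |a - x| ^ (2 * H * K) :=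
      (Real.continuous_rpow_const (by linarith)).comp
        (continuous_const.sub continuous_id).abs
    have c4 : ContinuousOn (fun x : ℝ => (a ^ (2 * H) + x ^ (2 * H)) ^ K) (Icc 0 b) :=
      (continuous_const.add c1).continuousOn.rpow_const fun x hx => Or.inl (hpos x hx)
    unfold cov
    exact continuousOn_const.mul (c4.sub c3.continuousOn)
  have hi : IntervalIntegrable (fun u => covDeriv H K a u) volume 0 b := by
    refine ContinuousOn.intervalIntegrable ?_
    rw [uIcc_of_le hb]
    have c3 : Continuous fun x : ℝ => |a - x| ^ (2 * H * K - 2) * (a - x) :=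
      (continuous_mul_abs_rpow hα).comp (continuous_const.sub continuous_id)
    have c4 : ContinuousOn (fun x : ℝ => (a ^ (2 * H) + x ^ (2 * H)) ^ (K - 1)) (Icc 0 b) :=
      (continuous_const.add c1).continuousOn.rpow_const fun x hx => Or.inl (hpos x hx)
    unfold covDeriv
    exact continuousOn_const.mul ((continuousOn_const.mul (c4.mul c2.continuousOn)).add
      (continuousOn_const.mul c3.continuousOn))
  have hz : cov H K a 0 = 0 := by
    rw [cov, Real.zero_rpow (by linarith), add_zero, sub_zero, abs_of_pos ha,
      ← Real.rpow_mul ha.le, sub_self, mul_zero]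
  have := integral_eq_of_hasDerivAt_off_countable_of_le (fun u => cov H K a u)
    (fun u => covDeriv H K a u) hb countable_empty hc
    (fun x hx => hasDerivAt_cov_right hα ha hx.1.1) hi
  rw [← intervalIntegral.integral_of_le hb, this, hz, sub_zero]

lemma cov_zero_left {H K : ℝ} (hH : 0 < H) {b : ℝ} (hb : 0 ≤ b) : cov H K 0 b = 0 := by
  rw [cov, Real.zero_rpow (by linarith), zero_add, zero_sub, abs_neg, abs_of_nonneg hb,
      ← Real.rpow_mul hb, sub_self, mul_zero]

/-- The covariance is the double integral of its mixed second derivative. -/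
lemma integral_covMixedDeriv {H K : ℝ} (hH : 0 < H) (hK : K ∈ Ioc (0 : ℝ) 1)
    (hα : 1 < 2 * H * K) {a b : ℝ} (ha : 0 ≤ a) (hb : 0 ≤ b) :
    ∫ z, covMixedDeriv H K z.1 z.2
      ∂(volume.restrict (Ioc 0 a)).prod (volume.restrict (Ioc 0 b)) = cov H K a b := by
  rcases ha.eq_or_lt with rfl | ha0
  · simp [cov_zero_left hH hb]
  rw [integral_congr_ae (ae_covMixedDeriv_eq hα a b), integral_prod_symm]
  · rw [← integral_covDeriv_right hH hα hK ha0 hb]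
    refine setIntegral_congr_fun measurableSet_Ioc fun v hv => ?_
    exact integral_covKernel_left hH hα hK ha hv.1
  · refine (integrable_covKernel hK hα (le_max_of_le_left ha : 0 ≤ max a b)).mono_measure ?_
    exact Measure.prod_mono
      (Measure.restrict_mono (Ioc_subset_Ioc_right (le_max_left _ _)) le_rfl)
      (Measure.restrict_mono (Ioc_subset_Ioc_right (le_max_right _ _)) le_rfl)

lemma cov_self {H K : ℝ} (hH : 0 < H) (hK : 0 < K) {a : ℝ} (ha : 0 ≤ a) :
    cov H K a a = a ^ (2 * H * K) := by
  have h2 : (2 : ℝ) ^ K ≠ 0 := by positivity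
  rw [cov, sub_self, abs_zero, Real.zero_rpow (by positivity), sub_zero, ← two_mul,
    Real.mul_rpow zero_le_two (Real.rpow_nonneg ha _), ← Real.rpow_mul ha]
  field_simp

/-- The variance of an increment. -/
lemma cov_increment_le {H K : ℝ} (hH : 0 < H) (hK : K ∈ Ioc (0 : ℝ) 1) {a b : ℝ}
    (ha : 0 ≤ a) (hb : 0 ≤ b) :
    cov H K a a + cov H K b b - 2 * cov H K a b ≤ 2 * |a - b| ^ (2 * H * K) := by
  have hx := Real.rpow_nonneg ha (2 * H)
  have hy := Real.rpow_nonneg hb (2 * H)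
  -- Midpoint concavity of x ↦ x^K at a^{2H} and b^{2H} gives a^{2HK} + b^{2HK} ≤ 2^{1−K}(a^{2H} +
  -- b^{2H})^K. Only 2^{1−K}|a−b|^{2HK} is left, and 2^{1−K} ≤ 2.
  have hconc := (Real.concaveOn_rpow hK.1.le hK.2).2 hx hy (by norm_num : (0 : ℝ) ≤ 1 / 2)
    (by norm_num : (0 : ℝ) ≤ 1 / 2) (by norm_num)
  simp only [smul_eq_mul, ← Real.rpow_mul ha, ← Real.rpow_mul hb] at hconc
  rw [← mul_add (1 / 2 : ℝ) (a ^ (2 * H)), Real.mul_rpow (by norm_num) (by positivity),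
    Real.div_rpow zero_le_one zero_le_two, Real.one_rpow] at hconc
  rw [cov_self hH hK.1 ha, cov_self hH hK.1 hb, cov]
  have h2 : 1 / (2 : ℝ) ^ K ≤ 1 := by
    rw [div_le_one (by positivity)]; exact Real.one_le_rpow one_le_two hK.1.le
  have h3 : 0 ≤ |a - b| ^ (2 * H * K) := by positivity
  nlinarith [mul_le_mul_of_nonneg_right h2 h3]

end Kernel
-- The Gaussian Hilbert space and Gaussian integration by parts.
section GaussianSpace

open Set Filter Topology

variable {Ω : Type*} [MeasurableSpace Ω] {P : Measure Ω} {d : ℕ} {H K : Fin d → ℝ} {T : ℝ}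
  {B : Fin d → ℝ → Ω → ℝ}

lemma inner_Lp_eq_integral (X Y : Lp ℝ 2 P) : inner ℝ X Y = ∫ ω, X ω * Y ω ∂P := by
  rw [L2.inner_def]
  simp [mul_comm]

lemma IsBifBm.hasGaussianLaw (hB : IsBifBm P H K T B) (i : Fin d) {s : ℝ} (hs : s ∈ Icc 0 T) :
    HasGaussianLaw (B i s) P :=
  (hB.gaussian i).hasGaussianLaw_eval ⟨s, hs⟩

lemma IsBifBm.memLp_two (hB : IsBifBm P H K T B) (i : Fin d) {s : ℝ} (hs : s ∈ Icc 0 T) :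
    MemLp (B i s) 2 P :=
  (hB.hasGaussianLaw i hs).memLp_two

lemma IsBifBm.coeFn_ind (hB : IsBifBm P H K T B) (i : Fin d) {s : ℝ} (hs : s ∈ Icc 0 T) :
    ind P B i s =ᵐ[P] B i s := by
  rw [ind, dif_pos (hB.memLp_two i hs)]
  exact MemLp.coeFn_toLp _

lemma ind_mem_hilb (i : Fin d) {s : ℝ} (hs : s ∈ Icc 0 T) : ind P B i s ∈ hilb P T B i :=
  Submodule.le_topologicalClosure _ (Submodule.subset_span ⟨s, hs, rfl⟩)

lemma hilb_le_hilbAll (i : Fin d) : hilb P T B i ≤ hilbAll P T B :=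
  Submodule.topologicalClosure_mono (Submodule.span_mono fun _ ⟨s, hs, h⟩ => ⟨i, s, hs, h⟩)

lemma ind_mem_hilbAll (i : Fin d) {s : ℝ} (hs : s ∈ Icc 0 T) : ind P B i s ∈ hilbAll P T B :=
  hilb_le_hilbAll i (ind_mem_hilb i hs)

lemma IsBifBm.inner_ind_self (hB : IsBifBm P H K T B) (i : Fin d) {s r : ℝ} (hs : s ∈ Icc 0 T)
    (hr : r ∈ Icc 0 T) :
    inner ℝ (ind P B i s) (ind P B i r) = cov (H i) (K i) s r := by
  rw [inner_Lp_eq_integral, ← hB.covariance i s hs r hr]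
  refine integral_congr_ae ?_
  filter_upwards [hB.coeFn_ind i hs, hB.coeFn_ind i hr] with ω h1 h2
  rw [h1, h2]

lemma IsBifBm.inner_ind_of_ne (hB : IsBifBm P H K T B) {i j : Fin d} (hij : i ≠ j) {s r : ℝ}
    (hs : s ∈ Icc 0 T) (hr : r ∈ Icc 0 T) :
    inner ℝ (ind P B i s) (ind P B j r) = 0 := by
  have hind : IndepFun (B i s) (B j r) P :=
    (hB.independent.indepFun hij).comp (measurable_pi_apply (⟨s, hs⟩ : Icc (0 : ℝ) T))
      (measurable_pi_apply (⟨r, hr⟩ : Icc (0 : ℝ) T))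
  rw [inner_Lp_eq_integral]
  calc _ = ∫ ω, (B i s * B j r) ω ∂P := by
        refine integral_congr_ae ?_
        filter_upwards [hB.coeFn_ind i hs, hB.coeFn_ind j hr] with ω h1 h2
        rw [h1, h2, Pi.mul_apply]
    _ = 0 := by
        rw [hind.integral_mul_eq_mul_integral (hB.measurable i s hs).aestronglyMeasurable
          (hB.measurable j r hr).aestronglyMeasurable, hB.centered i s hs, zero_mul]

/-- The components of the process, restricted to finitely many times, are jointly Gaussian. -/
lemma IsBifBm.hasGaussianLaw_restrict (hB : IsBifBm P H K T B) (I : Finset (Icc (0 : ℝ) T)) :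
    HasGaussianLaw (fun ω (i : Fin d) => I.restrict (fun t : Icc (0 : ℝ) T => B i t ω)) P := by
  refine iIndepFun.hasGaussianLaw (fun i => (hB.gaussian i).hasGaussianLaw I) ?_
  exact hB.independent.comp (fun _ => I.restrict) fun _ => Finset.measurable_restrict I

lemma IsBifBm.hasGaussianLaw_of_mem_span [IsProbabilityMeasure P] (hB : IsBifBm P H K T B)
    {X : Lp ℝ 2 P}
    (hX : X ∈ Submodule.span ℝ {h | ∃ i, ∃ s ∈ Icc 0 T, h = ind P B i s}) :
    HasGaussianLaw (X : Ω → ℝ) P := by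
  classical
  have hS : {h | ∃ i, ∃ s ∈ Icc 0 T, h = ind P B i s} =
      range fun p : Fin d × Icc (0 : ℝ) T => ind P B p.1 p.2 := by
    ext h
    constructor
    · rintro ⟨i, s, hs, rfl⟩; exact ⟨(i, ⟨s, hs⟩), rfl⟩
    · rintro ⟨p, rfl⟩; exact ⟨p.1, p.2, p.2.2, rfl⟩
  rw [hS, Finsupp.mem_span_range_iff_exists_finsupp] at hX
  obtain ⟨c, rfl⟩ := hX
  -- All components are restricted to the same finite set of times, so that the combination is a
  -- continuous linear image of one Gaussian vector.
  set I : Finset (Icc (0 : ℝ) T) := c.support.image Prod.snd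
  let L : (Fin d → I → ℝ) →L[ℝ] ℝ := ∑ p ∈ c.support.attach, c p.1 •
    ((ContinuousLinearMap.proj (R := ℝ) (φ := fun _ : I => ℝ)
      ⟨p.1.2, Finset.mem_image_of_mem _ p.2⟩).comp
      (ContinuousLinearMap.proj (R := ℝ) (φ := fun _ : Fin d => I → ℝ) p.1.1))
  refine ((hB.hasGaussianLaw_restrict I).map_fun L).congr ?_
  have h1 : ∀ᵐ ω ∂P, ∀ p ∈ c.support, (ind P B p.1 p.2 : Lp ℝ 2 P) ω = B p.1 p.2 ω :=
    (eventually_all_finset c.support).2 fun p _ => hB.coeFn_ind p.1 p.2.2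
  have h2 : ∀ᵐ ω ∂P, ∀ p ∈ c.support, (c p • ind P B p.1 p.2 : Lp ℝ 2 P) ω =
      c p * (ind P B p.1 p.2 : Lp ℝ 2 P) ω :=
    (eventually_all_finset c.support).2 fun p _ => Lp.coeFn_smul (c p) (ind P B p.1 p.2)
  have h3 := Lp.coeFn_finsetSum (p := 2) (μ := P) c.support fun p => c p • ind P B p.1 p.2
  filter_upwards [h1, h2, h3] with ω h1 h2 h3
  rw [Finsupp.sum, h3]
  simp only [L, sum_apply]
  rw [Finset.sum_apply, ← Finset.sum_attach c.support]
  refine Finset.sum_congr rfl fun p _ => ?_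
  rw [h2 p.1 p.2, h1 p.1 p.2]
  rfl

lemma integral_abs_Lp_le [IsProbabilityMeasure P] (X : Lp ℝ 2 P) : ∫ ω, |X ω| ∂P ≤ ‖X‖ := by
  have h := eLpNorm_le_eLpNorm_of_exponent_le (μ := P) (p := 1) (q := 2) (by norm_num)
    (Lp.aestronglyMeasurable X)
  rw [Lp.norm_def]
  refine le_trans (le_of_eq ?_) (ENNReal.toReal_mono (Lp.eLpNorm_ne_top X) h)
  rw [eLpNorm_one_eq_lintegral_enorm, ← integral_norm_eq_lintegral_enorm
    (Lp.aestronglyMeasurable X)]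
  rfl

/-- Makes "mean zero" and "characteristic function equal to a given continuous expression" closed
conditions in L², which then pass from the span of the indicators to its closure. -/
lemma continuous_integral_comp_Lp [IsProbabilityMeasure P] {F : Type*} [NormedAddCommGroup F]
    [NormedSpace ℝ F] {φ : ℝ → F} {C : NNReal} (hφ : LipschitzWith C φ) :
    Continuous fun X : Lp ℝ 2 P => ∫ ω, φ (X ω) ∂P := by
  have hint : ∀ X : Lp ℝ 2 P, Integrable (fun ω => φ (X ω)) P := by
    intro X
    have hX := (Lp.memLp X).integrable (by norm_num)
    refine Integrable.mono' ((hX.abs.const_mul C).add (integrable_const ‖φ 0‖))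
      (hφ.continuous.comp_aestronglyMeasurable (Lp.aestronglyMeasurable X))
      (.of_forall fun ω => ?_)
    have h := hφ.dist_le_mul (X ω) 0
    rw [dist_eq_norm, dist_zero_right, Real.norm_eq_abs] at h
    have h2 := norm_sub_norm_le (φ (X ω)) (φ 0)
    simp only [Pi.add_apply]
    linarith
  refine LipschitzWith.continuous (K := C) (LipschitzWith.of_dist_le_mul fun X Y => ?_)
  rw [dist_eq_norm, dist_eq_norm, ← integral_sub (hint X) (hint Y)]
  calc _ ≤ ∫ ω, C * |(X - Y) ω| ∂P := by
        refine norm_integral_le_of_norm_le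
          (((Lp.memLp (X - Y)).integrable (by norm_num)).abs.const_mul C) ?_
        filter_upwards [Lp.coeFn_sub X Y] with ω hω
        rw [hω, ← dist_eq_norm]
        exact hφ.dist_le_mul _ _
    _ ≤ C * ‖X - Y‖ := by
        rw [integral_const_mul]
        gcongr
        exact integral_abs_Lp_le _

lemma lipschitzWith_cexp (t : ℝ) :
    LipschitzWith ‖t‖₊ fun x : ℝ => Complex.exp (t * x * Complex.I) := by
  refine LipschitzWith.of_dist_le_mul fun x y => ?_
  have h : Complex.exp (t * x * Complex.I) - Complex.exp (t * y * Complex.I) =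
      Complex.exp ((t * y : ℝ) * Complex.I) *
        (Complex.exp (Complex.I * (t * (x - y) : ℝ)) - 1) := by
    rw [mul_sub, ← Complex.exp_add]
    push_cast
    ring_nf
  rw [dist_eq_norm, h, norm_mul, Complex.norm_exp_ofReal_mul_I, one_mul]
  refine Real.norm_exp_I_mul_ofReal_sub_one_le.trans (le_of_eq ?_)
  rw [norm_mul, coe_nnnorm, Real.dist_eq, Real.norm_eq_abs (x - y)]

lemma norm_sq_Lp (X : Lp ℝ 2 P) : ‖X‖ ^ 2 = ∫ ω, X ω ^ 2 ∂P := by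
  rw [← real_inner_self_eq_norm_sq, inner_Lp_eq_integral]
  simp only [sq]

lemma IsBifBm.integral_eq_zero [IsProbabilityMeasure P] (hB : IsBifBm P H K T B) {X : Lp ℝ 2 P}
    (hX : X ∈ hilbAll P T B) : ∫ ω, X ω ∂P = 0 := by
  have hcl : IsClosed {X : Lp ℝ 2 P | ∫ ω, X ω ∂P = 0} :=
    isClosed_eq (continuous_integral_comp_Lp (φ := id) LipschitzWith.id) continuous_const
  refine (closure_minimal ?_ hcl) hX
  intro Y hY
  induction hY using Submodule.span_induction with
  | mem x h =>
    obtain ⟨i, s, hs, rfl⟩ := h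
    rw [mem_ofPred_eq, integral_congr_ae (hB.coeFn_ind i hs), hB.centered i s hs]
  | zero =>
    rw [mem_ofPred_eq, integral_congr_ae (Lp.coeFn_zero ℝ 2 P)]; simp
  | add x y _ _ hx hy =>
    rw [mem_ofPred_eq] at *
    rw [integral_congr_ae (Lp.coeFn_add x y)]
    simp only [Pi.add_apply]
    rw [integral_add ((Lp.memLp x).integrable (by norm_num))
      ((Lp.memLp y).integrable (by norm_num)), hx, hy, add_zero]
  | smul a x _ hx =>
    rw [mem_ofPred_eq] at *
    rw [integral_congr_ae (Lp.coeFn_smul a x)]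
    simp only [Pi.smul_apply, smul_eq_mul]
    rw [integral_const_mul, hx, mul_zero]

lemma variance_Lp [IsProbabilityMeasure P] {X : Lp ℝ 2 P} (hX : ∫ ω, X ω ∂P = 0) :
    variance X P = ‖X‖ ^ 2 := by
  rw [variance_of_integral_eq_zero (Lp.aestronglyMeasurable X).aemeasurable hX, norm_sq_Lp]

lemma charFun_map_Lp (X : Lp ℝ 2 P) (t : ℝ) :
    charFun (P.map X) t = ∫ ω, Complex.exp (t * X ω * Complex.I) ∂P := by
  rw [charFun_apply_real, integral_map (Lp.aestronglyMeasurable X).aemeasurable (by fun_prop)]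

/-- The elements of the canonical Hilbert space are Gaussian random variables. -/
lemma IsBifBm.hasGaussianLaw_of_mem [IsProbabilityMeasure P] (hB : IsBifBm P H K T B)
    {X : Lp ℝ 2 P} (hX : X ∈ hilbAll P T B) : HasGaussianLaw (X : Ω → ℝ) P := by
  -- A centred Y is Gaussian exactly when its characteristic function is exp(−t²‖Y‖²/2). For each t
  -- both sides are continuous in Y ∈ L².
  have key : ∀ Y : Lp ℝ 2 P, ∫ ω, Y ω ∂P = 0 → (HasGaussianLaw (Y : Ω → ℝ) P ↔
      ∀ t : ℝ, ∫ ω, Complex.exp (t * Y ω * Complex.I) ∂P =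
        Complex.exp (-((t * t * ‖Y‖ ^ 2 : ℝ) : ℂ) / 2)) := by
    intro Y hY
    rw [hasGaussianLaw_iff_charFun_map_eq (Lp.aestronglyMeasurable Y).aemeasurable]
    refine forall_congr' fun t => ?_
    rw [charFun_map_Lp]
    have e : ∀ ω, inner ℝ t (Y ω) = t * Y ω := fun ω => by simp [mul_comm]
    simp only [e]
    rw [integral_const_mul, hY, variance_const_mul, variance_Lp hY]
    simp [sq, neg_div]
  have hcl : IsClosed {X : Lp ℝ 2 P | ∀ t : ℝ,
      ∫ ω, Complex.exp (t * X ω * Complex.I) ∂P =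
        Complex.exp (-((t * t * ‖X‖ ^ 2 : ℝ) : ℂ) / 2)} := by
    rw [ofPred_forall]
    exact isClosed_iInter fun t => isClosed_eq (continuous_integral_comp_Lp (lipschitzWith_cexp t))
      (by fun_prop)
  refine (key X (hB.integral_eq_zero hX)).2 ((closure_minimal ?_ hcl) hX)
  intro Y hY
  exact (key Y (hB.integral_eq_zero (Submodule.le_topologicalClosure _ hY))).1
    (hB.hasGaussianLaw_of_mem_span hY)

/-- Finite families in the canonical Hilbert space are jointly Gaussian. -/
lemma IsBifBm.hasGaussianLaw_pi [IsProbabilityMeasure P] (hB : IsBifBm P H K T B) {ι : Type*}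
    [Fintype ι] (φ : ι → hilbAll P T B) :
    HasGaussianLaw (fun ω (k : ι) => (φ k : Lp ℝ 2 P) ω) P := by
  classical
  have hm : AEMeasurable (fun ω (k : ι) => (φ k : Lp ℝ 2 P) ω) P :=
    aemeasurable_pi_lambda _ fun k => (Lp.aestronglyMeasurable _).aemeasurable
  rw [hasGaussianLaw_iff_charFunDual_map_eq hm]
  intro L
  -- Cramér–Wold: every linear functional of the vector is again an element of the Gaussian space.
  have hmem : ∑ k, L (Pi.single k 1) • (φ k : Lp ℝ 2 P) ∈ hilbAll P T B :=
    Submodule.sum_mem _ fun k _ => Submodule.smul_mem _ _ (φ k).2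
  have heq : ((∑ k, L (Pi.single k 1) • (φ k : Lp ℝ 2 P) : Lp ℝ 2 P) : Ω → ℝ) =ᵐ[P]
      L ∘ fun ω (k : ι) => (φ k : Lp ℝ 2 P) ω := by
    have h1 := Lp.coeFn_finsetSum (p := 2) (μ := P) Finset.univ
      fun k => L (Pi.single k 1) • (φ k : Lp ℝ 2 P)
    have h2 : ∀ᵐ ω ∂P, ∀ k, (L (Pi.single k 1) • (φ k : Lp ℝ 2 P) : Lp ℝ 2 P) ω =
        L (Pi.single k 1) * (φ k : Lp ℝ 2 P) ω :=
      ae_all_iff.2 fun k => Lp.coeFn_smul _ _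
    filter_upwards [h1, h2] with ω h1 h2
    rw [h1, Finset.sum_apply, Function.comp_apply, ← L.coe_coe, LinearMap.pi_apply_eq_sum_univ]
    refine Finset.sum_congr rfl fun k _ => ?_
    rw [L.coe_coe, h2 k, smul_eq_mul, mul_comm]
    congr 2
    ext j
    simp [Pi.single_apply, eq_comm]
  have hG := (hB.hasGaussianLaw_of_mem hmem).congr heq
  have := hG.charFun_map_eq 1
  rw [charFunDual_eq_charFun_map_one, AEMeasurable.map_map_of_aemeasurable
    L.continuous.measurable.aemeasurable hm, this]
  simp [Function.comp_def]

lemma integrable_gaussianReal_iff {v : NNReal} (hv : v ≠ 0) {f : ℝ → ℝ} :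
    Integrable f (gaussianReal 0 v) ↔ Integrable (fun y => gaussianPDFReal 0 v y * f y) := by
  rw [gaussianReal_of_var_ne_zero 0 hv, integrable_withDensity_iff_integrable_smul'
    (measurable_gaussianPDF _ _) (.of_forall fun _ => gaussianPDF_lt_top)]
  simp only [toReal_gaussianPDF, smul_eq_mul]

lemma hasDerivAt_gaussianPDFReal {v : NNReal} (hv : v ≠ 0) (y : ℝ) :
    HasDerivAt (fun y => -(v : ℝ) * gaussianPDFReal 0 v y) (gaussianPDFReal 0 v y * y) y := by
  have hv' : (v : ℝ) ≠ 0 := by exact_mod_cast hv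
  have h := (((hasDerivAt_id y).sub_const 0).pow 2).neg.div_const (2 * (v : ℝ))
  have h2 := (h.exp.const_mul (Real.sqrt (2 * Real.pi * v))⁻¹).const_mul (-(v : ℝ))
  refine h2.congr_deriv ?_
  rw [gaussianPDFReal_def]
  simp only [id, Pi.neg_apply, Pi.pow_apply]
  field_simp
  simp

/-- Stein's lemma. -/
lemma integral_mul_gaussianReal {v : NNReal} (hv : v ≠ 0) {ψ ψ' : ℝ → ℝ}
    (hψ : ∀ y, HasDerivAt ψ (ψ' y) y) (h1 : Integrable (fun y => ψ y * y) (gaussianReal 0 v))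
    (h2 : Integrable ψ' (gaussianReal 0 v)) :
    ∫ y, ψ y * y ∂gaussianReal 0 v = v * ∫ y, ψ' y ∂gaussianReal 0 v := by
  have hc : Continuous ψ := continuous_iff_continuousAt.2 fun y => (hψ y).continuousAt
  -- ψ is continuous, hence bounded on [−1,1], and |ψ(y)| ≤ |ψ(y)y| outside.
  have h0 : Integrable ψ (gaussianReal 0 v) := by
    obtain ⟨M, hM⟩ := isCompact_Icc.exists_bound_of_continuousOn
      (hc.continuousOn (s := Icc (-1 : ℝ) 1))
    refine Integrable.mono' ((integrable_const M).add h1.abs) hc.aestronglyMeasurable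
      (.of_forall fun y => ?_)
    simp only [Pi.add_apply]
    have hM0 : 0 ≤ M := (norm_nonneg _).trans (hM 0 (by simp))
    by_cases hy : y ∈ Icc (-1 : ℝ) 1
    · linarith [hM y hy, abs_nonneg (ψ y * y)]
    · have : 1 ≤ |y| := by
        rw [mem_Icc, ← abs_le] at hy; linarith
      rw [abs_mul, Real.norm_eq_abs]
      nlinarith [abs_nonneg (ψ y)]
  rw [integrable_gaussianReal_iff hv] at h0 h1 h2
  -- If p is the density, then −v·p is a primitive of y·p(y); integrability of the three products
  -- removes the boundary terms.
  have key := integral_mul_deriv_eq_deriv_mul_of_integrable (u := ψ) (u' := ψ')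
    (v := fun y => -(v : ℝ) * gaussianPDFReal 0 v y) (v' := fun y => gaussianPDFReal 0 v y * y)
    (fun x _ => hψ x) (fun x _ => hasDerivAt_gaussianPDFReal hv x)
    (h1.congr (.of_forall fun y => by simp only [Pi.mul_apply]; ring))
    ((h2.const_mul (-(v : ℝ))).congr (.of_forall fun y => by simp only [Pi.mul_apply]; ring))
    ((h0.const_mul (-(v : ℝ))).congr (.of_forall fun y => by simp only [Pi.mul_apply]; ring))
  rw [integral_gaussianReal_eq_integral_smul hv, integral_gaussianReal_eq_integral_smul hv,
    ← integral_const_mul]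
  simp only [smul_eq_mul]
  calc _ = ∫ y, ψ y * (gaussianPDFReal 0 v y * y) := by congr 1; ext y; ring
    _ = _ := by rw [key, ← integral_neg]; congr 1; ext y; ring

/-- Gaussian integration by parts. -/
lemma IsBifBm.integral_mul_eq [IsProbabilityMeasure P] (hB : IsBifBm P H K T B) {ι : Type*}
    [Fintype ι] (φ : ι → hilbAll P T B) (y : hilbAll P T B) {Ψ : (ι → ℝ) → ℝ}
    (hΨ : ContDiff ℝ 1 Ψ)
    (h1 : Integrable (fun ω => Ψ (fun k => (φ k : Lp ℝ 2 P) ω) * (y : Lp ℝ 2 P) ω) P)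
    (h2 : Integrable (fun ω => fderiv ℝ Ψ (fun k => (φ k : Lp ℝ 2 P) ω)
      (fun k => inner ℝ (φ k : Lp ℝ 2 P) (y : Lp ℝ 2 P))) P) :
    ∫ ω, Ψ (fun k => (φ k : Lp ℝ 2 P) ω) * (y : Lp ℝ 2 P) ω ∂P =
      ∫ ω, fderiv ℝ Ψ (fun k => (φ k : Lp ℝ 2 P) ω)
        (fun k => inner ℝ (φ k : Lp ℝ 2 P) (y : Lp ℝ 2 P)) ∂P := by
  set c : ι → ℝ := fun k => inner ℝ (φ k : Lp ℝ 2 P) (y : Lp ℝ 2 P) with hc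
  rcases eq_or_ne y 0 with rfl | hy
  · have hc0 : c = 0 := by ext k; simp [hc]
    rw [hc0]
    simp only [map_zero, integral_zero]
    rw [integral_eq_zero_of_ae]
    filter_upwards [Lp.coeFn_zero ℝ 2 P] with ω hω
    change _ * (0 : Lp ℝ 2 P) ω = 0
    rw [hω, Pi.zero_apply, mul_zero]
  have hy0 : (y : Lp ℝ 2 P) ≠ 0 := by simpa using hy
  set v : NNReal := ‖(y : Lp ℝ 2 P)‖₊ ^ 2 with hv
  have hv0 : v ≠ 0 := pow_ne_zero _ (nnnorm_ne_zero_iff.2 hy0)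
  have hvr : (v : ℝ) = ‖(y : Lp ℝ 2 P)‖ ^ 2 := by simp [hv]
  have hv0' : (v : ℝ) ≠ 0 := by exact_mod_cast hv0
  -- Each φ_k is split into its projection onto y and a remainder ζ_k orthogonal to y. Joint
  -- Gaussianity turns orthogonality into independence, so that Stein's lemma can be applied in the
  -- variable y with ζ frozen.
  let ζ : ι → hilbAll P T B := fun k => φ k - (c k / v) • y
  set Z : Ω → ι → ℝ := fun ω k => (ζ k : Lp ℝ 2 P) ω with hZ
  set Y : Ω → ℝ := fun ω => (y : Lp ℝ 2 P) ω with hY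
  have hZm : AEMeasurable Z P :=
    aemeasurable_pi_lambda _ fun k => (Lp.aestronglyMeasurable _).aemeasurable
  have hYm : AEMeasurable Y P := (Lp.aestronglyMeasurable _).aemeasurable
  have hYlaw : P.map Y = gaussianReal 0 v := by
    rw [(hB.hasGaussianLaw_of_mem y.2).map_eq_gaussianReal, hB.integral_eq_zero y.2,
      variance_Lp (hB.integral_eq_zero y.2), ← hvr]
    simp
  have hindep : IndepFun Z Y P := by
    -- The vector ζ and y must be Gaussian as one family before zero covariance yields independence.
    have hpair := hB.hasGaussianLaw_pi (ι := ι ⊕ Unit) (Sum.elim ζ fun _ => y)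
    let L : ((ι ⊕ Unit) → ℝ) →L[ℝ] (ι → ℝ) × (Unit → ℝ) :=
      (ContinuousLinearMap.pi fun k => ContinuousLinearMap.proj (Sum.inl k)).prod
        (ContinuousLinearMap.pi fun k => ContinuousLinearMap.proj (Sum.inr k))
    have h := (hpair.map_fun L : HasGaussianLaw
      (fun ω => (fun k => (ζ k : Lp ℝ 2 P) ω, fun _ : Unit => (y : Lp ℝ 2 P) ω)) P)
    have := h.indepFun_of_covariance_eval (X := fun k ω => (ζ k : Lp ℝ 2 P) ω)
      (Y := fun (_ : Unit) ω => (y : Lp ℝ 2 P) ω) (fun k _ => by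
        rw [covariance_eq_sub (Lp.memLp _) (Lp.memLp _), hB.integral_eq_zero y.2, mul_zero,
          sub_zero]
        have : ∫ ω, (ζ k : Lp ℝ 2 P) ω * (y : Lp ℝ 2 P) ω ∂P = 0 := by
          rw [← inner_Lp_eq_integral]
          simp only [ζ, Submodule.coe_sub, Submodule.coe_smul, inner_sub_left,
            real_inner_smul_left, real_inner_self_eq_norm_sq, ← hvr]
          rw [div_mul_cancel₀ _ hv0']
          simp [hc]
        exact this)
    exact this.comp measurable_id (measurable_pi_apply ())
  have hdec : ∀ᵐ ω ∂P, (fun k => (φ k : Lp ℝ 2 P) ω) = Z ω + (Y ω / v) • c := by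
    have : ∀ᵐ ω ∂P, ∀ k, (ζ k : Lp ℝ 2 P) ω =
        (φ k : Lp ℝ 2 P) ω - c k / v * (y : Lp ℝ 2 P) ω := by
      refine ae_all_iff.2 fun k => ?_
      filter_upwards [Lp.coeFn_sub (φ k : Lp ℝ 2 P) ((c k / v) • (y : Lp ℝ 2 P)),
        Lp.coeFn_smul (c k / (v : ℝ)) (y : Lp ℝ 2 P)] with ω h1 h2
      simp only [ζ, Submodule.coe_sub, Submodule.coe_smul]
      rw [h1, Pi.sub_apply, h2, Pi.smul_apply, smul_eq_mul]
    filter_upwards [this] with ω hω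
    ext k
    simp only [hZ, hY, Pi.add_apply, Pi.smul_apply, smul_eq_mul]
    rw [hω k]
    ring
  have hprod := (indepFun_iff_map_prod_eq_prod_map_map hZm hYm).1 hindep
  rw [hYlaw] at hprod
  have : IsProbabilityMeasure (P.map Z) := Measure.isProbabilityMeasure_map hZm
  have hZYm : AEMeasurable (fun ω => (Z ω, Y ω)) P := hZm.prodMk hYm
  have hfc : Continuous (fderiv ℝ Ψ) := hΨ.continuous_fderiv one_ne_zero
  let F : (ι → ℝ) × ℝ → ℝ := fun z => Ψ (z.1 + (z.2 / v) • c) * z.2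
  let F' : (ι → ℝ) × ℝ → ℝ := fun z => fderiv ℝ Ψ (z.1 + (z.2 / v) • c) c
  have hFc : Continuous F := (hΨ.continuous.comp (by fun_prop)).mul continuous_snd
  have hF'c : Continuous F' := (hfc.comp (by fun_prop)).clm_apply continuous_const
  have e1 : (fun ω => Ψ (fun k => (φ k : Lp ℝ 2 P) ω) * (y : Lp ℝ 2 P) ω) =ᵐ[P]
      fun ω => F (Z ω, Y ω) := by
    filter_upwards [hdec] with ω hω
    simp only [F]
    rw [hω]
  have e2 : (fun ω => fderiv ℝ Ψ (fun k => (φ k : Lp ℝ 2 P) ω) c) =ᵐ[P]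
      fun ω => F' (Z ω, Y ω) := by
    filter_upwards [hdec] with ω hω
    simp only [F']
    rw [hω]
  have i1 : Integrable F ((P.map Z).prod (gaussianReal 0 v)) := by
    rw [← hprod, integrable_map_measure hFc.aestronglyMeasurable hZYm]
    exact h1.congr e1
  have i2 : Integrable F' ((P.map Z).prod (gaussianReal 0 v)) := by
    rw [← hprod, integrable_map_measure hF'c.aestronglyMeasurable hZYm]
    exact h2.congr e2
  rw [integral_congr_ae e1, integral_congr_ae e2,
    ← integral_map hZYm hFc.aestronglyMeasurable, ← integral_map hZYm hF'c.aestronglyMeasurable,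
    hprod, integral_prod _ i1, integral_prod _ i2]
  refine integral_congr_ae ?_
  filter_upwards [i1.prod_right_ae, i2.prod_right_ae] with z hz1 hz2
  -- The factor 1/v from the chain rule cancels the variance v produced by Stein's lemma.
  have hd : ∀ x, HasDerivAt (fun x : ℝ => Ψ (z + (x / v) • c)) (F' (z, x) / v) x := by
    intro x
    have hline : HasDerivAt (fun x : ℝ => z + (x / v) • c) ((1 / (v : ℝ)) • c) x :=
      (((hasDerivAt_id x).div_const (v : ℝ)).smul_const c).const_add z
    refine ((hΨ.differentiable one_ne_zero).differentiableAt.hasFDerivAt.comp_hasDerivAt x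
      hline).congr_deriv ?_
    simp only [F', map_smul, smul_eq_mul]
    ring
  rw [integral_mul_gaussianReal hv0 hd hz1 (hz2.div_const _), integral_div, mul_div_cancel₀ _ hv0']

end GaussianSpace
-- Calculus of smooth functionals and their derivatives.
section Malliavin

open Set Filter Topology
open scoped TensorProduct

variable {Ω : Type*} [MeasurableSpace Ω] {P : Measure Ω} {d : ℕ} {H K : Fin d → ℝ} {T : ℝ}
  {B : Fin d → ℝ → Ω → ℝ}

/-- Bounded random variables. -/
def IsBddRV (P : Measure Ω) (f : Ω → ℝ) : Prop :=
  AEStronglyMeasurable f P ∧ ∃ C : ℝ, ∀ ω, |f ω| ≤ C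

lemma IsBddRV.mul {f g : Ω → ℝ} (hf : IsBddRV P f) (hg : IsBddRV P g) :
    IsBddRV P (fun ω => f ω * g ω) := by
  obtain ⟨hf, C, hC⟩ := hf
  obtain ⟨hg, C', hC'⟩ := hg
  refine ⟨hf.mul hg, C * C', fun ω => ?_⟩
  rw [abs_mul]
  exact mul_le_mul (hC ω) (hC' ω) (abs_nonneg _) ((abs_nonneg _).trans (hC ω))

lemma IsBddRV.mul_integrable {f g : Ω → ℝ} (hf : IsBddRV P f) (hg : Integrable g P) :
    Integrable (fun ω => f ω * g ω) P := by
  obtain ⟨hf, C, hC⟩ := hf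
  exact hg.bdd_mul hf (.of_forall hC)

lemma IsBddRV.integrable [IsProbabilityMeasure P] {f : Ω → ℝ} (hf : IsBddRV P f) :
    Integrable f P := by
  simpa using hf.mul_integrable (integrable_const (1 : ℝ))

lemma integrable_Lp [IsProbabilityMeasure P] (X : Lp ℝ 2 P) : Integrable X P :=
  (Lp.memLp X).integrable (by norm_num)

lemma integrable_mul_Lp (X Y : Lp ℝ 2 P) : Integrable (fun ω => X ω * Y ω) P :=
  (Lp.memLp X).integrable_mul (Lp.memLp Y)

variable (P T B) in
/-- `F` is a `C¹` function of finitely many elements of the Gaussian space; `D ω y` is its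
derivative in the direction `y`. -/
def HasMalliavinDeriv (F : Ω → ℝ) (D : Ω → Lp ℝ 2 P → ℝ) : Prop :=
  ∃ (ι : Type) (_ : Fintype ι) (φ : ι → hilbAll P T B) (g : (ι → ℝ) → ℝ), ContDiff ℝ 1 g ∧
    (∀ ω, F ω = g (fun k => (φ k : Lp ℝ 2 P) ω)) ∧
    ∀ ω y, D ω y = fderiv ℝ g (fun k => (φ k : Lp ℝ 2 P) ω)
      (fun k => inner ℝ (φ k : Lp ℝ 2 P) y)

lemma HasMalliavinDeriv.integral_mul_eq [IsProbabilityMeasure P] (hB : IsBifBm P H K T B)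
    {F : Ω → ℝ} {D : Ω → Lp ℝ 2 P → ℝ} (hF : HasMalliavinDeriv P T B F D) {y : Lp ℝ 2 P}
    (hy : y ∈ hilbAll P T B) (h1 : Integrable (fun ω => F ω * y ω) P)
    (h2 : Integrable (fun ω => D ω y) P) :
    ∫ ω, F ω * y ω ∂P = ∫ ω, D ω y ∂P := by
  obtain ⟨ι, _, φ, g, hg, hF, hD⟩ := hF
  simp only [hF, hD] at h1 h2 ⊢
  exact hB.integral_mul_eq φ ⟨y, hy⟩ hg h1 h2

/-- The underlying functions need not be bounded, so products may contain elements of the Gaussian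
space as factors; integrability is required only when the integration by parts is carried out. The
two families of Gaussian variables are joined into one indexed by the disjoint sum. -/
lemma HasMalliavinDeriv.mul {F G : Ω → ℝ} {D E : Ω → Lp ℝ 2 P → ℝ}
    (hF : HasMalliavinDeriv P T B F D) (hG : HasMalliavinDeriv P T B G E) :
    HasMalliavinDeriv P T B (fun ω => F ω * G ω) (fun ω y => D ω y * G ω + F ω * E ω y) := by
  obtain ⟨ι, _, φ, g, hg, hF, hD⟩ := hF
  obtain ⟨κ, _, ψ, h, hh, hG, hE⟩ := hG
  let L₁ : (ι ⊕ κ → ℝ) →L[ℝ] (ι → ℝ) :=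
    ContinuousLinearMap.pi fun k => ContinuousLinearMap.proj (Sum.inl k)
  let L₂ : (ι ⊕ κ → ℝ) →L[ℝ] (κ → ℝ) :=
    ContinuousLinearMap.pi fun k => ContinuousLinearMap.proj (Sum.inr k)
  refine ⟨ι ⊕ κ, inferInstance, Sum.elim φ ψ, fun x => g (L₁ x) * h (L₂ x),
    (hg.comp L₁.contDiff).mul (hh.comp L₂.contDiff), fun ω => ?_, fun ω y => ?_⟩
  · simp only [hF, hG]
    rfl
  · have d1 : HasFDerivAt (fun x => g (L₁ x)) _
        (fun k => ((Sum.elim φ ψ k : hilbAll P T B) : Lp ℝ 2 P) ω) :=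
      (hg.differentiable one_ne_zero _).hasFDerivAt.comp _ L₁.hasFDerivAt
    have d2 : HasFDerivAt (fun x => h (L₂ x)) _
        (fun k => ((Sum.elim φ ψ k : hilbAll P T B) : Lp ℝ 2 P) ω) :=
      (hh.differentiable one_ne_zero _).hasFDerivAt.comp _ L₂.hasFDerivAt
    have d3 : HasFDerivAt (fun x => g (L₁ x) * h (L₂ x)) _
        (fun k => ((Sum.elim φ ψ k : hilbAll P T B) : Lp ℝ 2 P) ω) := d1.mul d2
    rw [d3.fderiv]
    simp only [hF, hG, hD, hE, add_apply, smul_apply,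
      ContinuousLinearMap.comp_apply, smul_eq_mul]
    rw [add_comm, mul_comm (fderiv ℝ g _ _)]
    rfl

lemma hasMalliavinDeriv_coe {y : Lp ℝ 2 P} (hy : y ∈ hilbAll P T B) :
    HasMalliavinDeriv P T B y (fun _ z => inner ℝ y z) := by
  let L : (Unit → ℝ) →L[ℝ] ℝ := ContinuousLinearMap.proj ()
  refine ⟨Unit, inferInstance, fun _ => ⟨y, hy⟩, L, L.contDiff, fun ω => rfl, fun ω z => ?_⟩
  rw [L.fderiv]
  rfl

namespace SmoothFunctional

variable (F : SmoothFunctional P T B)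

lemma measurable_vec : Measurable F.vec :=
  measurable_pi_lambda _ fun _ => (Lp.stronglyMeasurable _).measurable

/-- The vector of inner products of the underlying elements with `y`. -/
noncomputable def coord (y : Lp ℝ 2 P) : Fin F.n → ℝ := fun k => inner ℝ (F.φ k : Lp ℝ 2 P) y

lemma inner_D (ω : Ω) (y : Lp ℝ 2 P) : inner ℝ (F.D ω) y = fderiv ℝ F.g (F.vec ω) (F.coord y) := by
  rw [D, sum_inner]
  conv_rhs => rw [← ContinuousLinearMap.coe_coe, LinearMap.pi_apply_eq_sum_univ]
  refine Finset.sum_congr rfl fun k _ => ?_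
  rw [real_inner_smul_left, partialDeriv, smul_eq_mul, mul_comm, coord, ContinuousLinearMap.coe_coe]
  congr 2
  ext j
  simp [Pi.single_apply, eq_comm]

/-- The second derivative in the directions `y` and `z`. -/
noncomputable def D2 (ω : Ω) (y z : Lp ℝ 2 P) : ℝ :=
  fderiv ℝ (fderiv ℝ F.g) (F.vec ω) (F.coord z) (F.coord y)

/-- This symmetry is what cancels the second derivatives in the covariance of two divergences. -/
lemma D2_comm (ω : Ω) (y z : Lp ℝ 2 P) : F.D2 ω y z = F.D2 ω z y := by
  have h : IsSymmSndFDerivAt ℝ F.g (F.vec ω) :=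
    (F.smooth.contDiffAt).isSymmSndFDerivAt (by simp; exact WithTop.coe_le_coe.2 le_top)
  exact h _ _

lemma hasMalliavinDeriv : HasMalliavinDeriv P T B F.eval (fun ω y => inner ℝ (F.D ω) y) :=
  ⟨Fin F.n, inferInstance, F.φ, F.g, F.smooth.of_le (mod_cast le_top), fun _ => rfl, F.inner_D⟩

lemma contDiff_fderiv : ContDiff ℝ (⊤ : ℕ∞) (fderiv ℝ F.g) :=
  F.smooth.fderiv_right (by simp)

lemma hasMalliavinDeriv_inner_D (y : Lp ℝ 2 P) :
    HasMalliavinDeriv P T B (fun ω => inner ℝ (F.D ω) y) (fun ω z => F.D2 ω y z) := by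
  refine ⟨Fin F.n, inferInstance, F.φ, fun x => fderiv ℝ F.g x (F.coord y),
    (F.contDiff_fderiv.of_le (mod_cast le_top)).clm_apply contDiff_const, fun ω => F.inner_D ω y,
    fun ω z => ?_⟩
  have h : HasFDerivAt (fderiv ℝ F.g) _ (F.vec ω) :=
    (F.contDiff_fderiv.differentiable (by simp) _).hasFDerivAt
  change fderiv ℝ (fderiv ℝ F.g) (F.vec ω) (F.coord z) (F.coord y) =
    fderiv ℝ (fun x => fderiv ℝ F.g x (F.coord y)) (F.vec ω) (F.coord z)
  rw [(h.clm_apply (hasFDerivAt_const (F.coord y) (F.vec ω))).fderiv]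
  simp

lemma exists_bound_fderiv : ∃ C : ℝ, ∀ x, ‖fderiv ℝ F.g x‖ ≤ C := by
  obtain ⟨C, hC⟩ := F.bounded 1
  refine ⟨C, fun x => ?_⟩
  have := hC x
  rwa [← norm_iteratedFDeriv_fderiv, norm_iteratedFDeriv_zero] at this

lemma isBddRV_eval : IsBddRV P F.eval := by
  obtain ⟨C, hC⟩ := F.bounded 0
  refine ⟨(F.smooth.continuous.measurable.comp F.measurable_vec).aestronglyMeasurable, C,
    fun ω => ?_⟩
  have := hC (F.vec ω)
  rwa [norm_iteratedFDeriv_zero] at this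

lemma isBddRV_inner_D (y : Lp ℝ 2 P) : IsBddRV P (fun ω => inner ℝ (F.D ω) y) := by
  obtain ⟨C, hC⟩ := F.exists_bound_fderiv
  simp only [F.inner_D]
  have hc : Continuous fun x => fderiv ℝ F.g x (F.coord y) :=
    (F.contDiff_fderiv.continuous).clm_apply continuous_const
  refine ⟨(hc.measurable.comp F.measurable_vec).aestronglyMeasurable, C * ‖F.coord y‖,
    fun ω => ?_⟩
  exact (ContinuousLinearMap.le_opNorm _ _).trans
    (mul_le_mul_of_nonneg_right (hC _) (norm_nonneg _))

lemma isBddRV_D2 (y z : Lp ℝ 2 P) : IsBddRV P (fun ω => F.D2 ω y z) := by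
  obtain ⟨C, hC⟩ := F.bounded 2
  have hc : Continuous fun x => fderiv ℝ (fderiv ℝ F.g) x (F.coord z) (F.coord y) :=
    (((F.contDiff_fderiv.continuous_fderiv (by simp))).clm_apply continuous_const).clm_apply
      continuous_const
  refine ⟨(hc.measurable.comp F.measurable_vec).aestronglyMeasurable,
    C * ‖F.coord z‖ * ‖F.coord y‖, fun ω => ?_⟩
  have hb : ‖fderiv ℝ (fderiv ℝ F.g) (F.vec ω)‖ ≤ C := by
    have := hC (F.vec ω)
    rwa [← norm_iteratedFDeriv_fderiv, ← norm_iteratedFDeriv_fderiv, norm_iteratedFDeriv_zero]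
      at this
  refine ((fderiv ℝ (fderiv ℝ F.g) (F.vec ω)).le_opNorm₂ _ _).trans ?_
  gcongr

lemma measurable_D : StronglyMeasurable F.D := by
  unfold D
  refine Finset.stronglyMeasurable_fun_sum _ fun k _ => StronglyMeasurable.smul_const ?_ _
  have hc : Continuous fun x => partialDeriv k F.g x :=
    (F.contDiff_fderiv.continuous).clm_apply continuous_const
  exact (hc.measurable.comp F.measurable_vec).stronglyMeasurable

lemma exists_bound_D : ∃ C : ℝ, ∀ ω, ‖F.D ω‖ ≤ C := by
  obtain ⟨C, hC⟩ := F.exists_bound_fderiv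
  refine ⟨∑ k, C * ‖(F.φ k : Lp ℝ 2 P)‖, fun ω => (norm_sum_le _ _).trans ?_⟩
  refine Finset.sum_le_sum fun k _ => ?_
  rw [norm_smul]
  refine mul_le_mul_of_nonneg_right ?_ (norm_nonneg _)
  refine (ContinuousLinearMap.le_opNorm _ _).trans ?_
  rw [Pi.norm_single, norm_one, mul_one]
  exact hC _

end SmoothFunctional

/-- `tr (A²) ≤ ‖A‖²` for a Hilbert–Schmidt operator of finite rank. -/
lemma sum_inner_mul_inner_le {E : Type*} [NormedAddCommGroup E] [InnerProductSpace ℝ E]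
    {ι : Type*} (s : Finset ι) (X h : ι → E) :
    ∑ j ∈ s, ∑ k ∈ s, inner ℝ (X j) (h k) * inner ℝ (X k) (h j) ≤
      ∑ j ∈ s, ∑ k ∈ s, inner ℝ (X j) (X k) * inner ℝ (h j) (h k) := by
  -- A' is the transpose of A and has the same norm, so ‖A − A'‖² ≥ 0 reads ⟨A, A'⟩ ≤ ‖A‖².
  set A : E ⊗[ℝ] E := ∑ j ∈ s, X j ⊗ₜ h j
  set A' : E ⊗[ℝ] E := ∑ j ∈ s, h j ⊗ₜ X j
  have e1 : inner ℝ A A = ∑ j ∈ s, ∑ k ∈ s, inner ℝ (X j) (X k) * inner ℝ (h j) (h k) := by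
    simp only [A, sum_inner, inner_sum, TensorProduct.inner_tmul]
    exact Finset.sum_comm
  have e2 : inner ℝ A' A' = inner ℝ A A := by
    simp only [A, A', sum_inner, inner_sum, TensorProduct.inner_tmul, mul_comm]
  have e3 : inner ℝ A A' = ∑ j ∈ s, ∑ k ∈ s, inner ℝ (X j) (h k) * inner ℝ (X k) (h j) := by
    simp only [A, A', sum_inner, inner_sum, TensorProduct.inner_tmul]
    refine Finset.sum_congr rfl fun j _ => Finset.sum_congr rfl fun k _ => ?_
    rw [real_inner_comm (h k) (X j), mul_comm, real_inner_comm (X j) (h k)]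
  have h0 := real_inner_self_nonneg (x := A - A')
  rw [inner_sub_left, inner_sub_right, inner_sub_right, e2, real_inner_comm A A', e1, e3] at h0
  linarith

end Malliavin
-- The divergence of smooth elementary variables and its L² bound.
section Divergence

open Set Filter Topology

variable {Ω : Type*} [MeasurableSpace Ω] {P : Measure Ω} {d : ℕ} {H K : Fin d → ℝ} {T : ℝ}
  {B : Fin d → ℝ → Ω → ℝ}

/-- `E[δ(F h) δ(G k)]` for smooth functionals `F`, `G`. -/
lemma SmoothFunctional.integral_div_mul_div [IsProbabilityMeasure P] (hB : IsBifBm P H K T B)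
    (F G : SmoothFunctional P T B) {h k : Lp ℝ 2 P} (hh : h ∈ hilbAll P T B)
    (hk : k ∈ hilbAll P T B) :
    ∫ ω, (F.eval ω * h ω - inner ℝ (F.D ω) h) * (G.eval ω * k ω - inner ℝ (G.D ω) k) ∂P =
      ∫ ω, F.eval ω * G.eval ω * inner ℝ h k +
        inner ℝ (F.D ω) k * inner ℝ (G.D ω) h ∂P := by
  have bF := F.isBddRV_eval
  have bG := G.isBddRV_eval
  have bFG := bF.mul bG
  have bFh := F.isBddRV_inner_D h
  have bFk := F.isBddRV_inner_D k
  have bGh := G.isBddRV_inner_D h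
  have bGk := G.isBddRV_inner_D k
  have bD := F.isBddRV_D2 h k
  have bD' := F.isBddRV_D2 k h
  have ih := integrable_Lp h
  have ik := integrable_Lp k
  have ihk := integrable_mul_Lp h k
  have i1 := bFG.mul_integrable ihk
  have i2 := (bF.mul bGk).mul_integrable ih
  have i3 := (bFh.mul bG).mul_integrable ik
  have i4 := (bFh.mul bGk).integrable
  have j1 := (bFk.mul bG).mul_integrable ih
  have j2 := bFG.integrable.mul_const (inner ℝ h k)
  have j3 := (bD.mul bG).integrable
  have j4 := (bFk.mul bGh).integrable
  -- integration by parts for `F G h` in the direction `k`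
  have e1 := ((F.hasMalliavinDeriv.mul G.hasMalliavinDeriv).mul
    (hasMalliavinDeriv_coe hh)).integral_mul_eq hB hk
    (i1.congr (.of_forall fun ω => by simp only; ring))
    (((j1.add i2).add j2).congr (.of_forall fun ω => by simp only [Pi.add_apply]; ring))
  -- Both E[⟨DF,h⟩Gk] and E[⟨DF,k⟩Gh] produce the term E[D²F(h,k)G]. They enter the expansion with
  -- opposite signs, so that no second derivative remains.
  have e2 := ((F.hasMalliavinDeriv_inner_D h).mul G.hasMalliavinDeriv).integral_mul_eq hB hk
    i3 (j3.add i4)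
  have e3 := ((F.hasMalliavinDeriv_inner_D k).mul G.hasMalliavinDeriv).integral_mul_eq hB hh
    j1 ((((bD'.mul bG).integrable).add j4))
  have c1 : ∫ ω, (inner ℝ (F.D ω) k * G.eval ω + F.eval ω * inner ℝ (G.D ω) k) * h ω +
      F.eval ω * G.eval ω * inner ℝ h k ∂P = (∫ ω, inner ℝ (F.D ω) k * G.eval ω * h ω ∂P) +
      (∫ ω, F.eval ω * inner ℝ (G.D ω) k * h ω ∂P) +
      ∫ ω, F.eval ω * G.eval ω * inner ℝ h k ∂P := by
    have j12 : Integrable (fun ω => inner ℝ (F.D ω) k * G.eval ω * h ω +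
        F.eval ω * inner ℝ (G.D ω) k * h ω) P := j1.add i2
    rw [← integral_add j1 i2, ← integral_add j12 j2]
    congr 1; ext ω; ring
  have c2 : ∫ ω, F.D2 ω h k * G.eval ω + inner ℝ (F.D ω) h * inner ℝ (G.D ω) k ∂P =
      (∫ ω, F.D2 ω h k * G.eval ω ∂P) + ∫ ω, inner ℝ (F.D ω) h * inner ℝ (G.D ω) k ∂P :=
    integral_add j3 i4
  have c3 : ∫ ω, F.D2 ω k h * G.eval ω + inner ℝ (F.D ω) k * inner ℝ (G.D ω) h ∂P =
      (∫ ω, F.D2 ω h k * G.eval ω ∂P) + ∫ ω, inner ℝ (F.D ω) k * inner ℝ (G.D ω) h ∂P := by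
    rw [← integral_add j3 j4]
    congr 1; ext ω; rw [F.D2_comm ω k h]
  rw [c1] at e1
  rw [c2] at e2
  rw [c3] at e3
  rw [integral_add j2 j4]
  have expand : ∫ ω, (F.eval ω * h ω - inner ℝ (F.D ω) h) *
      (G.eval ω * k ω - inner ℝ (G.D ω) k) ∂P =
      (∫ ω, F.eval ω * G.eval ω * h ω * k ω ∂P) -
      (∫ ω, F.eval ω * inner ℝ (G.D ω) k * h ω ∂P) -
      (∫ ω, inner ℝ (F.D ω) h * G.eval ω * k ω ∂P) +
      ∫ ω, inner ℝ (F.D ω) h * inner ℝ (G.D ω) k ∂P := by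
    have i1' : Integrable (fun ω => F.eval ω * G.eval ω * h ω * k ω) P :=
      i1.congr (.of_forall fun ω => by simp only; ring)
    have i12 : Integrable (fun ω => F.eval ω * G.eval ω * h ω * k ω -
        F.eval ω * inner ℝ (G.D ω) k * h ω) P := i1'.sub i2
    have i123 : Integrable (fun ω => F.eval ω * G.eval ω * h ω * k ω -
        F.eval ω * inner ℝ (G.D ω) k * h ω - inner ℝ (F.D ω) h * G.eval ω * k ω) P := i12.sub i3
    rw [← integral_sub i1' i2, ← integral_sub i12 i3, ← integral_add i123 i4]
    congr 1; ext ω; ring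
  rw [expand, e1, e2, e3]
  ring

namespace SmoothElem

variable {i : Fin d}

/-- The divergence of a smooth elementary random variable. -/
noncomputable def div (V : SmoothElem P T B i) (ω : Ω) : ℝ :=
  ∑ j, ((V.F j).eval ω * (V.h j : Lp ℝ 2 P) ω - inner ℝ ((V.F j).D ω) (V.h j : Lp ℝ 2 P))

lemma h_mem_hilbAll (V : SmoothElem P T B i) (j : Fin V.m) :
    (V.h j : Lp ℝ 2 P) ∈ hilbAll P T B := hilb_le_hilbAll i (V.h j).2

lemma memLp_term [IsProbabilityMeasure P] (V : SmoothElem P T B i) (j : Fin V.m) :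
    MemLp (fun ω => (V.F j).eval ω * (V.h j : Lp ℝ 2 P) ω -
      inner ℝ ((V.F j).D ω) (V.h j : Lp ℝ 2 P)) 2 P := by
  obtain ⟨m1, C, hC⟩ := (V.F j).isBddRV_eval
  obtain ⟨m2, C', hC'⟩ := (V.F j).isBddRV_inner_D (V.h j : Lp ℝ 2 P)
  refine MemLp.sub ?_ (MemLp.of_bound m2 C' (.of_forall hC'))
  refine (Lp.memLp (V.h j : Lp ℝ 2 P)).of_le_mul (c := C)
    (m1.mul (Lp.aestronglyMeasurable _)) (.of_forall fun ω => ?_)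
  rw [norm_mul]
  exact mul_le_mul_of_nonneg_right (hC ω) (norm_nonneg _)

lemma memLp_div [IsProbabilityMeasure P] (V : SmoothElem P T B i) : MemLp V.div 2 P :=
  memLp_finsetSum _ fun j _ => V.memLp_term j

lemma memLp_eval [IsProbabilityMeasure P] (V : SmoothElem P T B i) : MemLp V.eval 2 P := by
  refine memLp_finsetSum _ fun j _ => ?_
  obtain ⟨m1, C, hC⟩ := (V.F j).isBddRV_eval
  refine MemLp.of_bound (m1.smul_const _) (C * ‖(V.h j : Lp ℝ 2 P)‖) (.of_forall fun ω => ?_)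
  rw [norm_smul]
  exact mul_le_mul_of_nonneg_right (hC ω) (norm_nonneg _)

/-- The duality between the divergence and the derivative. -/
lemma duality [IsProbabilityMeasure P] (hB : IsBifBm P H K T B) (V : SmoothElem P T B i)
    (F : SmoothFunctional P T B) :
    ∫ ω, F.eval ω * V.div ω ∂P = ∫ ω, inner ℝ (F.D ω) (V.eval ω) ∂P := by
  have bF := F.isBddRV_eval
  simp only [div, eval, Finset.mul_sum, inner_sum, real_inner_smul_right]
  rw [integral_finsetSum, integral_finsetSum]
  · refine Finset.sum_congr rfl fun j _ => ?_
    set h := (V.h j : Lp ℝ 2 P)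
    have bV := (V.F j).isBddRV_eval
    have i1 := (bF.mul bV).mul_integrable (integrable_Lp h)
    have i2 := ((F.isBddRV_inner_D h).mul bV).integrable
    have i3 := (bF.mul ((V.F j).isBddRV_inner_D h)).integrable
    have e := (F.hasMalliavinDeriv.mul (V.F j).hasMalliavinDeriv).integral_mul_eq hB
      (V.h_mem_hilbAll j) i1 (i2.add i3)
    have c : ∫ ω, inner ℝ (F.D ω) h * (V.F j).eval ω + F.eval ω * inner ℝ ((V.F j).D ω) h ∂P =
        (∫ ω, inner ℝ (F.D ω) h * (V.F j).eval ω ∂P) +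
        ∫ ω, F.eval ω * inner ℝ ((V.F j).D ω) h ∂P := integral_add i2 i3
    rw [c] at e
    calc _ = (∫ ω, F.eval ω * (V.F j).eval ω * h ω ∂P) -
          ∫ ω, F.eval ω * inner ℝ ((V.F j).D ω) h ∂P := by
          rw [← integral_sub i1 i3]; congr 1; ext ω; ring
      _ = _ := by rw [e, add_sub_cancel_right]; congr 1; ext ω; ring
  · intro j _
    exact ((F.isBddRV_inner_D _).mul (V.F j).isBddRV_eval).integrable.congr
      (.of_forall fun ω => mul_comm _ _)
  · intro j _
    exact bF.mul_integrable ((V.memLp_term j).integrable (by norm_num))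

/-- The `L²`-bound for the divergence. -/
lemma integral_div_sq_le [IsProbabilityMeasure P] (hB : IsBifBm P H K T B)
    (V : SmoothElem P T B i) :
    ∫ ω, V.div ω ^ 2 ∂P ≤ ∫ ω, ‖V.eval ω‖ ^ 2 ∂P + ∫ ω, V.innerD V ω ∂P := by
  have iE : ∀ j k, Integrable (fun ω => (V.F j).eval ω * (V.F k).eval ω *
      inner ℝ (V.h j : Lp ℝ 2 P) (V.h k : Lp ℝ 2 P)) P := fun j k =>
    ((V.F j).isBddRV_eval.mul (V.F k).isBddRV_eval).integrable.mul_const _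
  have iT : ∀ j k, Integrable (fun ω => inner ℝ ((V.F j).D ω) (V.h k : Lp ℝ 2 P) *
      inner ℝ ((V.F k).D ω) (V.h j : Lp ℝ 2 P)) P := fun j k =>
    (((V.F j).isBddRV_inner_D _).mul ((V.F k).isBddRV_inner_D _)).integrable
  have iD : Integrable (V.innerD V) P := by
    refine integrable_finsetSum _ fun j _ => integrable_finsetSum _ fun k _ => ?_
    obtain ⟨C, hC⟩ := (V.F j).exists_bound_D
    obtain ⟨C', hC'⟩ := (V.F k).exists_bound_D
    refine Integrable.mul_const ?_ _
    refine Integrable.of_bound (C := C * C')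
      ((V.F j).measurable_D.inner (V.F k).measurable_D).aestronglyMeasurable
      (.of_forall fun ω => ?_)
    exact (norm_inner_le_norm _ _).trans
      (mul_le_mul (hC ω) (hC' ω) (norm_nonneg _) ((norm_nonneg _).trans (hC ω)))
  have hEv : ∀ ω, ‖V.eval ω‖ ^ 2 = ∑ j, ∑ k, (V.F j).eval ω * (V.F k).eval ω *
      inner ℝ (V.h j : Lp ℝ 2 P) (V.h k : Lp ℝ 2 P) := by
    intro ω
    rw [← real_inner_self_eq_norm_sq, eval, sum_inner]
    refine Finset.sum_congr rfl fun j _ => ?_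
    rw [inner_sum]
    refine Finset.sum_congr rfl fun k _ => ?_
    rw [real_inner_smul_left, real_inner_smul_right, mul_assoc]
  have hdiv : ∫ ω, V.div ω ^ 2 ∂P = ∑ j, ∑ k, ∫ ω, (V.F j).eval ω * (V.F k).eval ω *
      inner ℝ (V.h j : Lp ℝ 2 P) (V.h k : Lp ℝ 2 P) +
        inner ℝ ((V.F j).D ω) (V.h k : Lp ℝ 2 P) *
        inner ℝ ((V.F k).D ω) (V.h j : Lp ℝ 2 P) ∂P := by
    have hint : ∀ j k, Integrable (fun ω =>
        ((V.F j).eval ω * (V.h j : Lp ℝ 2 P) ω - inner ℝ ((V.F j).D ω) (V.h j : Lp ℝ 2 P)) *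
        ((V.F k).eval ω * (V.h k : Lp ℝ 2 P) ω - inner ℝ ((V.F k).D ω) (V.h k : Lp ℝ 2 P))) P :=
      fun j k => (V.memLp_term j).integrable_mul (V.memLp_term k)
    simp only [div, sq, Finset.sum_mul_sum]
    rw [integral_finsetSum _ fun j _ => integrable_finsetSum _ fun k _ => hint j k]
    refine Finset.sum_congr rfl fun j _ => ?_
    rw [integral_finsetSum _ fun k _ => hint j k]
    exact Finset.sum_congr rfl fun k _ =>
      (V.F j).integral_div_mul_div hB (V.F k) (V.h_mem_hilbAll j) (V.h_mem_hilbAll k)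
  have hsum : ∑ j, ∑ k, ∫ ω, (V.F j).eval ω * (V.F k).eval ω *
      inner ℝ (V.h j : Lp ℝ 2 P) (V.h k : Lp ℝ 2 P) +
        inner ℝ ((V.F j).D ω) (V.h k : Lp ℝ 2 P) *
        inner ℝ ((V.F k).D ω) (V.h j : Lp ℝ 2 P) ∂P =
      ∫ ω, ‖V.eval ω‖ ^ 2 + ∑ j, ∑ k, inner ℝ ((V.F j).D ω) (V.h k : Lp ℝ 2 P) *
        inner ℝ ((V.F k).D ω) (V.h j : Lp ℝ 2 P) ∂P := by
    simp only [hEv, ← Finset.sum_add_distrib]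
    have iET : ∀ j k, Integrable (fun ω => (V.F j).eval ω * (V.F k).eval ω *
        inner ℝ (V.h j : Lp ℝ 2 P) (V.h k : Lp ℝ 2 P) +
        inner ℝ ((V.F j).D ω) (V.h k : Lp ℝ 2 P) *
        inner ℝ ((V.F k).D ω) (V.h j : Lp ℝ 2 P)) P := fun j k => (iE j k).add (iT j k)
    rw [integral_finsetSum _ fun j _ => integrable_finsetSum _ fun k _ => iET j k]
    refine Finset.sum_congr rfl fun j _ => ?_
    rw [integral_finsetSum _ fun k _ => iET j k]
  have iEv : Integrable (fun ω => ‖V.eval ω‖ ^ 2) P := by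
    simp only [hEv]
    exact integrable_finsetSum _ fun j _ => integrable_finsetSum _ fun k _ => iE j k
  have iTr : Integrable (fun ω => ∑ j, ∑ k, inner ℝ ((V.F j).D ω) (V.h k : Lp ℝ 2 P) *
        inner ℝ ((V.F k).D ω) (V.h j : Lp ℝ 2 P)) P :=
    integrable_finsetSum _ fun j _ => integrable_finsetSum _ fun k _ => iT j k
  rw [hdiv, hsum, ← integral_add iEv iD]
  refine integral_mono (iEv.add iTr) (iEv.add iD) fun ω => ?_
  -- Up to here everything is an identity: E δ(V)² = E‖V‖² + E tr((DV)²). The only loss is to bound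
  -- the trace by the Hilbert–Schmidt norm.
  gcongr
  exact sum_inner_mul_inner_le Finset.univ _ _

/-- The difference of two smooth elementary random variables. -/
noncomputable def sub (V W : SmoothElem P T B i) : SmoothElem P T B i where
  m := V.m + W.m
  F := Fin.append V.F W.F
  h := Fin.append V.h fun k => -W.h k

/-- Value, divergence and ⟨DV, DU⟩ are all sums over the pairs (F_j, h_j), so one rule for the
concatenated family treats the three of them. -/
lemma sum_sub {M : Type*} [AddCommMonoid M] (V W : SmoothElem P T B i)
    (f : SmoothFunctional P T B → hilb P T B i → M) :
    ∑ j, f ((V.sub W).F j) ((V.sub W).h j) =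
      ∑ j, f (V.F j) (V.h j) + ∑ j, f (W.F j) (-W.h j) := by
  refine (Fin.sum_univ_add (a := V.m) (b := W.m) _).trans ?_
  simp [sub]

lemma eval_sub (V W : SmoothElem P T B i) (ω : Ω) : (V.sub W).eval ω = V.eval ω - W.eval ω := by
  refine (V.sum_sub W fun F h => F.eval ω • (h : Lp ℝ 2 P)).trans ?_
  simp [sub_eq_add_neg, eval]

/-- Only almost everywhere, because the representative of −h agrees with minus that of h only up to
a null set. -/
lemma div_sub (V W : SmoothElem P T B i) : (V.sub W).div =ᵐ[P] fun ω => V.div ω - W.div ω := by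
  have h : ∀ᵐ ω ∂P, ∀ k, (-(W.h k : Lp ℝ 2 P) : Lp ℝ 2 P) ω = -(W.h k : Lp ℝ 2 P) ω :=
    ae_all_iff.2 fun k => Lp.coeFn_neg _
  filter_upwards [h] with ω hω
  refine (V.sum_sub W fun F h => F.eval ω * (h : Lp ℝ 2 P) ω -
    inner ℝ (F.D ω) (h : Lp ℝ 2 P)).trans ?_
  simp only [Submodule.coe_neg, hω, inner_neg_right, div]
  rw [sub_eq_add_neg, ← Finset.sum_neg_distrib]
  congr 1
  exact Finset.sum_congr rfl fun k _ => by ring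

lemma innerD_comm (V W : SmoothElem P T B i) (ω : Ω) : V.innerD W ω = W.innerD V ω := by
  rw [innerD, innerD, Finset.sum_comm]
  refine Finset.sum_congr rfl fun j _ => Finset.sum_congr rfl fun k _ => ?_
  rw [real_inner_comm, real_inner_comm (W.h j : Lp ℝ 2 P)]

lemma innerD_sub_left (V W U : SmoothElem P T B i) (ω : Ω) :
    (V.sub W).innerD U ω = V.innerD U ω - W.innerD U ω := by
  refine (V.sum_sub W fun F h => ∑ k, inner ℝ (F.D ω) ((U.F k).D ω) *
    inner ℝ (h : Lp ℝ 2 P) (U.h k : Lp ℝ 2 P)).trans ?_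
  simp only [Submodule.coe_neg, inner_neg_left, mul_neg, Finset.sum_neg_distrib, innerD,
    sub_eq_add_neg]

lemma innerD_sub (V W : SmoothElem P T B i) (ω : Ω) :
    (V.sub W).innerD (V.sub W) ω = V.distDSq W ω := by
  rw [innerD_sub_left, V.innerD_comm, W.innerD_comm, innerD_sub_left, innerD_sub_left, distDSq,
    W.innerD_comm V]
  ring

lemma integral_div_sub_sq_le [IsProbabilityMeasure P] (hB : IsBifBm P H K T B)
    (V W : SmoothElem P T B i) :
    ∫ ω, (V.div ω - W.div ω) ^ 2 ∂P ≤
      ∫ ω, ‖V.eval ω - W.eval ω‖ ^ 2 ∂P + ∫ ω, V.distDSq W ω ∂P := by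
  have h := (V.sub W).integral_div_sq_le hB
  simp only [eval_sub, innerD_sub] at h
  refine le_trans (le_of_eq ?_) h
  refine integral_congr_ae ?_
  filter_upwards [V.div_sub W] with ω hω
  rw [hω]

end SmoothElem

end Divergence
-- Closedness of the divergence operator.
section Divergence

open Set Filter Topology

variable {Ω : Type*} [MeasurableSpace Ω] {P : Measure Ω} {d : ℕ} {H K : Fin d → ℝ} {T : ℝ}
  {B : Fin d → ℝ → Ω → ℝ}

lemma sq_integral_norm_le [IsProbabilityMeasure P] {E : Type*} [NormedAddCommGroup E]
    {f : Ω → E} (hf : MemLp f 2 P) : (∫ ω, ‖f ω‖ ∂P) ^ 2 ≤ ∫ ω, ‖f ω‖ ^ 2 ∂P := by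
  have h := variance_nonneg (fun ω => ‖f ω‖) P
  rw [variance_eq_sub hf.norm] at h
  simpa using h

lemma tendsto_integral_norm_of_sq [IsProbabilityMeasure P] {E : Type*} [NormedAddCommGroup E]
    {f : ℕ → Ω → E} (hf : ∀ n, MemLp (f n) 2 P)
    (h : Tendsto (fun n => ∫ ω, ‖f n ω‖ ^ 2 ∂P) atTop (𝓝 0)) :
    Tendsto (fun n => ∫ ω, ‖f n ω‖ ∂P) atTop (𝓝 0) := by
  have h2 : Tendsto (fun n => Real.sqrt (∫ ω, ‖f n ω‖ ^ 2 ∂P)) atTop (𝓝 0) := by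
    simpa using h.sqrt
  refine squeeze_zero (fun n => integral_nonneg fun _ => norm_nonneg _) (fun n => ?_) h2
  exact Real.le_sqrt_of_sq_le (sq_integral_norm_le (hf n))

lemma IsBifBm.sigmaAlg_le (hB : IsBifBm P H K T B) : sigmaAlg T B ≤ ‹MeasurableSpace Ω› :=
  iSup_le fun i => iSup_le fun t => (hB.measurable i t t.2).comap_le

/-- The divergence is a closed operator; on `𝔻^{1,2}` it is defined everywhere. -/
lemma exists_isDivergence_of_tendsto [IsProbabilityMeasure P] (hB : IsBifBm P H K T B) {i : Fin d}
    {u : Ω → Lp ℝ 2 P} (hu : ∀ᵐ ω ∂P, u ω ∈ hilb P T B i) (hu2 : MemLp u 2 P)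
    (V : ℕ → SmoothElem P T B i)
    (h1 : Tendsto (fun n => ∫ ω, ‖(V n).eval ω - u ω‖ ^ 2 ∂P) atTop (𝓝 0))
    (h2 : Tendsto (fun p : ℕ × ℕ => ∫ ω, (V p.1).distDSq (V p.2) ω ∂P) atTop (𝓝 0))
    (h3 : ∀ n, AEStronglyMeasurable[sigmaAlg T B] (V n).div P) :
    ∃ G : Ω → ℝ, IsDivergence P T B i u G ∧
      Tendsto (fun n => ∫ ω, ‖(V n).div ω - G ω‖ ∂P) atTop (𝓝 0) := by
  have hVu : ∀ n, MemLp (fun ω => (V n).eval ω - u ω) 2 P := fun n => (V n).memLp_eval.sub hu2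
  let X : ℕ → Lp ℝ 2 P := fun n => (V n).memLp_div.toLp _
  have hX : ∀ n, X n =ᵐ[P] (V n).div := fun n => MemLp.coeFn_toLp _
  -- The L² distance of two divergences is bounded by the 𝔻^{1,2} distance; the part without
  -- derivatives is routed through u by ‖x − y‖² ≤ 2‖x‖² + 2‖y‖².
  have hdist : ∀ p : ℕ × ℕ, dist (X p.1) (X p.2) ^ 2 ≤
      2 * ∫ ω, ‖(V p.1).eval ω - u ω‖ ^ 2 ∂P + 2 * ∫ ω, ‖(V p.2).eval ω - u ω‖ ^ 2 ∂P +
        ∫ ω, (V p.1).distDSq (V p.2) ω ∂P := by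
    intro p
    rw [dist_eq_norm, norm_sq_Lp]
    have e : ∫ ω, (X p.1 - X p.2 : Lp ℝ 2 P) ω ^ 2 ∂P =
        ∫ ω, ((V p.1).div ω - (V p.2).div ω) ^ 2 ∂P := by
      refine integral_congr_ae ?_
      filter_upwards [Lp.coeFn_sub (X p.1) (X p.2), hX p.1, hX p.2] with ω a b c
      rw [a, Pi.sub_apply, b, c]
    rw [e]
    refine ((V p.1).integral_div_sub_sq_le hB (V p.2)).trans ?_
    gcongr
    rw [← integral_const_mul, ← integral_const_mul, ← integral_add
      ((hVu p.1).norm.integrable_sq.const_mul 2) ((hVu p.2).norm.integrable_sq.const_mul 2)]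
    refine integral_mono ((V p.1).memLp_eval.sub (V p.2).memLp_eval).norm.integrable_sq
      (((hVu p.1).norm.integrable_sq.const_mul 2).add
        ((hVu p.2).norm.integrable_sq.const_mul 2)) fun ω => ?_
    simp only
    have := norm_sub_le ((V p.1).eval ω - u ω) ((V p.2).eval ω - u ω)
    rw [sub_sub_sub_cancel_right] at this
    nlinarith [sq_nonneg (‖(V p.1).eval ω - u ω‖ - ‖(V p.2).eval ω - u ω‖),
      norm_nonneg ((V p.1).eval ω - (V p.2).eval ω)]
  have hcauchy : CauchySeq X := by
    rw [cauchySeq_iff_tendsto_dist_atTop_0]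
    have hsq : Tendsto (fun p : ℕ × ℕ => dist (X p.1) (X p.2) ^ 2) atTop (𝓝 0) := by
      refine squeeze_zero (fun _ => sq_nonneg _) hdist ?_
      have f1 : Tendsto (Prod.fst : ℕ × ℕ → ℕ) atTop atTop := by
        rw [← prod_atTop_atTop_eq]; exact tendsto_fst
      have f2 : Tendsto (Prod.snd : ℕ × ℕ → ℕ) atTop atTop := by
        rw [← prod_atTop_atTop_eq]; exact tendsto_snd
      simpa using (((h1.comp f1).const_mul 2).add ((h1.comp f2).const_mul 2)).add h2
    have := hsq.sqrt
    simpa [Real.sqrt_sq dist_nonneg] using this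
  obtain ⟨G, hG⟩ := cauchySeq_tendsto_of_complete hcauchy
  have hdG : ∀ n, MemLp (fun ω => (V n).div ω - G ω) 2 P := fun n =>
    (V n).memLp_div.sub (Lp.memLp G)
  have hGsq : Tendsto (fun n => ∫ ω, ‖(V n).div ω - G ω‖ ^ 2 ∂P) atTop (𝓝 0) := by
    have h := (tendsto_iff_norm_sub_tendsto_zero.1 hG).pow 2
    rw [zero_pow two_ne_zero] at h
    refine h.congr fun n => ?_
    rw [norm_sq_Lp]
    refine integral_congr_ae ?_
    filter_upwards [Lp.coeFn_sub (X n) G, hX n] with ω a b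
    rw [a, Pi.sub_apply, b, Real.norm_eq_abs, sq_abs]
  have hG1 := tendsto_integral_norm_of_sq hdG hGsq
  have hu1 := tendsto_integral_norm_of_sq hVu h1
  refine ⟨G, ⟨hu, hu2, Lp.memLp G, ?_, fun F => ?_⟩, hG1⟩
  -- The classes with a σ(B)-measurable representative form a closed subset of L², so measurability
  -- survives the limit.
  · have hcl := isClosed_aestronglyMeasurable (F := ℝ) (p := 2) (μ := P) hB.sigmaAlg_le
    exact hcl.mem_of_tendsto hG (.of_forall fun n => (h3 n).congr (hX n).symm)
  · have bF := F.isBddRV_eval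
    obtain ⟨C, hC⟩ := bF.2
    obtain ⟨C', hC'⟩ := F.exists_bound_D
    have iV : ∀ n, Integrable (V n).div P := fun n => (V n).memLp_div.integrable (by norm_num)
    have iG : Integrable G P := integrable_Lp G
    have l1 : Tendsto (fun n => ∫ ω, F.eval ω * (V n).div ω ∂P) atTop
        (𝓝 (∫ ω, F.eval ω * G ω ∂P)) := by
      rw [tendsto_iff_norm_sub_tendsto_zero]
      refine squeeze_zero (fun _ => norm_nonneg _) (fun n => ?_)
        (by simpa using hG1.const_mul C)
      rw [← integral_sub (bF.mul_integrable (iV n)) (bF.mul_integrable iG), ← integral_const_mul]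
      refine norm_integral_le_of_norm_le (((iV n).sub iG).norm.const_mul C)
        (.of_forall fun ω => ?_)
      rw [← mul_sub, norm_mul]
      exact mul_le_mul_of_nonneg_right (hC ω) (norm_nonneg _)
    have iD : ∀ w : Ω → Lp ℝ 2 P, MemLp w 2 P →
        Integrable (fun ω => inner ℝ (F.D ω) (w ω)) P := by
      intro w hw
      refine Integrable.mono' ((hw.integrable (by norm_num)).norm.const_mul C')
        (F.measurable_D.aestronglyMeasurable.inner hw.1) (.of_forall fun ω => ?_)
      exact (norm_inner_le_norm _ _).trans (mul_le_mul_of_nonneg_right (hC' ω) (norm_nonneg _))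
    have l2 : Tendsto (fun n => ∫ ω, inner ℝ (F.D ω) ((V n).eval ω) ∂P) atTop
        (𝓝 (∫ ω, inner ℝ (F.D ω) (u ω) ∂P)) := by
      rw [tendsto_iff_norm_sub_tendsto_zero]
      refine squeeze_zero (fun _ => norm_nonneg _) (fun n => ?_)
        (by simpa using hu1.const_mul C')
      rw [← integral_sub (iD _ (V n).memLp_eval) (iD _ hu2), ← integral_const_mul]
      refine norm_integral_le_of_norm_le
        (((hVu n).integrable (by norm_num)).norm.const_mul C') (.of_forall fun ω => ?_)
      rw [← inner_sub_right]
      exact (norm_inner_le_norm _ _).trans (mul_le_mul_of_nonneg_right (hC' ω) (norm_nonneg _))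
    refine tendsto_nhds_unique l1 (l2.congr fun n => ((V n).duality hB F).symm)

end Divergence
-- Partitions, step processes and their inner products as kernel integrals.
section Riemann

open Set Filter Topology

variable {Ω : Type*} [MeasurableSpace Ω] {P : Measure Ω} {d : ℕ} {H K : Fin d → ℝ} {T : ℝ}
  {B : Fin d → ℝ → Ω → ℝ} {E : Type*} [NormedAddCommGroup E] [InnerProductSpace ℝ E]

/-- Lebesgue measure on the square `(0, T]²`. -/
noncomputable def squareMeasure (T : ℝ) : Measure (ℝ × ℝ) :=
  (volume.restrict (Ioc 0 T)).prod (volume.restrict (Ioc 0 T))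

/-- The indicator function of `(0, a]`. -/
noncomputable def unitStep (a x : ℝ) : ℝ := (Ioc 0 a).indicator (fun _ => 1) x

lemma measurable_unitStep (a : ℝ) : Measurable (unitStep a) :=
  measurable_const.indicator measurableSet_Ioc

lemma abs_unitStep_le (a x : ℝ) : |unitStep a x| ≤ 1 := by
  unfold unitStep indicator
  split_ifs <;> simp

lemma integral_unitStep_mul {a b : ℝ} (f : ℝ × ℝ → ℝ) (ha : a ≤ T) (hb : b ≤ T) :
    ∫ z, unitStep a z.1 * unitStep b z.2 * f z ∂squareMeasure T =
      ∫ z, f z ∂(volume.restrict (Ioc 0 a)).prod (volume.restrict (Ioc 0 b)) := by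
  have e : ∀ z : ℝ × ℝ, unitStep a z.1 * unitStep b z.2 * f z =
      (Ioc 0 a ×ˢ Ioc 0 b).indicator f z := by
    intro z
    unfold unitStep indicator
    by_cases h1 : z.1 ∈ Ioc 0 a <;> by_cases h2 : z.2 ∈ Ioc 0 b <;> simp [h1, h2, mem_prod]
  simp only [e, squareMeasure]
  rw [integral_indicator (measurableSet_Ioc.prod measurableSet_Ioc), ← Measure.prod_restrict,
    Measure.restrict_restrict measurableSet_Ioc, Measure.restrict_restrict measurableSet_Ioc,
    inter_eq_left.2 (Ioc_subset_Ioc_right ha), inter_eq_left.2 (Ioc_subset_Ioc_right hb)]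

/-- The equidistant partition of `[0, t]`. -/
noncomputable def node (t : ℝ) (n k : ℕ) : ℝ := t * (k / (n + 1))

lemma node_zero (t : ℝ) (n : ℕ) : node t n 0 = 0 := by simp [node]

lemma node_last (t : ℝ) (n : ℕ) : node t n (n + 1) = t := by
  have : (n : ℝ) + 1 ≠ 0 := by positivity
  simp [node, this]

lemma node_mono {t : ℝ} (ht : 0 ≤ t) (n : ℕ) : Monotone (node t n) := fun k l h => by
  unfold node
  gcongr

lemma node_succ_sub (t : ℝ) (n k : ℕ) : node t n (k + 1) - node t n k = t / (n + 1) := by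
  unfold node
  push_cast
  ring

lemma node_mem {t : ℝ} (ht : 0 ≤ t) {n k : ℕ} (hk : k ≤ n + 1) : node t n k ∈ Icc 0 t := by
  constructor
  · rw [← node_zero t n]; exact node_mono ht n k.zero_le
  · conv_rhs => rw [← node_last t n]
    exact node_mono ht n hk

lemma node_mem_of_mem {t : ℝ} (ht : t ∈ Icc 0 T) {n k : ℕ} (hk : k ≤ n + 1) :
    node t n k ∈ Icc 0 T :=
  Icc_subset_Icc_right ht.2 (node_mem ht.1 hk)

/-- The indicator function of the `k`-th interval of the partition. -/
noncomputable def cell (t : ℝ) (n k : ℕ) (x : ℝ) : ℝ :=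
  unitStep (node t n (k + 1)) x - unitStep (node t n k) x

lemma cell_eq {t : ℝ} (ht : 0 ≤ t) (n k : ℕ) (x : ℝ) :
    cell t n k x = (Ioc (node t n k) (node t n (k + 1))).indicator (fun _ => 1) x := by
  have h0 : 0 ≤ node t n k := by
    rw [← node_zero t n]; exact node_mono ht n k.zero_le
  have h1 : node t n k ≤ node t n (k + 1) := node_mono ht n k.le_succ
  unfold cell unitStep indicator
  by_cases a : x ≤ node t n k
  · have : ¬ node t n k < x := not_lt.2 a
    have b : x ≤ node t n (k + 1) := a.trans h1
    simp [mem_Ioc, a, this, b]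
  · have a' : node t n k < x := not_le.1 a
    have b : 0 < x := h0.trans_lt a'
    simp [mem_Ioc, a, a', b]

/-- The step function with value `Y` at the left end point of each interval. -/
noncomputable def stepFun (t : ℝ) (n : ℕ) (Y : ℝ → E) (x : ℝ) : E :=
  ∑ k ∈ Finset.range (n + 1), cell t n k x • Y (node t n k)

lemma exists_node_of_mem {t : ℝ} (n : ℕ) {x : ℝ} (hx : x ∈ Ioc 0 t) :
    ∃ k ≤ n, x ∈ Ioc (node t n k) (node t n (k + 1)) := by
  have hex : ∃ k, x ≤ node t n k := ⟨n + 1, by rw [node_last]; exact hx.2⟩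
  classical
  set m := Nat.find hex
  have hm : x ≤ node t n m := Nat.find_spec hex
  have hm0 : m ≠ 0 := by
    intro h
    rw [h, node_zero] at hm
    exact absurd hx.1 (not_lt.2 hm)
  obtain ⟨k, hk⟩ := Nat.exists_eq_succ_of_ne_zero hm0
  refine ⟨k, ?_, ?_, ?_⟩
  · have : m ≤ n + 1 := Nat.find_min' hex (by rw [node_last]; exact hx.2)
    omega
  · exact not_le.1 (Nat.find_min hex (show k < m by omega))
  · rw [← Nat.succ_eq_add_one, ← hk]; exact hm

lemma stepFun_of_mem {t : ℝ} (ht : 0 ≤ t) {n k : ℕ} (hk : k ≤ n) {x : ℝ}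
    (hx : x ∈ Ioc (node t n k) (node t n (k + 1))) (Y : ℝ → E) :
    stepFun t n Y x = Y (node t n k) := by
  rw [stepFun, Finset.sum_eq_single k]
  · rw [cell_eq ht, indicator_of_mem hx, one_smul]
  · intro l _ hl
    rw [cell_eq ht, indicator_of_notMem, zero_smul]
    intro hx'
    rcases lt_or_gt_of_ne hl with h | h
    · exact absurd (hx'.2.trans (node_mono ht n (show l + 1 ≤ k from h))) (not_le.2 hx.1)
    · exact absurd (hx.2.trans (node_mono ht n (show k + 1 ≤ l from h))) (not_le.2 hx'.1)
  · intro h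
    exact absurd (Finset.mem_range.2 (by omega)) h

lemma stepFun_of_notMem {t : ℝ} (ht : 0 ≤ t) (n : ℕ) {x : ℝ} (hx : x ∉ Ioc 0 t) (Y : ℝ → E) :
    stepFun t n Y x = 0 := by
  refine Finset.sum_eq_zero fun k hk => ?_
  rw [cell_eq ht, indicator_of_notMem, zero_smul]
  intro h
  have hk' : k + 1 ≤ n + 1 := by simpa using Finset.mem_range.1 hk
  exact hx ⟨(node_mem ht (by omega)).1.trans_lt h.1, h.2.trans (node_mem ht hk').2⟩

lemma norm_stepFun_le {t : ℝ} (ht : 0 ≤ t) (n : ℕ) {Y : ℝ → E} {C : ℝ} (hC0 : 0 ≤ C)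
    (hC : ∀ s ∈ Icc 0 t, ‖Y s‖ ≤ C) (x : ℝ) : ‖stepFun t n Y x‖ ≤ C := by
  by_cases hx : x ∈ Ioc 0 t
  · obtain ⟨k, hk, hxk⟩ := exists_node_of_mem n hx
    rw [stepFun_of_mem ht hk hxk]
    exact hC _ (node_mem ht (by omega))
  · rw [stepFun_of_notMem ht n hx, norm_zero]; exact hC0

lemma tendsto_mesh (t : ℝ) : Tendsto (fun n : ℕ => t / ((n : ℝ) + 1)) atTop (𝓝 0) := by
  simpa [div_eq_mul_inv] using (tendsto_one_div_add_atTop_nhds_zero_nat (𝕜 := ℝ)).const_mul t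

/-- Uniform continuity of Z controls the distance to the left end point, and uniform convergence
controls the change of function. The values Y n may depend on n because mollification and mesh are
refined together. -/
lemma tendstoUniformly_stepFun {t : ℝ} (ht : 0 ≤ t) {Y : ℕ → ℝ → E} {Z : ℝ → E}
    (hY : TendstoUniformlyOn Y Z atTop (Icc 0 t)) (hZ : ContinuousOn Z (Icc 0 t)) :
    TendstoUniformly (fun n => stepFun t n (Y n)) ((Ioc 0 t).indicator Z) atTop := by
  rw [Metric.tendstoUniformly_iff]
  intro ε hε
  obtain ⟨δ, hδ, hδ'⟩ := Metric.uniformContinuousOn_iff.1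
    (isCompact_Icc.uniformContinuousOn_of_continuous hZ) (ε / 2) (half_pos hε)
  filter_upwards [Metric.tendstoUniformlyOn_iff.1 hY (ε / 2) (half_pos hε),
    (tendsto_mesh t).eventually_lt_const hδ] with n h1 h2 x
  by_cases hx : x ∈ Ioc 0 t
  · obtain ⟨k, hk, hxk⟩ := exists_node_of_mem n hx
    rw [stepFun_of_mem ht hk hxk, indicator_of_mem hx]
    have hn : node t n k ∈ Icc 0 t := node_mem ht (by omega)
    have hd : dist x (node t n k) < δ := by
      rw [Real.dist_eq, abs_of_pos (sub_pos.2 hxk.1)]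
      have := node_succ_sub t n k
      linarith [hxk.2]
    calc _ ≤ dist (Z x) (Z (node t n k)) + dist (Z (node t n k)) (Y n (node t n k)) :=
          dist_triangle _ _ _
      _ < ε / 2 + ε / 2 := add_lt_add (hδ' x ⟨hx.1.le, hx.2⟩ _ hn hd) (h1 _ hn)
      _ = ε := add_halves ε
  · rw [stepFun_of_notMem ht n hx, indicator_of_notMem hx, dist_self]
    exact hε

lemma stronglyMeasurable_stepFun (t : ℝ) (n : ℕ) (Y : ℝ → E) :
    StronglyMeasurable (stepFun t n Y) :=
  Finset.stronglyMeasurable_fun_sum _ fun _ _ => StronglyMeasurable.smul_const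
    ((measurable_unitStep _).sub (measurable_unitStep _)).stronglyMeasurable _

/-- The standing assumptions on the parameters of one component. -/
structure IsParam (H K : ℝ) : Prop where
  pos : 0 < H
  mem : K ∈ Ioc (0 : ℝ) 1
  one_lt : 1 < 2 * H * K

lemma isParam_of {h k : ℝ} (hH : h ∈ Icc (0 : ℝ) 1) (hK : k ∈ Ioc (0 : ℝ) 1)
    (hHK : 1 < 2 * h * k) : IsParam h k :=
  ⟨by
    rcases hH.1.eq_or_lt with h0 | h0
    · rw [← h0] at hHK; norm_num at hHK
    · exact h0, hK, hHK⟩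

lemma IsParam.integrable {h k : ℝ} (hp : IsParam h k) (hT : 0 ≤ T) :
    Integrable (fun z : ℝ × ℝ => covMixedDeriv h k z.1 z.2) (squareMeasure T) :=
  integrable_covMixedDeriv hp.mem hp.one_lt hT

/-- The increment of the `i`-th component over the `k`-th interval. -/
noncomputable def incr (P : Measure Ω) (B : Fin d → ℝ → Ω → ℝ) (i : Fin d) (t : ℝ) (n k : ℕ) :
    Lp ℝ 2 P :=
  ind P B i (node t n (k + 1)) - ind P B i (node t n k)

lemma incr_mem_hilb {t : ℝ} (ht : t ∈ Icc 0 T) (i : Fin d) {n k : ℕ} (hk : k ≤ n) :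
    incr P B i t n k ∈ hilb P T B i :=
  Submodule.sub_mem _ (ind_mem_hilb i (node_mem_of_mem ht (by omega)))
    (ind_mem_hilb i (node_mem_of_mem ht (by omega)))

lemma IsBifBm.inner_ind_eq_integral (hB : IsBifBm P H K T B) {i : Fin d}
    (hp : IsParam (H i) (K i)) {a b : ℝ} (ha : a ∈ Icc 0 T) (hb : b ∈ Icc 0 T) :
    inner ℝ (ind P B i a) (ind P B i b) =
      ∫ z, unitStep a z.1 * unitStep b z.2 * covMixedDeriv (H i) (K i) z.1 z.2
        ∂squareMeasure T := by
  rw [hB.inner_ind_self i ha hb, integral_unitStep_mul _ ha.2 hb.2,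
    integral_covMixedDeriv hp.pos hp.mem hp.one_lt ha.1 hb.1]

lemma IsParam.integrable_mul {h k : ℝ} (hp : IsParam h k) (hT : 0 ≤ T) {f : ℝ × ℝ → ℝ}
    (hf : Measurable f) {C : ℝ} (hC : ∀ z, |f z| ≤ C) :
    Integrable (fun z : ℝ × ℝ => f z * covMixedDeriv h k z.1 z.2) (squareMeasure T) :=
  (hp.integrable hT).bdd_mul hf.aestronglyMeasurable (.of_forall hC)

lemma IsParam.integrable_unitStep {h k : ℝ} (hp : IsParam h k) (hT : 0 ≤ T) (a b : ℝ) :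
    Integrable (fun z : ℝ × ℝ => unitStep a z.1 * unitStep b z.2 * covMixedDeriv h k z.1 z.2)
      (squareMeasure T) := by
  refine hp.integrable_mul hT (C := 1) (((measurable_unitStep a).comp measurable_fst).mul
    ((measurable_unitStep b).comp measurable_snd)) fun z => ?_
  rw [abs_mul]
  exact mul_le_one₀ (abs_unitStep_le _ _) (abs_nonneg _) (abs_unitStep_le _ _)

lemma IsBifBm.inner_incr_ind (hB : IsBifBm P H K T B) {i : Fin d}
    (hp : IsParam (H i) (K i)) {t : ℝ} (ht : t ∈ Icc 0 T) {n k : ℕ} (hk : k ≤ n) {b : ℝ}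
    (hb : b ∈ Icc 0 T) :
    inner ℝ (incr P B i t n k) (ind P B i b) =
      ∫ z, cell t n k z.1 * unitStep b z.2 * covMixedDeriv (H i) (K i) z.1 z.2
        ∂squareMeasure T := by
  have hT : 0 ≤ T := ht.1.trans ht.2
  rw [incr, inner_sub_left, hB.inner_ind_eq_integral hp (node_mem_of_mem ht (by omega)) hb,
    hB.inner_ind_eq_integral hp (node_mem_of_mem ht (by omega)) hb,
    ← integral_sub (hp.integrable_unitStep hT _ _) (hp.integrable_unitStep hT _ _)]
  congr 1; ext z; unfold cell; ring

lemma abs_cell_le (t : ℝ) (n k : ℕ) (x : ℝ) : |cell t n k x| ≤ 2 := by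
  have h := abs_sub (unitStep (node t n (k + 1)) x) (unitStep (node t n k) x)
  have h1 := abs_unitStep_le (node t n (k + 1)) x
  have h2 := abs_unitStep_le (node t n k) x
  unfold cell
  linarith

lemma measurable_cell (t : ℝ) (n k : ℕ) : Measurable (cell t n k) :=
  (measurable_unitStep _).sub (measurable_unitStep _)

lemma IsBifBm.inner_incr_incr (hB : IsBifBm P H K T B) {i : Fin d}
    (hp : IsParam (H i) (K i)) {t : ℝ} (ht : t ∈ Icc 0 T) {n k m l : ℕ} (hk : k ≤ n)
    (hl : l ≤ m) :
    inner ℝ (incr P B i t n k) (incr P B i t m l) =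
      ∫ z, cell t n k z.1 * cell t m l z.2 * covMixedDeriv (H i) (K i) z.1 z.2
        ∂squareMeasure T := by
  have hT : 0 ≤ T := ht.1.trans ht.2
  have hi : ∀ b, Integrable (fun z : ℝ × ℝ => cell t n k z.1 * unitStep b z.2 *
      covMixedDeriv (H i) (K i) z.1 z.2) (squareMeasure T) := by
    intro b
    refine hp.integrable_mul hT (C := 2 * 1) (((measurable_cell t n k).comp measurable_fst).mul
      ((measurable_unitStep b).comp measurable_snd)) fun z => ?_
    rw [abs_mul]
    exact mul_le_mul (abs_cell_le _ _ _ _) (abs_unitStep_le _ _) (abs_nonneg _) zero_le_two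
  rw [show incr P B i t m l = ind P B i (node t m (l + 1)) -
    ind P B i (node t m l) from rfl,
    inner_sub_right, hB.inner_incr_ind hp ht hk (node_mem_of_mem ht (by omega)),
    hB.inner_incr_ind hp ht hk (node_mem_of_mem ht (by omega)), ← integral_sub (hi _) (hi _)]
  congr 1; ext z; simp only [cell]; ring

variable (P B) in
/-- The inner product of two step processes in the tensor product of `E` with the Gaussian
space. -/
noncomputable def stepInner (i : Fin d) (t : ℝ) (n m : ℕ) (Y Z : ℝ → E) : ℝ :=
  ∑ k ∈ Finset.range (n + 1), ∑ l ∈ Finset.range (m + 1),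
    inner ℝ (Y (node t n k)) (Z (node t m l)) *
      inner ℝ (incr P B i t n k) (incr P B i t m l)

/-- By bilinearity it suffices to treat two cells. With E = ℝ this is the inner product of
integrands in ℋ_i; with E = L²(Ω) it is the inner product of derivatives in ℋ ⊗ ℋ_i. -/
lemma IsBifBm.stepInner_eq (hB : IsBifBm P H K T B) {i : Fin d}
    (hp : IsParam (H i) (K i)) {t : ℝ} (ht : t ∈ Icc 0 T) (n m : ℕ) (Y Z : ℝ → E) :
    stepInner P B i t n m Y Z =
      ∫ z, inner ℝ (stepFun t n Y z.1) (stepFun t m Z z.2) *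
        covMixedDeriv (H i) (K i) z.1 z.2 ∂squareMeasure T := by
  have hT : 0 ≤ T := ht.1.trans ht.2
  have hi : ∀ k l, Integrable (fun z : ℝ × ℝ => cell t n k z.1 * cell t m l z.2 *
      covMixedDeriv (H i) (K i) z.1 z.2) (squareMeasure T) := by
    intro k l
    refine hp.integrable_mul hT (C := 2 * 2) (((measurable_cell t n k).comp measurable_fst).mul
      ((measurable_cell t m l).comp measurable_snd)) fun z => ?_
    rw [abs_mul]
    exact mul_le_mul (abs_cell_le _ _ _ _) (abs_cell_le _ _ _ _) (abs_nonneg _) zero_le_two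
  have e : ∀ z : ℝ × ℝ, inner ℝ (stepFun t n Y z.1) (stepFun t m Z z.2) *
      covMixedDeriv (H i) (K i) z.1 z.2 = ∑ k ∈ Finset.range (n + 1),
      ∑ l ∈ Finset.range (m + 1), inner ℝ (Y (node t n k)) (Z (node t m l)) *
        (cell t n k z.1 * cell t m l z.2 * covMixedDeriv (H i) (K i) z.1 z.2) := by
    intro z
    rw [stepFun, sum_inner, Finset.sum_mul]
    refine Finset.sum_congr rfl fun k _ => ?_
    rw [stepFun, inner_sum, Finset.sum_mul]
    refine Finset.sum_congr rfl fun l _ => ?_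
    rw [real_inner_smul_left, real_inner_smul_right]
    ring
  simp only [e]
  rw [integral_finsetSum _ fun k _ => integrable_finsetSum _ fun l _ => (hi k l).const_mul _]
  refine Finset.sum_congr rfl fun k hk => ?_
  rw [integral_finsetSum _ fun l _ => (hi k l).const_mul _]
  refine Finset.sum_congr rfl fun l hl => ?_
  rw [integral_const_mul, hB.inner_incr_incr hp ht (Finset.mem_range_succ_iff.1 hk)
    (Finset.mem_range_succ_iff.1 hl)]

end Riemann
-- Continuous functions as elements of ℋ_i.
section WienerIntegral

open Set Filter Topology

variable {Ω : Type*} [MeasurableSpace Ω] {P : Measure Ω} {d : ℕ} {H K : Fin d → ℝ} {T : ℝ}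
  {B : Fin d → ℝ → Ω → ℝ} {E : Type*} [NormedAddCommGroup E] [InnerProductSpace ℝ E]

/-- The total mass of the mixed derivative. -/
noncomputable def kernelMass (H K T : ℝ) : ℝ :=
  ∫ z, |covMixedDeriv H K z.1 z.2| ∂squareMeasure T

/-- The sign of the kernel plays no role: only the total mass of its absolute value enters. -/
lemma IsBifBm.abs_stepInner_le (hB : IsBifBm P H K T B) {i : Fin d} (hp : IsParam (H i) (K i))
    {t : ℝ} (ht : t ∈ Icc 0 T) (n m : ℕ) {Y Z : ℝ → E} {C C' : ℝ} (hC0 : 0 ≤ C) (hC0' : 0 ≤ C')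
    (hC : ∀ s ∈ Icc 0 t, ‖Y s‖ ≤ C) (hC' : ∀ s ∈ Icc 0 t, ‖Z s‖ ≤ C') :
    |stepInner P B i t n m Y Z| ≤ C * C' * kernelMass (H i) (K i) T := by
  have hT : 0 ≤ T := ht.1.trans ht.2
  rw [hB.stepInner_eq hp ht, kernelMass, ← integral_const_mul, ← Real.norm_eq_abs]
  refine norm_integral_le_of_norm_le ((hp.integrable hT).abs.const_mul _) (.of_forall fun z => ?_)
  rw [norm_mul]
  refine mul_le_mul_of_nonneg_right ((norm_inner_le_norm _ _).trans ?_) (norm_nonneg _)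
  exact mul_le_mul (norm_stepFun_le ht.1 n hC0 hC _) (norm_stepFun_le ht.1 m hC0' hC' _)
    (norm_nonneg _) hC0

lemma eventually_bound_of_tendstoUniformlyOn {F : Type*} [NormedAddCommGroup F] {t : ℝ}
    {Y : ℕ → ℝ → F} {Z : ℝ → F}
    (hY : TendstoUniformlyOn Y Z atTop (Icc 0 t)) (hZ : ContinuousOn Z (Icc 0 t)) :
    ∃ C : ℝ, 0 ≤ C ∧ (∀ s ∈ Icc 0 t, ‖Z s‖ ≤ C) ∧
      ∀ᶠ n in atTop, ∀ s ∈ Icc 0 t, ‖Y n s‖ ≤ C := by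
  obtain ⟨C, hC⟩ := isCompact_Icc.exists_bound_of_continuousOn hZ
  refine ⟨max C 0 + 1, by positivity, fun s hs =>
    (hC s hs).trans ((le_max_left _ _).trans (by linarith)), ?_⟩
  filter_upwards [Metric.tendstoUniformlyOn_iff.1 hY 1 one_pos] with n hn s hs
  have h1 := hn s hs
  rw [dist_comm, dist_eq_norm] at h1
  have h2 := norm_sub_norm_le (Y n s) (Z s)
  linarith [hC s hs, le_max_left C 0]

/-- Dominated convergence with a majorant C²|∂²R/∂u∂v|. The two partition indices run along an
arbitrary countably generated filter, so squared norms and mixed products are covered at once. -/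
lemma IsBifBm.tendsto_stepInner (hB : IsBifBm P H K T B) {i : Fin d} (hp : IsParam (H i) (K i))
    {t : ℝ} (ht : t ∈ Icc 0 T) {Y : ℕ → ℝ → E} {Z : ℝ → E}
    (hY : TendstoUniformlyOn Y Z atTop (Icc 0 t)) (hZ : ContinuousOn Z (Icc 0 t))
    {ι : Type*} {l : Filter ι} [l.IsCountablyGenerated] {n m : ι → ℕ} (hn : Tendsto n l atTop)
    (hm : Tendsto m l atTop) :
    Tendsto (fun a => stepInner P B i t (n a) (m a) (Y (n a)) (Y (m a))) l
      (𝓝 (∫ z, inner ℝ ((Ioc 0 t).indicator Z z.1) ((Ioc 0 t).indicator Z z.2) *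
        covMixedDeriv (H i) (K i) z.1 z.2 ∂squareMeasure T)) := by
  have hT : 0 ≤ T := ht.1.trans ht.2
  obtain ⟨C, hC0, -, hC⟩ := eventually_bound_of_tendstoUniformlyOn hY hZ
  simp only [hB.stepInner_eq hp ht]
  have hU := tendstoUniformly_stepFun ht.1 hY hZ
  refine tendsto_integral_filter_of_dominated_convergence
    (fun z => C * C * |covMixedDeriv (H i) (K i) z.1 z.2|) (.of_forall fun a => ?_) ?_
    ((hp.integrable hT).abs.const_mul _) (.of_forall fun z => ?_)
  · exact (((stronglyMeasurable_stepFun t (n a) (Y (n a))).comp_measurable measurable_fst).inner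
      ((stronglyMeasurable_stepFun t (m a) (Y (m a))).comp_measurable
        measurable_snd)).aestronglyMeasurable.mul (hp.integrable hT).aestronglyMeasurable
  · filter_upwards [hn.eventually hC, hm.eventually hC] with a h1 h2
    refine .of_forall fun z => ?_
    rw [norm_mul]
    refine mul_le_mul_of_nonneg_right ((norm_inner_le_norm _ _).trans ?_) (norm_nonneg _)
    exact mul_le_mul (norm_stepFun_le ht.1 _ hC0 h1 _) (norm_stepFun_le ht.1 _ hC0 h2 _)
      (norm_nonneg _) hC0
  · exact (((hU.tendsto_at z.1).comp hn).inner ((hU.tendsto_at z.2).comp hm)).mul_const _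

lemma tendsto_fst_atTop : Tendsto (Prod.fst : ℕ × ℕ → ℕ) atTop atTop := by
  rw [← prod_atTop_atTop_eq]; exact tendsto_fst

lemma tendsto_snd_atTop : Tendsto (Prod.snd : ℕ × ℕ → ℕ) atTop atTop := by
  rw [← prod_atTop_atTop_eq]; exact tendsto_snd

/-- The three terms of the polarised square have a common limit I, and I − 2I + I = 0. With E = ℝ
the Riemann sums are thus Cauchy; with E = L²(Ω) this is the Cauchy condition on derivatives in
`MemSobolev`. -/
lemma IsBifBm.tendsto_stepInner_sub (hB : IsBifBm P H K T B) {i : Fin d}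
    (hp : IsParam (H i) (K i)) {t : ℝ} (ht : t ∈ Icc 0 T) {Y : ℕ → ℝ → E} {Z : ℝ → E}
    (hY : TendstoUniformlyOn Y Z atTop (Icc 0 t)) (hZ : ContinuousOn Z (Icc 0 t)) :
    Tendsto (fun p : ℕ × ℕ => stepInner P B i t p.1 p.1 (Y p.1) (Y p.1) -
      2 * stepInner P B i t p.1 p.2 (Y p.1) (Y p.2) +
      stepInner P B i t p.2 p.2 (Y p.2) (Y p.2)) atTop (𝓝 0) := by
  have h1 := hB.tendsto_stepInner hp ht hY hZ tendsto_fst_atTop tendsto_fst_atTop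
  have h2 := hB.tendsto_stepInner hp ht hY hZ tendsto_fst_atTop tendsto_snd_atTop
  have h3 := hB.tendsto_stepInner hp ht hY hZ tendsto_snd_atTop tendsto_snd_atTop
  have := (h1.sub (h2.const_mul 2)).add h3
  refine this.congr' (.of_forall fun _ => rfl) |>.trans_eq ?_
  ring_nf

variable (P B) in
/-- The integral of a step process against the `i`-th component, as an element of `ℋ_i`. -/
noncomputable def riemannSum (i : Fin d) (t : ℝ) (n : ℕ) (Y : ℝ → ℝ) : Lp ℝ 2 P :=
  ∑ k ∈ Finset.range (n + 1), Y (node t n k) • incr P B i t n k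

variable (P B) in
/-- The element of `ℋ_i` represented by the restriction of a continuous function to `[0, t]`. -/
noncomputable def toHilb (i : Fin d) (t : ℝ) (Y : ℝ → ℝ) : Lp ℝ 2 P :=
  limUnder atTop fun n => riemannSum P B i t n Y

lemma riemannSum_mem_hilb {t : ℝ} (ht : t ∈ Icc 0 T) (i : Fin d) (n : ℕ) (Y : ℝ → ℝ) :
    riemannSum P B i t n Y ∈ hilb P T B i :=
  Submodule.sum_mem _ fun _ hk => Submodule.smul_mem _ _
    (incr_mem_hilb ht i (Finset.mem_range_succ_iff.1 hk))

lemma inner_riemannSum (i : Fin d) (t : ℝ) (n m : ℕ) (Y Z : ℝ → ℝ) :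
    inner ℝ (riemannSum P B i t n Y) (riemannSum P B i t m Z) = stepInner P B i t n m Y Z := by
  rw [riemannSum, sum_inner, stepInner]
  refine Finset.sum_congr rfl fun k _ => ?_
  rw [riemannSum, inner_sum]
  refine Finset.sum_congr rfl fun l _ => ?_
  rw [real_inner_smul_left, real_inner_smul_right, ← mul_assoc]
  congr 1
  simp [mul_comm]

lemma dist_riemannSum_sq (i : Fin d) (t : ℝ) (n m : ℕ) (Y Z : ℝ → ℝ) :
    dist (riemannSum P B i t n Y) (riemannSum P B i t m Z) ^ 2 =
      stepInner P B i t n n Y Y - 2 * stepInner P B i t n m Y Z + stepInner P B i t m m Z Z := by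
  rw [dist_eq_norm, norm_sub_sq_real, ← real_inner_self_eq_norm_sq, ← real_inner_self_eq_norm_sq,
    inner_riemannSum, inner_riemannSum, inner_riemannSum]

lemma riemannSum_sub (i : Fin d) (t : ℝ) (n : ℕ) (Y Z : ℝ → ℝ) :
    riemannSum P B i t n (fun s => Y s - Z s) =
      riemannSum P B i t n Y - riemannSum P B i t n Z := by
  simp only [riemannSum, sub_smul, Finset.sum_sub_distrib]

lemma riemannSum_congr {t : ℝ} (ht : 0 ≤ t) (i : Fin d) (n : ℕ) {Y Z : ℝ → ℝ}
    (h : ∀ s ∈ Icc 0 t, Y s = Z s) : riemannSum P B i t n Y = riemannSum P B i t n Z :=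
  Finset.sum_congr rfl fun k hk => by
    rw [h _ (node_mem ht (by have := Finset.mem_range.1 hk; omega))]

lemma toHilb_congr {t : ℝ} (ht : 0 ≤ t) (i : Fin d) {Y Z : ℝ → ℝ}
    (h : ∀ s ∈ Icc 0 t, Y s = Z s) : toHilb P B i t Y = toHilb P B i t Z := by
  simp only [toHilb, riemannSum_congr ht i _ h]

/-- Shows that the `limUnder` in `toHilb` is a genuine limit, by the Cauchy property and
completeness of L². -/
lemma IsBifBm.tendsto_riemannSum_const (hB : IsBifBm P H K T B) {i : Fin d}
    (hp : IsParam (H i) (K i)) {t : ℝ} (ht : t ∈ Icc 0 T) {Z : ℝ → ℝ}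
    (hZ : ContinuousOn Z (Icc 0 t)) :
    Tendsto (fun n => riemannSum P B i t n Z) atTop (𝓝 (toHilb P B i t Z)) := by
  refine CauchySeq.tendsto_limUnder ?_
  rw [cauchySeq_iff_tendsto_dist_atTop_0]
  have h := hB.tendsto_stepInner_sub hp ht (Y := fun _ => Z)
    (Metric.tendstoUniformlyOn_iff.2 fun ε hε => .of_forall fun _ _ _ => by simpa using hε) hZ
  simp only [← dist_riemannSum_sq] at h
  simpa [Real.sqrt_sq dist_nonneg] using h.sqrt

lemma IsBifBm.tendsto_riemannSum (hB : IsBifBm P H K T B) {i : Fin d}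
    (hp : IsParam (H i) (K i)) {t : ℝ} (ht : t ∈ Icc 0 T) {Y : ℕ → ℝ → ℝ} {Z : ℝ → ℝ}
    (hY : TendstoUniformlyOn Y Z atTop (Icc 0 t)) (hZ : ContinuousOn Z (Icc 0 t)) :
    Tendsto (fun n => riemannSum P B i t n (Y n)) atTop (𝓝 (toHilb P B i t Z)) := by
  have h0 : Tendsto (fun n => riemannSum P B i t n (Y n) - riemannSum P B i t n Z) atTop (𝓝 0) := by
    simp only [← riemannSum_sub]
    rw [tendsto_zero_iff_norm_tendsto_zero]
    have hU : TendstoUniformlyOn (fun n s => Y n s - Z s) (fun _ => (0 : ℝ)) atTop (Icc 0 t) := by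
      rw [Metric.tendstoUniformlyOn_iff] at hY ⊢
      intro ε hε
      filter_upwards [hY ε hε] with n hn s hs
      have := hn s hs
      rwa [dist_comm, dist_zero_right, ← dist_eq_norm, dist_comm]
    -- For Y n − Z the uniform limit is 0, so the limiting kernel integral, which is the limit of
    -- the squared norms, is 0.
    have h := hB.tendsto_stepInner hp ht hU continuousOn_const tendsto_id tendsto_id
    simp only [id, ← inner_riemannSum, real_inner_self_eq_norm_sq] at h
    simpa [Real.sqrt_sq (norm_nonneg _)] using h.sqrt
  simpa using h0.add (hB.tendsto_riemannSum_const hp ht hZ)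

lemma IsBifBm.toHilb_mem_hilb (hB : IsBifBm P H K T B) {i : Fin d}
    (hp : IsParam (H i) (K i)) {t : ℝ} (ht : t ∈ Icc 0 T) {Z : ℝ → ℝ}
    (hZ : ContinuousOn Z (Icc 0 t)) : toHilb P B i t Z ∈ hilb P T B i :=
  (Submodule.isClosed_topologicalClosure _).mem_of_tendsto (hB.tendsto_riemannSum_const hp ht hZ)
    (.of_forall fun n => riemannSum_mem_hilb ht i n Z)

lemma IsBifBm.norm_riemannSum_sq_le (hB : IsBifBm P H K T B) {i : Fin d}
    (hp : IsParam (H i) (K i)) {t : ℝ} (ht : t ∈ Icc 0 T) (n : ℕ) {Z : ℝ → ℝ} {C : ℝ}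
    (hC0 : 0 ≤ C) (hC : ∀ s ∈ Icc 0 t, |Z s| ≤ C) :
    ‖riemannSum P B i t n Z‖ ^ 2 ≤ C * C * kernelMass (H i) (K i) T := by
  rw [← real_inner_self_eq_norm_sq, inner_riemannSum]
  exact (le_abs_self _).trans (hB.abs_stepInner_le hp ht n n hC0 hC0 hC hC)

lemma IsBifBm.norm_toHilb_sq_le (hB : IsBifBm P H K T B) {i : Fin d}
    (hp : IsParam (H i) (K i)) {t : ℝ} (ht : t ∈ Icc 0 T) {Z : ℝ → ℝ}
    (hZ : ContinuousOn Z (Icc 0 t)) {C : ℝ}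
    (hC0 : 0 ≤ C) (hC : ∀ s ∈ Icc 0 t, |Z s| ≤ C) :
    ‖toHilb P B i t Z‖ ^ 2 ≤ C * C * kernelMass (H i) (K i) T :=
  le_of_tendsto ((hB.tendsto_riemannSum_const hp ht hZ).norm.pow 2)
    (.of_forall fun n => hB.norm_riemannSum_sq_le hp ht n hC0 hC)

lemma IsBifBm.inner_toHilb_ind (hB : IsBifBm P H K T B) {i : Fin d}
    (hp : IsParam (H i) (K i)) {t : ℝ} (ht : t ∈ Icc 0 T) {Z : ℝ → ℝ}
    (hZ : ContinuousOn Z (Icc 0 t)) {r : ℝ} (hr : r ∈ Icc 0 T) :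
    inner ℝ (toHilb P B i t Z) (ind P B i r) =
      ∫ z, (Ioc 0 t).indicator Z z.1 * unitStep r z.2 * covMixedDeriv (H i) (K i) z.1 z.2
        ∂squareMeasure T := by
  have hT : 0 ≤ T := ht.1.trans ht.2
  obtain ⟨C, hC⟩ := isCompact_Icc.exists_bound_of_continuousOn hZ
  have hC' : ∀ s ∈ Icc 0 t, ‖Z s‖ ≤ max C 0 := fun s hs => (hC s hs).trans (le_max_left _ _)
  have hU := tendstoUniformly_stepFun ht.1 (Y := fun _ => Z)
    (Metric.tendstoUniformlyOn_iff.2 fun ε hε => .of_forall fun _ _ _ => by simpa using hε) hZ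
  have h1 := Filter.Tendsto.inner (𝕜 := ℝ) (hB.tendsto_riemannSum_const hp ht hZ)
    (tendsto_const_nhds (x := ind P B i r))
  refine tendsto_nhds_unique h1 ?_
  have hm : ∀ n, AEStronglyMeasurable (fun z : ℝ × ℝ => stepFun t n Z z.1 * unitStep r z.2)
      (squareMeasure T) := fun n =>
    ((stronglyMeasurable_stepFun t n Z).comp_measurable measurable_fst).aestronglyMeasurable.mul
      ((measurable_unitStep r).comp measurable_snd).aestronglyMeasurable
  have e : ∀ n, inner ℝ (riemannSum P B i t n Z) (ind P B i r) =
      ∫ z, stepFun t n Z z.1 * unitStep r z.2 * covMixedDeriv (H i) (K i) z.1 z.2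
        ∂squareMeasure T := by
    intro n
    have hi : ∀ k, Integrable (fun z : ℝ × ℝ => cell t n k z.1 * unitStep r z.2 *
        covMixedDeriv (H i) (K i) z.1 z.2) (squareMeasure T) := by
      intro k
      refine hp.integrable_mul hT (C := 2 * 1) (((measurable_cell t n k).comp measurable_fst).mul
        ((measurable_unitStep r).comp measurable_snd)) fun z => ?_
      rw [abs_mul]
      exact mul_le_mul (abs_cell_le _ _ _ _) (abs_unitStep_le _ _) (abs_nonneg _) zero_le_two
    have e2 : ∀ z : ℝ × ℝ, stepFun t n Z z.1 * unitStep r z.2 *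
        covMixedDeriv (H i) (K i) z.1 z.2 = ∑ k ∈ Finset.range (n + 1), Z (node t n k) *
        (cell t n k z.1 * unitStep r z.2 * covMixedDeriv (H i) (K i) z.1 z.2) := by
      intro z
      rw [stepFun, Finset.sum_mul, Finset.sum_mul]
      refine Finset.sum_congr rfl fun k _ => ?_
      rw [smul_eq_mul]; ring
    simp only [e2]
    rw [integral_finsetSum _ fun k _ => (hi k).const_mul _, riemannSum, sum_inner]
    refine Finset.sum_congr rfl fun k hk => ?_
    rw [integral_const_mul, real_inner_smul_left,
      hB.inner_incr_ind hp ht (Finset.mem_range_succ_iff.1 hk) hr]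
  simp only [e]
  refine tendsto_integral_of_dominated_convergence
    (fun z => max C 0 * |covMixedDeriv (H i) (K i) z.1 z.2|)
    (fun n => (hm n).mul (hp.integrable hT).aestronglyMeasurable)
    ((hp.integrable hT).abs.const_mul _) (fun n => .of_forall fun z => ?_)
    (.of_forall fun z => ((hU.tendsto_at z.1).mul_const _).mul_const _)
  rw [norm_mul, norm_mul]
  refine mul_le_mul_of_nonneg_right ?_ (norm_nonneg _)
  calc _ ≤ max C 0 * 1 := mul_le_mul (norm_stepFun_le ht.1 n (le_max_right _ _) hC' _)
        (abs_unitStep_le _ _) (abs_nonneg _) (le_max_right _ _)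
    _ = _ := mul_one _

/-- A function bounded on [0,t] is in |ℋ_i| because the kernel is absolutely integrable; Fubini
turns the pairing with 1_{[0,r]} into the iterated integral. -/
lemma IsBifBm.isFunction_toHilb (hB : IsBifBm P H K T B) {i : Fin d}
    (hp : IsParam (H i) (K i)) {t : ℝ} (ht : t ∈ Icc 0 T) {Z : ℝ → ℝ}
    (hZ : ContinuousOn Z (Icc 0 t)) :
    IsFunction P T B H K i ((Icc 0 t).indicator Z) (toHilb P B i t Z) := by
  have hT : 0 ≤ T := ht.1.trans ht.2
  obtain ⟨C, hC⟩ := isCompact_Icc.exists_bound_of_continuousOn hZ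
  have hbd : ∀ s, |(Icc 0 t).indicator Z s| ≤ max C 0 := by
    intro s
    by_cases hs : s ∈ Icc 0 t
    · rw [indicator_of_mem hs]; exact (hC s hs).trans (le_max_left _ _)
    · rw [indicator_of_notMem hs]; simp
  have hZm : AEMeasurable ((Icc 0 t).indicator Z) volume :=
    (aemeasurable_indicator_iff measurableSet_Icc).2 (hZ.aemeasurable measurableSet_Icc)
  have hint := hp.integrable (T := T) hT
  refine ⟨hB.toHilb_mem_hilb hp ht hZ, ⟨hZm.restrict, ?_⟩, fun r hr => ?_⟩
  · have hres : volume.restrict (Icc (0 : ℝ) T) = volume.restrict (Ioc (0 : ℝ) T) :=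
      Measure.restrict_congr_set Ioc_ae_eq_Icc.symm
    rw [hres]
    have hfin : ∫⁻ z, ENNReal.ofReal (max C 0 * max C 0 * |covMixedDeriv (H i) (K i) z.1 z.2|)
        ∂squareMeasure T < ⊤ := by
      have := (hint.abs.const_mul (max C 0 * max C 0)).lintegral_lt_top
      exact this
    refine lt_of_le_of_lt ?_ hfin
    have hme : AEMeasurable (fun z : ℝ × ℝ => ENNReal.ofReal
        (max C 0 * max C 0 * |covMixedDeriv (H i) (K i) z.1 z.2|)) (squareMeasure T) :=
      ENNReal.measurable_ofReal.comp_aemeasurable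
        (hint.abs.const_mul (max C 0 * max C 0)).aestronglyMeasurable.aemeasurable
    rw [squareMeasure] at hme ⊢
    rw [lintegral_prod _ hme]
    refine lintegral_mono fun u => lintegral_mono fun v => ENNReal.ofReal_le_ofReal ?_
    refine mul_le_mul_of_nonneg_right ?_ (abs_nonneg _)
    exact mul_le_mul (hbd u) (hbd v) (abs_nonneg _) (le_max_right _ _)
  · rw [hB.inner_toHilb_ind hp ht hZ hr]
    have hZm' : AEMeasurable ((Ioc 0 t).indicator Z) volume := by
      refine (aemeasurable_indicator_iff measurableSet_Ioc).2 ?_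
      exact (hZ.mono Ioc_subset_Icc_self).aemeasurable measurableSet_Ioc
    have hi : Integrable (fun z : ℝ × ℝ => (Ioc 0 t).indicator Z z.1 * unitStep r z.2 *
        covMixedDeriv (H i) (K i) z.1 z.2) (squareMeasure T) := by
      refine hint.bdd_mul (c := max C 0) ?_ (.of_forall fun z => ?_)
      · exact (hZm'.restrict.aestronglyMeasurable.comp_fst).mul
          ((measurable_unitStep r).comp measurable_snd).aestronglyMeasurable
      · rw [norm_mul, ← mul_one (max C 0)]
        refine mul_le_mul ?_ (abs_unitStep_le _ _) (norm_nonneg _) (le_max_right _ _)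
        by_cases hs : z.1 ∈ Ioc 0 t
        · rw [indicator_of_mem hs]
          exact (hC _ (Ioc_subset_Icc_self hs)).trans (le_max_left _ _)
        · rw [indicator_of_notMem hs]; simp
    rw [squareMeasure] at hi ⊢
    rw [integral_prod _ hi, intervalIntegral.integral_of_le hT]
    refine setIntegral_congr_fun measurableSet_Ioc fun u hu => ?_
    rw [intervalIntegral.integral_of_le hr.1]
    -- The two indicators differ only at 0, and here u > 0.
    have e1 : (Ioc 0 t).indicator Z u = (Icc 0 t).indicator Z u := by
      by_cases h : u ≤ t
      · rw [indicator_of_mem (show u ∈ Ioc 0 t from ⟨hu.1, h⟩),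
        indicator_of_mem (show u ∈ Icc 0 t from ⟨hu.1.le, h⟩)]
      · rw [indicator_of_notMem (fun h' => h h'.2), indicator_of_notMem (fun h' => h h'.2)]
    have e2 : ∀ v, (Ioc 0 t).indicator Z u * unitStep r v * covMixedDeriv (H i) (K i) u v =
        (Ioc 0 r).indicator (fun v => (Icc 0 t).indicator Z u *
          covMixedDeriv (H i) (K i) u v) v := by
      intro v
      rw [e1]
      unfold unitStep
      by_cases hv : v ∈ Ioc 0 r
      · simp [indicator_of_mem hv]
      · simp [indicator_of_notMem hv]
    simp only [e2]
    rw [integral_indicator measurableSet_Ioc, Measure.restrict_restrict measurableSet_Ioc,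
      inter_eq_left.2 (Ioc_subset_Ioc_right hr.2)]

end WienerIntegral
-- Mollification and the Taylor estimate.
section Mollifier

open Set Filter Topology
open scoped Convolution

variable {d : ℕ}

/-- A smooth bump function supported in the ball of radius `1 / (n + 1)`. -/
noncomputable def bump (d n : ℕ) : ContDiffBump (0 : Fin d → ℝ) where
  rIn := 1 / (2 * ((n : ℝ) + 1))
  rOut := 1 / ((n : ℝ) + 1)
  rIn_pos := by positivity
  rIn_lt_rOut := by
    apply one_div_lt_one_div_of_lt <;> [positivity; linarith [(n.cast_nonneg : (0 : ℝ) ≤ n)]]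

lemma bump_rOut_le (d n : ℕ) : (bump d n).rOut ≤ 1 := by
  simp only [bump]
  rw [div_le_one (by positivity)]
  linarith [(n.cast_nonneg : (0 : ℝ) ≤ n)]

lemma tendsto_bump_rOut (d : ℕ) : Tendsto (fun n => (bump d n).rOut) atTop (𝓝 0) :=
  tendsto_one_div_add_atTop_nhds_zero_nat

/-- Regularization of a function by convolution. -/
noncomputable def moll (n : ℕ) (f : (Fin d → ℝ) → ℝ) (x : Fin d → ℝ) : ℝ :=
  ∫ y, (bump d n).normed volume y * f (x - y)

lemma bump_normed_eq_zero {n : ℕ} {y : Fin d → ℝ} (hy : 1 < ‖y‖) :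
    (bump d n).normed volume y = 0 := by
  have : y ∉ Function.support ((bump d n).normed volume) := by
    rw [ContDiffBump.support_normed_eq, Metric.mem_ball, dist_zero_right, not_lt]
    exact (bump_rOut_le d n).trans hy.le
  simpa using this

lemma integrable_bump_mul {n : ℕ} {f : (Fin d → ℝ) → ℝ} (hf : Continuous f) (x : Fin d → ℝ) :
    Integrable (fun y => (bump d n).normed volume y * f (x - y)) :=
  (((bump d n).continuous_normed).mul (hf.comp (by fun_prop))).integrable_of_hasCompactSupport
    ((bump d n).hasCompactSupport_normed.mul_right)

/-- The bump is supported in the unit ball for every n. This locality is used to compare different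
cutoffs of f along one path. -/
lemma moll_congr {n : ℕ} {f g : (Fin d → ℝ) → ℝ} {x : Fin d → ℝ}
    (h : ∀ y, ‖y - x‖ ≤ 1 → f y = g y) : moll n f x = moll n g x := by
  refine integral_congr_ae (.of_forall fun y => ?_)
  by_cases hy : 1 < ‖y‖
  · simp only [bump_normed_eq_zero hy, zero_mul]
  · simp only
    rw [h (x - y) (by rw [sub_sub_cancel_left, norm_neg]; exact not_lt.1 hy)]

lemma abs_moll_le {n : ℕ} {f : (Fin d → ℝ) → ℝ} {C : ℝ} (hC : ∀ x, |f x| ≤ C) (x : Fin d → ℝ) :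
    |moll n f x| ≤ C := by
  rw [← Real.norm_eq_abs, moll]
  calc _ ≤ ∫ y, (bump d n).normed volume y * C := by
        refine norm_integral_le_of_norm_le ((bump d n).integrable_normed.mul_const C)
          (.of_forall fun y => ?_)
        rw [norm_mul, Real.norm_of_nonneg ((bump d n).nonneg_normed y)]
        exact mul_le_mul_of_nonneg_left (hC _) ((bump d n).nonneg_normed y)
    _ = C := by rw [integral_mul_const, (bump d n).integral_normed, one_mul]

lemma moll_eq_convolution (n : ℕ) (f : (Fin d → ℝ) → ℝ) :
    moll n f = (bump d n).normed volume ⋆[ContinuousLinearMap.lsmul ℝ ℝ, volume] f := by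
  ext x
  simp [moll, convolution_def]

lemma moll_eq_convolution_symm (n : ℕ) (f : (Fin d → ℝ) → ℝ) :
    moll n f = f ⋆[ContinuousLinearMap.lsmul ℝ ℝ, volume] (bump d n).normed volume := by
  ext x
  rw [convolution_lsmul_swap, moll]
  simp [mul_comm]

lemma contDiff_moll (n : ℕ) {f : (Fin d → ℝ) → ℝ} (hf : Continuous f) :
    ContDiff ℝ (⊤ : ℕ∞) (moll n f) := by
  rw [moll_eq_convolution_symm]
  exact (bump d n).hasCompactSupport_normed.contDiff_convolution_right _ hf.locallyIntegrable
    (bump d n).contDiff_normed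

/-- All derivatives fall on the smooth compactly supported factor, while g only has to be bounded.
The target space is general because each step of the induction replaces h by `fderiv ℝ h`. -/
lemma exists_bound_iteratedFDeriv_convolution {g : (Fin d → ℝ) → ℝ} (hg : Continuous g)
    {C : ℝ} (hC : ∀ x, |g x| ≤ C) (m : ℕ) :
    ∀ {F : Type} [NormedAddCommGroup F] [NormedSpace ℝ F] [CompleteSpace F] (h : (Fin d → ℝ) → F),
      ContDiff ℝ (⊤ : ℕ∞) h → HasCompactSupport h → ∃ C' : ℝ, ∀ x,
      ‖iteratedFDeriv ℝ m (g ⋆[ContinuousLinearMap.lsmul ℝ ℝ, volume] h) x‖ ≤ C' := by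
  induction m with
  | zero =>
    intro F _ _ _ h hh hs
    refine ⟨C * ∫ y, ‖h y‖, fun x => ?_⟩
    have hi : Integrable h := hh.continuous.integrable_of_hasCompactSupport hs
    rw [norm_iteratedFDeriv_zero, convolution_lsmul_swap, ← integral_const_mul]
    refine norm_integral_le_of_norm_le (hi.norm.const_mul C) (.of_forall fun y => ?_)
    rw [norm_smul]
    exact mul_le_mul_of_nonneg_right (hC _) (norm_nonneg _)
  | succ m ih =>
    intro F _ _ _ h hh hs
    obtain ⟨C', hC'⟩ := ih (fderiv ℝ h) (hh.fderiv_right (by simp)) (hs.fderiv ℝ)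
    refine ⟨C', fun x => ?_⟩
    rw [← norm_iteratedFDeriv_fderiv]
    convert hC' x using 3
    ext1 z
    rw [(hs.hasFDerivAt_convolution_right _ hg.locallyIntegrable
      (hh.of_le (mod_cast le_top)) z).fderiv]
    rfl

lemma exists_bound_iteratedFDeriv_moll (n : ℕ) {f : (Fin d → ℝ) → ℝ} (hf : Continuous f)
    {C : ℝ} (hC : ∀ x, |f x| ≤ C) (m : ℕ) :
    ∃ C' : ℝ, ∀ x, ‖iteratedFDeriv ℝ m (moll n f) x‖ ≤ C' := by
  rw [moll_eq_convolution_symm]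
  exact exists_bound_iteratedFDeriv_convolution hf hC m _ (bump d n).contDiff_normed
    (bump d n).hasCompactSupport_normed

lemma partialDeriv_moll (n : ℕ) {f : (Fin d → ℝ) → ℝ} (hf : ContDiff ℝ 1 f) (i : Fin d) :
    partialDeriv i (moll n f) = moll n (partialDeriv i f) := by
  ext x
  have hfc : Continuous (fderiv ℝ f) := hf.continuous_fderiv one_ne_zero
  -- No global bound on the derivative is available; the radius 2 allows 1 for moving the point and
  -- 1 for the support of the bump.
  obtain ⟨C, hC⟩ := (isCompact_closedBall x 2).exists_bound_of_continuousOn hfc.continuousOn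
  have hcs : HasCompactSupport fun y => (bump d n).normed volume y • fderiv ℝ f (x - y) :=
    (bump d n).hasCompactSupport_normed.smul_right
  have hcont : Continuous fun y => (bump d n).normed volume y • fderiv ℝ f (x - y) :=
    ((bump d n).continuous_normed).smul (hfc.comp (by fun_prop))
  have hint : Integrable fun y => (bump d n).normed volume y • fderiv ℝ f (x - y) :=
    hcont.integrable_of_hasCompactSupport hcs
  have key : HasFDerivAt (moll n f) (∫ y, (bump d n).normed volume y • fderiv ℝ f (x - y)) x := by
    refine hasFDerivAt_integral_of_dominated_of_fderiv_le
      (F' := fun x y => (bump d n).normed volume y • fderiv ℝ f (x - y))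
      (bound := fun y => (bump d n).normed volume y * C) (Metric.ball_mem_nhds x one_pos)
      (.of_forall fun z => (integrable_bump_mul hf.continuous z).aestronglyMeasurable)
      (integrable_bump_mul hf.continuous x) hint.aestronglyMeasurable
      (.of_forall fun y z hz => ?_) ((bump d n).integrable_normed.mul_const C)
      (.of_forall fun y z _ => ?_)
    · by_cases hy : 1 < ‖y‖
      · simp [bump_normed_eq_zero hy]
      · rw [norm_smul, Real.norm_of_nonneg ((bump d n).nonneg_normed y)]
        refine mul_le_mul_of_nonneg_left (hC _ ?_) ((bump d n).nonneg_normed y)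
        rw [Metric.mem_closedBall, dist_eq_norm, show z - y - x = (z - x) - y by abel]
        rw [Metric.mem_ball, dist_eq_norm] at hz
        linarith [norm_sub_le (z - x) y, not_lt.1 hy]
    · have h1 : HasFDerivAt (fun z => f (z - y)) (fderiv ℝ f (z - y)) z :=
        (hasFDerivAt_comp_sub y).2 (hf.differentiable one_ne_zero _).hasFDerivAt
      exact h1.const_mul _
  rw [partialDeriv, key.fderiv, ContinuousLinearMap.integral_apply hint]
  rfl

lemma tendsto_moll {f : (Fin d → ℝ) → ℝ} (hf : Continuous f) (x : Fin d → ℝ) :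
    Tendsto (fun p : ℕ × (Fin d → ℝ) => moll p.1 f p.2) (atTop ×ˢ 𝓝 x) (𝓝 (f x)) := by
  simp only [moll_eq_convolution]
  refine ContDiffBump.convolution_tendsto_right (φ := fun p : ℕ × (Fin d → ℝ) => bump d p.1)
    (g := fun _ => f) ((tendsto_bump_rOut d).comp tendsto_fst)
    (.of_forall fun _ => hf.aestronglyMeasurable) ?_ tendsto_snd
  exact (hf.tendsto x).comp tendsto_snd

/-- Joint convergence in (n, x) is locally uniform convergence, hence uniform on the compact image
of the path. In this way functions that are merely continuous can be treated path by path. -/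
lemma tendstoUniformlyOn_moll_comp {f : (Fin d → ℝ) → ℝ} (hf : Continuous f) {γ : ℝ → Fin d → ℝ}
    {t : ℝ} (hγ : ContinuousOn γ (Icc 0 t)) :
    TendstoUniformlyOn (fun n s => moll n f (γ s)) (fun s => f (γ s)) atTop (Icc 0 t) := by
  have h : TendstoLocallyUniformly (fun n => moll n f) f atTop := by
    rw [tendstoLocallyUniformly_iff_forall_tendsto]
    intro x
    have h1 : Tendsto (fun p : ℕ × (Fin d → ℝ) => (f p.2, moll p.1 f p.2)) (atTop ×ˢ 𝓝 x)
        (𝓝 (f x, f x)) := by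
      rw [nhds_prod_eq]
      exact ((hf.tendsto x).comp tendsto_snd).prodMk (tendsto_moll hf x)
    exact h1.mono_right (nhds_le_uniformity (f x))
  have h2 := (tendstoLocallyUniformlyOn_iff_tendstoUniformlyOn_of_compact
    (isCompact_Icc.image_of_continuousOn hγ)).1 (h.tendstoLocallyUniformlyOn (s := γ '' Icc 0 t))
  exact (h2.comp γ).mono fun s hs => mem_image_of_mem γ hs

lemma fderiv_apply_eq_sum (f : (Fin d → ℝ) → ℝ) (x v : Fin d → ℝ) :
    fderiv ℝ f x v = ∑ i, partialDeriv i f x * v i := by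
  conv_lhs => rw [← ContinuousLinearMap.coe_coe, LinearMap.pi_apply_eq_sum_univ]
  refine Finset.sum_congr rfl fun k _ => ?_
  rw [partialDeriv, smul_eq_mul, mul_comm, ContinuousLinearMap.coe_coe]
  congr 2
  ext j
  simp [Pi.single_apply, eq_comm]

lemma norm_fderiv_le (f : (Fin d → ℝ) → ℝ) (x : Fin d → ℝ) :
    ‖fderiv ℝ f x‖ ≤ ∑ i, |partialDeriv i f x| := by
  refine ContinuousLinearMap.opNorm_le_bound _ (Finset.sum_nonneg fun _ _ => abs_nonneg _)
    fun v => ?_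
  rw [fderiv_apply_eq_sum, Finset.sum_mul]
  refine (norm_sum_le _ _).trans (Finset.sum_le_sum fun i _ => ?_)
  rw [norm_mul]
  exact mul_le_mul_of_nonneg_left (norm_le_pi_norm v i) (norm_nonneg _)

lemma contDiff_partialDeriv {f : (Fin d → ℝ) → ℝ} {n m : WithTop ℕ∞} (hf : ContDiff ℝ n f)
    (hmn : m + 1 ≤ n) (i : Fin d) : ContDiff ℝ m (partialDeriv i f) :=
  (hf.fderiv_right hmn).clm_apply contDiff_const

/-- Second order Taylor estimate. -/
lemma abs_taylor_le {f : (Fin d → ℝ) → ℝ} (hf : ContDiff ℝ 2 f) {C : ℝ}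
    (hC : ∀ x i j, |partialDeriv j (partialDeriv i f) x| ≤ C) (x y : Fin d → ℝ) :
    |f y - f x - ∑ i, partialDeriv i f x * (y i - x i)| ≤ (d * (d * C)) * ‖y - x‖ ^ 2 := by
  have hd1 : ∀ i, Differentiable ℝ (partialDeriv i f) := fun i =>
    (contDiff_partialDeriv hf (m := 1) (by norm_num) i).differentiable one_ne_zero
  have hlip : ∀ i z, |partialDeriv i f z - partialDeriv i f x| ≤ (d * C) * ‖z - x‖ := by
    intro i z
    have := Convex.norm_image_sub_le_of_norm_fderiv_le (𝕜 := ℝ) (f := partialDeriv i f)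
      (C := d * C) (s := univ) (fun w _ => hd1 i w) (fun w _ => ?_) convex_univ (mem_univ x)
      (mem_univ z)
    · exact this
    · refine (norm_fderiv_le _ w).trans ?_
      calc _ ≤ ∑ _j : Fin d, C := Finset.sum_le_sum fun j _ => hC w i j
        _ = d * C := by simp
  -- Mean value inequality on the segment, after subtraction of the linear part at x.
  have hder : ∀ z, HasFDerivAt (fun z => f z - fderiv ℝ f x z) (fderiv ℝ f z - fderiv ℝ f x) z :=
    fun z => ((hf.differentiable two_ne_zero) z).hasFDerivAt.sub
      (fderiv ℝ f x).hasFDerivAt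
  have hbd : ∀ z ∈ segment ℝ x y, ‖fderiv ℝ f z - fderiv ℝ f x‖ ≤ (d * (d * C)) * ‖y - x‖ := by
    intro z hz
    have hzx : ‖z - x‖ ≤ ‖y - x‖ := by
      obtain ⟨θ, hθ, rfl⟩ := (segment_eq_image' ℝ x y ▸ hz :)
      simp only [add_sub_cancel_left, norm_smul]
      exact mul_le_of_le_one_left (norm_nonneg _) (by rw [Real.norm_of_nonneg hθ.1]; exact hθ.2)
    refine ContinuousLinearMap.opNorm_le_bound _ ?_ fun v => ?_
    -- For d = 0 the hypothesis on C is empty and C may be negative, but the bound is then 0.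
    · rcases Nat.eq_zero_or_pos d with h | h
      · simp [h]
      · have : 0 ≤ C := (abs_nonneg _).trans (hC x ⟨0, h⟩ ⟨0, h⟩)
        positivity
    · rw [sub_apply, fderiv_apply_eq_sum, fderiv_apply_eq_sum, ← Finset.sum_sub_distrib]
      refine (norm_sum_le _ _).trans ?_
      calc _ ≤ ∑ _i : Fin d, ((d * C) * ‖y - x‖) * ‖v‖ := by
            refine Finset.sum_le_sum fun i _ => ?_
            rw [← sub_mul, norm_mul]
            have h0 : (0 : ℝ) ≤ d * C := by
              have : 0 ≤ C := (abs_nonneg _).trans (hC x i i)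
              positivity
            refine mul_le_mul ((hlip i z).trans ?_) (norm_le_pi_norm v i) (norm_nonneg _)
              (by positivity)
            exact mul_le_mul_of_nonneg_left hzx h0
        _ = _ := by simp; ring
  have h := (convex_segment x y).norm_image_sub_le_of_norm_hasFDerivWithin_le
    (fun z _ => (hder z).hasFDerivWithinAt) hbd (left_mem_segment ℝ x y) (right_mem_segment ℝ x y)
  have e : f y - f x - ∑ i, partialDeriv i f x * (y i - x i) =
      f y - fderiv ℝ f x y - (f x - fderiv ℝ f x x) := by
    have := fderiv_apply_eq_sum f x (y - x)
    rw [map_sub] at this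
    simp only [Pi.sub_apply] at this
    linarith
  rw [e, ← Real.norm_eq_abs, sq, ← mul_assoc]
  exact h

end Mollifier
-- Step approximations of q(B) and existence of its divergence.
section Approximation

open Set Filter Topology

variable {Ω : Type*} [MeasurableSpace Ω] {P : Measure Ω} {d : ℕ} {H K : Fin d → ℝ} {T : ℝ}
  {B : Fin d → ℝ → Ω → ℝ}

/-- A path of the process. -/
def path (B : Fin d → ℝ → Ω → ℝ) (ω : Ω) (s : ℝ) : Fin d → ℝ := fun j => B j s ω

lemma IsBifBm.ae_continuousOn_path (hB : IsBifBm P H K T B) :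
    ∀ᵐ ω ∂P, ContinuousOn (path B ω) (Icc 0 T) := by
  filter_upwards [ae_all_iff.2 hB.continuous_paths] with ω hω
  exact continuousOn_pi.2 hω

/-- The variance of an increment is at most 2|s − a|^{2HK}. This continuity in L² is what makes the
gradient along a path a continuous function with values in L². -/
lemma IsBifBm.continuousOn_ind (hB : IsBifBm P H K T B) {j : Fin d} (hp : IsParam (H j) (K j)) :
    ContinuousOn (ind P B j) (Icc 0 T) := by
  intro a ha
  rw [ContinuousWithinAt, tendsto_iff_dist_tendsto_zero]
  have hα : 0 < 2 * H j * K j := one_pos.trans hp.one_lt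
  have h1 : Tendsto (fun s => 2 * |s - a| ^ (2 * H j * K j)) (𝓝[Icc 0 T] a) (𝓝 0) := by
    have hc : Continuous fun s : ℝ => 2 * |s - a| ^ (2 * H j * K j) :=
      continuous_const.mul ((continuous_abs.comp (by fun_prop)).rpow_const fun _ => Or.inr hα.le)
    have := (hc.tendsto a).mono_left (nhdsWithin_le_nhds (s := Icc 0 T))
    simpa [Real.zero_rpow hα.ne'] using this
  have h2 : Tendsto (fun s => dist (ind P B j s) (ind P B j a) ^ 2) (𝓝[Icc 0 T] a) (𝓝 0) := by
    refine squeeze_zero' (.of_forall fun _ => sq_nonneg _) ?_ h1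
    filter_upwards [self_mem_nhdsWithin] with s hs
    rw [dist_eq_norm, norm_sub_sq_real, ← real_inner_self_eq_norm_sq,
      ← real_inner_self_eq_norm_sq, hB.inner_ind_self j hs hs, hB.inner_ind_self j hs ha,
      hB.inner_ind_self j ha ha]
    have := cov_increment_le hp.pos hp.mem hs.1 ha.1
    linarith
  simpa [Real.sqrt_sq dist_nonneg] using h2.sqrt

/-- A smooth function of the position of the process at time `s`. -/
noncomputable def pointFunctional (P : Measure Ω) (B : Fin d → ℝ → Ω → ℝ)
    {g : (Fin d → ℝ) → ℝ} (hg : ContDiff ℝ (⊤ : ℕ∞) g)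
    (hb : ∀ m : ℕ, ∃ C : ℝ, ∀ x, ‖iteratedFDeriv ℝ m g x‖ ≤ C) {s : ℝ} (hs : s ∈ Icc 0 T) :
    SmoothFunctional P T B where
  n := d
  g := g
  φ j := ⟨ind P B j s, ind_mem_hilbAll j hs⟩
  smooth := hg
  bounded := hb

variable (P B) in
/-- The gradient of `g` along a path, as an element of the Gaussian space. -/
noncomputable def gradInd (g : (Fin d → ℝ) → ℝ) (ω : Ω) (s : ℝ) : Lp ℝ 2 P :=
  ∑ j, partialDeriv j g (path B ω s) • ind P B j s

lemma IsBifBm.pointFunctional_vec (hB : IsBifBm P H K T B) {g : (Fin d → ℝ) → ℝ}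
    (hg : ContDiff ℝ (⊤ : ℕ∞) g)
    (hb : ∀ m : ℕ, ∃ C : ℝ, ∀ x, ‖iteratedFDeriv ℝ m g x‖ ≤ C) {s : ℝ} (hs : s ∈ Icc 0 T) :
    ∀ᵐ ω ∂P, (pointFunctional P B hg hb hs).vec ω = path B ω s := by
  filter_upwards [ae_all_iff.2 fun j => hB.coeFn_ind j hs] with ω hω
  exact funext hω

lemma IsBifBm.pointFunctional_eval (hB : IsBifBm P H K T B) {g : (Fin d → ℝ) → ℝ}
    (hg : ContDiff ℝ (⊤ : ℕ∞) g)
    (hb : ∀ m : ℕ, ∃ C : ℝ, ∀ x, ‖iteratedFDeriv ℝ m g x‖ ≤ C) {s : ℝ} (hs : s ∈ Icc 0 T) :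
    ∀ᵐ ω ∂P, (pointFunctional P B hg hb hs).eval ω = g (path B ω s) ∧
      (pointFunctional P B hg hb hs).D ω = gradInd P B g ω s := by
  filter_upwards [hB.pointFunctional_vec hg hb hs] with ω hω
  refine ⟨?_, ?_⟩
  · rw [SmoothFunctional.eval, hω]; rfl
  · rw [SmoothFunctional.D, hω]; rfl

/-- The approximation of the process `s ↦ g (B_s)`, `s ≤ t`, by a step process. -/
noncomputable def stepElem (P : Measure Ω) (B : Fin d → ℝ → Ω → ℝ) (i : Fin d)
    {g : (Fin d → ℝ) → ℝ} (hg : ContDiff ℝ (⊤ : ℕ∞) g)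
    (hb : ∀ m : ℕ, ∃ C : ℝ, ∀ x, ‖iteratedFDeriv ℝ m g x‖ ≤ C) {t : ℝ} (ht : t ∈ Icc 0 T)
    (n : ℕ) : SmoothElem P T B i where
  m := n + 1
  F k := pointFunctional P B hg hb (node_mem_of_mem ht (n := n) (k := k) (by omega))
  h k := ⟨incr P B i t n k, incr_mem_hilb ht i (by omega)⟩

/-- The divergence of a step process, for the parameters `h`, `k` of the `i`-th component. -/
noncomputable def divSum (h k : ℝ) (B : Fin d → ℝ → Ω → ℝ) (i : Fin d) (t : ℝ) (n : ℕ)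
    (g : (Fin d → ℝ) → ℝ) (ω : Ω) : ℝ :=
  ∑ l ∈ Finset.range (n + 1), (g (path B ω (node t n l)) *
    (B i (node t n (l + 1)) ω - B i (node t n l) ω) -
    partialDeriv i g (path B ω (node t n l)) *
      (cov h k (node t n l) (node t n (l + 1)) - cov h k (node t n l) (node t n l)))

lemma IsBifBm.ae_stepElem (hB : IsBifBm P H K T B) (i : Fin d)
    {g : (Fin d → ℝ) → ℝ} (hg : ContDiff ℝ (⊤ : ℕ∞) g)
    (hb : ∀ m : ℕ, ∃ C : ℝ, ∀ x, ‖iteratedFDeriv ℝ m g x‖ ≤ C) {t : ℝ} (ht : t ∈ Icc 0 T)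
    (n : ℕ) : ∀ᵐ ω ∂P, ∀ k : Fin (n + 1),
      ((stepElem P B i hg hb ht n).F k).eval ω = g (path B ω (node t n k)) ∧
      ((stepElem P B i hg hb ht n).F k).D ω = gradInd P B g ω (node t n k) :=
  ae_all_iff.2 fun k => hB.pointFunctional_eval hg hb (node_mem_of_mem ht (by omega))

lemma IsBifBm.stepElem_eval (hB : IsBifBm P H K T B) (i : Fin d)
    {g : (Fin d → ℝ) → ℝ} (hg : ContDiff ℝ (⊤ : ℕ∞) g)
    (hb : ∀ m : ℕ, ∃ C : ℝ, ∀ x, ‖iteratedFDeriv ℝ m g x‖ ≤ C) {t : ℝ} (ht : t ∈ Icc 0 T)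
    (n : ℕ) : ∀ᵐ ω ∂P, (stepElem P B i hg hb ht n).eval ω =
      riemannSum P B i t n fun s => g (path B ω s) := by
  filter_upwards [hB.ae_stepElem i hg hb ht n] with ω hω
  rw [riemannSum, Finset.sum_range, SmoothElem.eval]
  exact Finset.sum_congr rfl fun k _ => by rw [(hω k).1]; rfl

lemma IsBifBm.stepElem_innerD (hB : IsBifBm P H K T B) (i : Fin d)
    {g g' : (Fin d → ℝ) → ℝ} (hg : ContDiff ℝ (⊤ : ℕ∞) g) (hg' : ContDiff ℝ (⊤ : ℕ∞) g')
    (hb : ∀ m : ℕ, ∃ C : ℝ, ∀ x, ‖iteratedFDeriv ℝ m g x‖ ≤ C)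
    (hb' : ∀ m : ℕ, ∃ C : ℝ, ∀ x, ‖iteratedFDeriv ℝ m g' x‖ ≤ C) {t : ℝ} (ht : t ∈ Icc 0 T)
    (n m : ℕ) : ∀ᵐ ω ∂P,
      (stepElem P B i hg hb ht n).innerD (stepElem P B i hg' hb' ht m) ω =
      stepInner P B i t n m (gradInd P B g ω) (gradInd P B g' ω) := by
  filter_upwards [hB.ae_stepElem i hg hb ht n, hB.ae_stepElem i hg' hb' ht m] with ω hω hω'
  rw [stepInner, Finset.sum_range, SmoothElem.innerD]
  refine Finset.sum_congr rfl fun k _ => ?_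
  rw [Finset.sum_range]
  exact Finset.sum_congr rfl fun l _ => by rw [(hω k).2, (hω' l).2]; rfl

/-- In ⟨D g(B_a), B^i_b − B^i_a⟩ the components j ≠ i drop out by independence, and j = i
contributes ∂_i g(B_a)(R(a,b) − R(a,a)). -/
lemma IsBifBm.stepElem_div (hB : IsBifBm P H K T B) (i : Fin d)
    {g : (Fin d → ℝ) → ℝ} (hg : ContDiff ℝ (⊤ : ℕ∞) g)
    (hb : ∀ m : ℕ, ∃ C : ℝ, ∀ x, ‖iteratedFDeriv ℝ m g x‖ ≤ C) {t : ℝ} (ht : t ∈ Icc 0 T)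
    (n : ℕ) : (stepElem P B i hg hb ht n).div =ᵐ[P] divSum (H i) (K i) B i t n g := by
  have h1 : ∀ᵐ ω ∂P, ∀ k : Fin (n + 1), incr P B i t n k ω =
      B i (node t n (k + 1)) ω - B i (node t n k) ω := by
    refine ae_all_iff.2 fun k => ?_
    filter_upwards [Lp.coeFn_sub (ind P B i (node t n (k + 1))) (ind P B i (node t n k)),
      hB.coeFn_ind i (node_mem_of_mem ht (n := n) (k := k + 1) (by omega)),
      hB.coeFn_ind i (node_mem_of_mem ht (n := n) (k := k) (by omega))] with ω a b c
    rw [incr, a, Pi.sub_apply, b, c]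
  filter_upwards [hB.ae_stepElem i hg hb ht n, h1] with ω hω h1
  rw [divSum, Finset.sum_range, SmoothElem.div]
  refine Finset.sum_congr rfl fun (k : Fin (n + 1)) _ => ?_
  rw [(hω k).1, (hω k).2]
  have hk : node t n k ∈ Icc 0 T := node_mem_of_mem ht (by omega)
  have hk' : node t n (k + 1) ∈ Icc 0 T := node_mem_of_mem ht (by omega)
  change _ * incr P B i t n k ω - inner ℝ _ (incr P B i t n k) = _
  rw [h1 k, gradInd, sum_inner, Finset.sum_eq_single i]
  · rw [real_inner_smul_left, incr, inner_sub_right, hB.inner_ind_self i hk hk',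
      hB.inner_ind_self i hk hk]
  · intro j _ hj
    rw [real_inner_smul_left, incr, inner_sub_right, hB.inner_ind_of_ne hj hk hk',
      hB.inner_ind_of_ne hj hk hk, sub_self, mul_zero]
  · intro h; exact absurd (Finset.mem_univ i) h

lemma measurable_sigmaAlg {Ω : Type*} {B : Fin d → ℝ → Ω → ℝ} (i : Fin d) {s : ℝ}
    (hs : s ∈ Icc 0 T) :
    Measurable[sigmaAlg T B] (B i s) :=
  Measurable.of_comap_le (le_iSup_of_le i (le_iSup_of_le (⟨s, hs⟩ : Icc (0 : ℝ) T) le_rfl))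

lemma measurable_divSum {Ω : Type*} {B : Fin d → ℝ → Ω → ℝ} (h k : ℝ) (i : Fin d) {t : ℝ}
    (ht : t ∈ Icc 0 T) (n : ℕ)
    {g : (Fin d → ℝ) → ℝ} (hg : ContDiff ℝ 1 g) :
    Measurable[sigmaAlg T B] (divSum h k B i t n g) := by
  have hp : ∀ s ∈ Icc 0 T, Measurable[sigmaAlg T B] fun ω => path B ω s := fun s hs =>
    @measurable_pi_lambda _ _ _ (sigmaAlg T B) _ _ fun j => measurable_sigmaAlg j hs
  have hc : Measurable (partialDeriv i g) :=
    (contDiff_partialDeriv hg (m := 0) (by norm_num) i).continuous.measurable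
  refine @Finset.measurable_fun_sum _ _ _ _ _ _ (sigmaAlg T B) _ _ fun l hl => ?_
  have hl' := Finset.mem_range.1 hl
  have m0 := node_mem_of_mem ht (n := n) (k := l) (by omega)
  have m1 := node_mem_of_mem ht (n := n) (k := l + 1) (by omega)
  exact ((hg.continuous.measurable.comp (hp _ m0)).mul
    ((measurable_sigmaAlg i m1).sub (measurable_sigmaAlg i m0))).sub
    ((hc.comp (hp _ m0)).mul_const _)

lemma tendstoUniformlyOn_sum_smul {E ι : Type*} [NormedAddCommGroup E] [NormedSpace ℝ E]
    [Fintype ι] {a : ℕ → ι → ℝ → ℝ} {b : ι → ℝ → ℝ} {e : ι → ℝ → E} {s : Set ℝ} {M : ℝ}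
    (hM : ∀ j, ∀ x ∈ s, ‖e j x‖ ≤ M)
    (h : ∀ j, TendstoUniformlyOn (fun n => a n j) (b j) atTop s) :
    TendstoUniformlyOn (fun n x => ∑ j, a n j x • e j x) (fun x => ∑ j, b j x • e j x)
      atTop s := by
  rw [Metric.tendstoUniformlyOn_iff]
  intro ε hε
  have hM' : 0 < Fintype.card ι * |M| + 1 := by positivity
  have h' := eventually_all.2 fun j =>
    Metric.tendstoUniformlyOn_iff.1 (h j) (ε / (Fintype.card ι * |M| + 1)) (by positivity)
  filter_upwards [h'] with n hn x hx
  rw [dist_eq_norm, ← Finset.sum_sub_distrib]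
  calc _ ≤ ∑ _j : ι, ε / (Fintype.card ι * |M| + 1) * |M| := by
        refine (norm_sum_le _ _).trans (Finset.sum_le_sum fun j _ => ?_)
        rw [← sub_smul, norm_smul]
        refine mul_le_mul ?_ ((hM j x hx).trans (le_abs_self _)) (norm_nonneg _) (by positivity)
        have := hn j x hx
        rw [dist_eq_norm] at this
        exact this.le
    _ = ε * (Fintype.card ι * |M| / (Fintype.card ι * |M| + 1)) := by simp; ring
    _ < ε := mul_lt_of_lt_one_right hε ((div_lt_one hM').2 (by linarith))

lemma SmoothElem.aestronglyMeasurable_innerD {i : Fin d} (V W : SmoothElem P T B i) :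
    AEStronglyMeasurable (V.innerD W) P :=
  Finset.aestronglyMeasurable_fun_sum _ fun j _ => Finset.aestronglyMeasurable_fun_sum _ fun k _ =>
    ((V.F j).measurable_D.inner (W.F k).measurable_D).aestronglyMeasurable.mul_const _

lemma IsBifBm.exists_bound_ind (hB : IsBifBm P H K T B) (hp : ∀ j, IsParam (H j) (K j)) :
    ∃ M : ℝ, 0 ≤ M ∧ ∀ j, ∀ s ∈ Icc 0 T, ‖ind P B j s‖ ≤ M := by
  choose M hM using fun j =>
    isCompact_Icc.exists_bound_of_continuousOn (hB.continuousOn_ind (hp j))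
  refine ⟨∑ j, |M j|, Finset.sum_nonneg fun _ _ => abs_nonneg _, fun j s hs => ?_⟩
  exact (hM j s hs).trans ((le_abs_self _).trans
    (Finset.single_le_sum (f := fun j => |M j|) (fun _ _ => abs_nonneg _) (Finset.mem_univ j)))

/-- The process `s ↦ q (B_s)`, `s ≤ t`, as a random element of `ℋ_i`. -/
noncomputable def integrand (P : Measure Ω) (B : Fin d → ℝ → Ω → ℝ) (i : Fin d) (t : ℝ)
    (q : (Fin d → ℝ) → ℝ) (ω : Ω) : Lp ℝ 2 P :=
  toHilb P B i t fun s => q (path B ω s)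

/-- Integrands and gradients of the mollified step processes converge for almost every path. The
bounds C on q and its gradient survive mollification, so constants dominate and the convergence
holds in 𝔻^{1,2}. The L¹ limit of the explicit sums is kept, since both the Itô formula and the
localization identify G through it. -/
theorem IsBifBm.exists_divergence [IsProbabilityMeasure P] (hB : IsBifBm P H K T B)
    (hp : ∀ j, IsParam (H j) (K j)) {t : ℝ} (ht : t ∈ Icc 0 T) (i : Fin d)
    {q : (Fin d → ℝ) → ℝ} (hq : ContDiff ℝ 1 q) {C : ℝ} (hC : ∀ x, |q x| ≤ C)
    (hC' : ∀ j x, |partialDeriv j q x| ≤ C) :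
    MemSobolev P T B i (integrand P B i t q) ∧
      (∀ n, Integrable (divSum (H i) (K i) B i t n (moll n q)) P) ∧
      ∃ G, IsDivergence P T B i (integrand P B i t q) G ∧
        Tendsto (fun n => ∫ ω, ‖divSum (H i) (K i) B i t n (moll n q) ω - G ω‖ ∂P)
          atTop (𝓝 0) := by
  have hC0 : 0 ≤ C := (abs_nonneg _).trans (hC 0)
  have hsub : Icc 0 t ⊆ Icc 0 T := Icc_subset_Icc_right ht.2
  have hg := fun n => contDiff_moll n hq.continuous
  have hb := fun n => exists_bound_iteratedFDeriv_moll n hq.continuous hC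
  let V : ℕ → SmoothElem P T B i := fun n => stepElem P B i (hg n) (hb n) ht n
  have hV : ∀ᵐ ω ∂P, ∀ n, (V n).eval ω = riemannSum P B i t n fun s => moll n q (path B ω s) :=
    ae_all_iff.2 fun n => hB.stepElem_eval i (hg n) (hb n) ht n
  have hpath := hB.ae_continuousOn_path
  have hlim : ∀ᵐ ω ∂P, Tendsto (fun n => (V n).eval ω) atTop (𝓝 (integrand P B i t q ω)) := by
    filter_upwards [hV, hpath] with ω h1 h2
    simp only [h1]
    exact hB.tendsto_riemannSum (hp i) ht
      (tendstoUniformlyOn_moll_comp hq.continuous (h2.mono hsub))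
      (hq.continuous.comp_continuousOn (h2.mono hsub))
  have hbV : ∀ n, ∀ᵐ ω ∂P, ‖(V n).eval ω‖ ^ 2 ≤ C * C * kernelMass (H i) (K i) T := by
    intro n
    filter_upwards [hV] with ω h1
    rw [h1 n]
    exact hB.norm_riemannSum_sq_le (hp i) ht n hC0 fun s _ => abs_moll_le hC _
  have hbu : ∀ᵐ ω ∂P, ‖integrand P B i t q ω‖ ^ 2 ≤ C * C * kernelMass (H i) (K i) T := by
    filter_upwards [hpath] with ω h2
    exact hB.norm_toHilb_sq_le (hp i) ht (hq.continuous.comp_continuousOn (h2.mono hsub)) hC0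
      fun s _ => hC _
  have hum : AEStronglyMeasurable (integrand P B i t q) P :=
    aestronglyMeasurable_of_tendsto_ae atTop (fun n => (V n).memLp_eval.1) hlim
  have hu2 : MemLp (integrand P B i t q) 2 P := by
    refine MemLp.of_bound hum (Real.sqrt (C * C * kernelMass (H i) (K i) T)) ?_
    filter_upwards [hbu] with ω h
    exact Real.le_sqrt_of_sq_le h
  have humem : ∀ᵐ ω ∂P, integrand P B i t q ω ∈ hilb P T B i := by
    filter_upwards [hpath] with ω h2
    exact hB.toHilb_mem_hilb (hp i) ht (hq.continuous.comp_continuousOn (h2.mono hsub))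
  have h1 : Tendsto (fun n => ∫ ω, ‖(V n).eval ω - integrand P B i t q ω‖ ^ 2 ∂P) atTop
      (𝓝 0) := by
    rw [← integral_zero Ω ℝ (μ := P)]
    refine tendsto_integral_of_dominated_convergence
      -- From ‖x − y‖² ≤ 2‖x‖² + 2‖y‖².
      (fun _ => 4 * (C * C * kernelMass (H i) (K i) T))
      (fun n => ((V n).memLp_eval.1.sub hum).norm.pow 2) (integrable_const _) (fun n => ?_) ?_
    · filter_upwards [hbV n, hbu] with ω a b
      rw [Real.norm_of_nonneg (sq_nonneg _)]
      have := norm_sub_le ((V n).eval ω) (integrand P B i t q ω)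
      have h0 := norm_nonneg ((V n).eval ω - integrand P B i t q ω)
      nlinarith [sq_nonneg (‖(V n).eval ω‖ - ‖integrand P B i t q ω‖)]
    · filter_upwards [hlim] with ω h
      simpa using ((h.sub_const (integrand P B i t q ω)).norm.pow 2)
  obtain ⟨M, hM0, hM⟩ := hB.exists_bound_ind hp
  have hgrad : ∀ n ω, gradInd P B (moll n q) ω =
      fun s => ∑ j, moll n (partialDeriv j q) (path B ω s) • ind P B j s := by
    intro n ω
    ext1 s
    simp only [gradInd, partialDeriv_moll n hq]
  have hgb : ∀ n ω, ∀ s ∈ Icc 0 t, ‖gradInd P B (moll n q) ω s‖ ≤ d * (C * M) := by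
    intro n ω s hs
    rw [hgrad]
    calc _ ≤ ∑ _j : Fin d, C * M := by
          refine (norm_sum_le _ _).trans (Finset.sum_le_sum fun j _ => ?_)
          rw [norm_smul]
          exact mul_le_mul (abs_moll_le (hC' j) _) (hM j s (hsub hs)) (norm_nonneg _) hC0
      _ = _ := by simp
  have hD0 : 0 ≤ d * (C * M) := by positivity
  have hin : ∀ᵐ ω ∂P, ∀ n m, (V n).innerD (V m) ω =
      stepInner P B i t n m (gradInd P B (moll n q) ω) (gradInd P B (moll m q) ω) :=
    ae_all_iff.2 fun n => ae_all_iff.2 fun m =>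
      hB.stepElem_innerD i (hg n) (hg m) (hb n) (hb m) ht n m
  have h2 : Tendsto (fun p : ℕ × ℕ => ∫ ω, (V p.1).distDSq (V p.2) ω ∂P) atTop (𝓝 0) := by
    rw [← integral_zero Ω ℝ (μ := P)]
    refine tendsto_integral_filter_of_dominated_convergence
      -- The three terms of `distDSq` carry the weights 1, 2 and 1.
      (fun _ => 4 * ((d * (C * M)) * (d * (C * M)) * kernelMass (H i) (K i) T))
      (.of_forall fun p => ?_) (.of_forall fun p => ?_) (integrable_const _) ?_
    · exact (((V p.1).aestronglyMeasurable_innerD _).sub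
        (((V p.1).aestronglyMeasurable_innerD _).const_mul 2)).add
        ((V p.2).aestronglyMeasurable_innerD _)
    · filter_upwards [hin] with ω h
      rw [SmoothElem.distDSq, h, h, h, Real.norm_eq_abs, abs_le]
      have a1 := abs_le.1 (hB.abs_stepInner_le (hp i) ht p.1 p.1 hD0 hD0 (hgb p.1 ω) (hgb p.1 ω))
      have a2 := abs_le.1 (hB.abs_stepInner_le (hp i) ht p.1 p.2 hD0 hD0 (hgb p.1 ω) (hgb p.2 ω))
      have a3 := abs_le.1 (hB.abs_stepInner_le (hp i) ht p.2 p.2 hD0 hD0 (hgb p.2 ω) (hgb p.2 ω))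
      constructor <;> linarith [a1.1, a1.2, a2.1, a2.2, a3.1, a3.2]
    · filter_upwards [hin, hpath] with ω h h'
      simp only [SmoothElem.distDSq, h]
      have hcq : ∀ j, Continuous (partialDeriv j q) := fun j =>
        (contDiff_partialDeriv hq (m := 0) (by norm_num) j).continuous
      refine hB.tendsto_stepInner_sub (hp i) ht (Y := fun n => gradInd P B (moll n q) ω)
        (Z := gradInd P B q ω) ?_ ?_
      · simp only [hgrad]
        exact tendstoUniformlyOn_sum_smul (fun j s hs => hM j s (hsub hs)) fun j =>
          tendstoUniformlyOn_moll_comp (hcq j) (h'.mono hsub)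
      · exact continuousOn_finsetSum _ fun j _ =>
          ((hcq j).comp_continuousOn (h'.mono hsub)).smul ((hB.continuousOn_ind (hp j)).mono hsub)
  have hdiv := fun n => hB.stepElem_div i (hg n) (hb n) ht n
  have h3 : ∀ n, AEStronglyMeasurable[sigmaAlg T B] (V n).div P := fun n =>
    ⟨_, (measurable_divSum (H i) (K i) i ht n
      ((hg n).of_le (mod_cast le_top))).stronglyMeasurable, hdiv n⟩
  obtain ⟨G, hG, hGl⟩ := exists_isDivergence_of_tendsto hB humem hu2 V h1 h2 h3
  refine ⟨⟨hu2, V, h1, h2⟩, 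
    fun n => ((V n).memLp_div.integrable (by norm_num)).congr (hdiv n), G, hG,
    hGl.congr fun n => integral_congr_ae ?_⟩
  filter_upwards [hdiv n] with ω h
  rw [h]

end Approximation
-- Itô's formula for bounded derivatives.
section Ito

open Set Filter Topology

variable {Ω : Type*} [MeasurableSpace Ω] {P : Measure Ω} {d : ℕ} {H K : Fin d → ℝ} {T : ℝ}
  {B : Fin d → ℝ → Ω → ℝ}

/-- Finitely many L¹ convergences share an almost surely convergent subsequence: apply convergence
in measure to the sum of the norms. -/
lemma exists_seq_tendsto_ae_of_integral_norm {ι : Type*} [Fintype ι] {X : ℕ → ι → Ω → ℝ}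
    (hX : ∀ n j, Integrable (X n j) P)
    (h : ∀ j, Tendsto (fun n => ∫ ω, ‖X n j ω‖ ∂P) atTop (𝓝 0)) :
    ∃ ns : ℕ → ℕ, StrictMono ns ∧
      ∀ᵐ ω ∂P, ∀ j, Tendsto (fun k => X (ns k) j ω) atTop (𝓝 0) := by
  have hi : ∀ n, Integrable (fun ω => ∑ j, ‖X n j ω‖) P := fun n =>
    integrable_finsetSum _ fun j _ => (hX n j).norm
  have h1 : Tendsto (fun n => ∫ ω, ∑ j, ‖X n j ω‖ ∂P) atTop (𝓝 0) := by
    have := tendsto_finsetSum (Finset.univ : Finset ι) fun j _ => h j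
    simp only [Finset.sum_const_zero] at this
    refine this.congr fun n => ?_
    rw [integral_finsetSum _ fun j _ => (hX n j).norm]
  have h2 : TendstoInMeasure P (fun n ω => ∑ j, ‖X n j ω‖) atTop fun _ => 0 := by
    refine tendstoInMeasure_of_tendsto_eLpNorm one_ne_zero (fun n => (hi n).1)
      aestronglyMeasurable_const ?_
    have e : ∀ n, eLpNorm ((fun ω => ∑ j, ‖X n j ω‖) - fun _ => 0) 1 P =
        ENNReal.ofReal (∫ ω, ∑ j, ‖X n j ω‖ ∂P) := by
      intro n
      rw [show ((fun ω => ∑ j, ‖X n j ω‖) - fun _ => (0 : ℝ)) = fun ω => ∑ j, ‖X n j ω‖ by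
        ext ω; simp, eLpNorm_one_eq_lintegral_enorm,
        ← ofReal_integral_norm_eq_lintegral_enorm (hi n)]
      congr 2
      ext ω
      exact Real.norm_of_nonneg (Finset.sum_nonneg fun _ _ => norm_nonneg _)
    simp only [e]
    simpa using ENNReal.tendsto_ofReal h1
  obtain ⟨ns, hns, hae⟩ := h2.exists_seq_tendsto_ae
  refine ⟨ns, hns, ?_⟩
  filter_upwards [hae] with ω hω j
  refine squeeze_zero_norm (fun k => ?_) hω
  exact Finset.single_le_sum (f := fun j => ‖X (ns k) j ω‖) (fun _ _ => norm_nonneg _)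
    (Finset.mem_univ j)

/-- With α = 2HK > 1 this makes the quadratic variation negligible. -/
lemma tendsto_mesh_rpow {t α : ℝ} (ht : 0 ≤ t) (hα : 1 < α) :
    Tendsto (fun n : ℕ => ((n : ℝ) + 1) * (t / ((n : ℝ) + 1)) ^ α) atTop (𝓝 0) := by
  have h1 : Tendsto (fun n : ℕ => t ^ α * ((n : ℝ) + 1) ^ (-(α - 1))) atTop (𝓝 (t ^ α * 0)) :=
    ((tendsto_rpow_neg_atTop (sub_pos.2 hα)).comp
      (tendsto_atTop_add_const_right _ 1 tendsto_natCast_atTop_atTop)).const_mul _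
  rw [mul_zero] at h1
  refine h1.congr fun n => ?_
  have hn : (0 : ℝ) < (n : ℝ) + 1 := by positivity
  rw [Real.div_rpow ht hn.le, neg_sub, Real.rpow_sub hn, Real.rpow_one]
  ring

lemma IsBifBm.integral_increment_sq (hB : IsBifBm P H K T B) (i : Fin d) {a b : ℝ}
    (ha : a ∈ Icc 0 T) (hb : b ∈ Icc 0 T) :
    ∫ ω, (B i b ω - B i a ω) ^ 2 ∂P =
      cov (H i) (K i) a a + cov (H i) (K i) b b - 2 * cov (H i) (K i) a b := by
  have e : ∫ ω, (B i b ω - B i a ω) ^ 2 ∂P = ‖ind P B i b - ind P B i a‖ ^ 2 := by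
    rw [norm_sq_Lp]
    refine integral_congr_ae ?_
    filter_upwards [Lp.coeFn_sub (ind P B i b) (ind P B i a), hB.coeFn_ind i ha,
      hB.coeFn_ind i hb] with ω h1 h2 h3
    rw [h1, Pi.sub_apply, h2, h3]
  rw [e, norm_sub_sq_real, ← real_inner_self_eq_norm_sq, ← real_inner_self_eq_norm_sq,
    real_inner_comm (ind P B i a), hB.inner_ind_self i ha hb, hB.inner_ind_self i ha ha,
    hB.inner_ind_self i hb hb]
  ring

lemma integral_unitStep_mul_rpow {α a t : ℝ} (hα : 1 < α) (ha : a ∈ Icc 0 t) :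
    ∫ s in (0 : ℝ)..t, unitStep a s * (α * s ^ (α - 1)) = a ^ α := by
  rw [intervalIntegral.integral_of_le (ha.1.trans ha.2)]
  have e : ∀ s, unitStep a s * (α * s ^ (α - 1)) =
      (Ioc 0 a).indicator (fun s => α * s ^ (α - 1)) s := by
    intro s
    unfold unitStep indicator
    split_ifs <;> simp
  simp only [e]
  rw [integral_indicator measurableSet_Ioc, Measure.restrict_restrict measurableSet_Ioc,
    inter_eq_left.2 (Ioc_subset_Ioc_right ha.2), ← intervalIntegral.integral_of_le ha.1,
    intervalIntegral.integral_const_mul, integral_rpow (Or.inl (by linarith)), sub_add_cancel,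
    Real.zero_rpow (by linarith), sub_zero, mul_div_cancel₀ _ (by linarith)]

/-- A Riemann–Stieltjes sum for d(s^α): since b^α − a^α is the integral of αs^{α−1} over (a,b], the
sum is the integral of the step function against this density. -/
lemma tendsto_sum_mul_rpow_sub {t α : ℝ} (ht : 0 ≤ t) (hα : 1 < α) {Y : ℕ → ℝ → ℝ} {Z : ℝ → ℝ}
    (hY : TendstoUniformlyOn Y Z atTop (Icc 0 t)) (hZ : ContinuousOn Z (Icc 0 t)) :
    Tendsto (fun n => ∑ l ∈ Finset.range (n + 1), Y n (node t n l) *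
      (node t n (l + 1) ^ α - node t n l ^ α)) atTop
      (𝓝 (∫ s in (0 : ℝ)..t, Z s * (α * s ^ (α - 1)))) := by
  have hw : IntervalIntegrable (fun s : ℝ => α * s ^ (α - 1)) volume 0 t :=
    (intervalIntegral.intervalIntegrable_rpow' (by linarith)).const_mul α
  have hu : ∀ a, IntervalIntegrable (fun s => unitStep a s * (α * s ^ (α - 1))) volume 0 t := by
    intro a
    rw [intervalIntegrable_iff] at hw ⊢
    exact hw.bdd_mul (measurable_unitStep a).aestronglyMeasurable (.of_forall (abs_unitStep_le a))
  have e : ∀ n, ∑ l ∈ Finset.range (n + 1), Y n (node t n l) *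
      (node t n (l + 1) ^ α - node t n l ^ α) =
      ∫ s in (0 : ℝ)..t, stepFun t n (Y n) s * (α * s ^ (α - 1)) := by
    intro n
    have e1 : ∀ s, stepFun t n (Y n) s * (α * s ^ (α - 1)) = ∑ l ∈ Finset.range (n + 1),
        Y n (node t n l) * (unitStep (node t n (l + 1)) s * (α * s ^ (α - 1)) -
          unitStep (node t n l) s * (α * s ^ (α - 1))) := by
      intro s
      rw [stepFun, Finset.sum_mul]
      refine Finset.sum_congr rfl fun l _ => ?_
      rw [cell, smul_eq_mul]; ring
    simp only [e1]
    rw [intervalIntegral.integral_finsetSum fun l _ => ((hu _).sub (hu _)).const_mul _]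
    refine Finset.sum_congr rfl fun l hl => ?_
    have hl' := Finset.mem_range.1 hl
    rw [intervalIntegral.integral_const_mul, intervalIntegral.integral_sub (hu _) (hu _),
      integral_unitStep_mul_rpow hα (node_mem ht (by omega)),
      integral_unitStep_mul_rpow hα (node_mem ht (by omega))]
  simp only [e]
  obtain ⟨C, hC0, -, hC⟩ := eventually_bound_of_tendstoUniformlyOn hY hZ
  have hU := tendstoUniformly_stepFun ht hY hZ
  refine intervalIntegral.tendsto_integral_filter_of_dominated_convergence
    (fun s => C * ‖α * s ^ (α - 1)‖) (.of_forall fun n => ?_) ?_ (hw.norm.const_mul C)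
    (.of_forall fun s hs => ?_)
  · exact (stronglyMeasurable_stepFun t n (Y n)).aestronglyMeasurable.mul
      hw.def'.aestronglyMeasurable
  · filter_upwards [hC] with n hn
    refine .of_forall fun s _ => ?_
    rw [norm_mul]
    exact mul_le_mul_of_nonneg_right (norm_stepFun_le ht n hC0 hn s) (norm_nonneg _)
  · rw [uIoc_of_le ht] at hs
    have := (hU.tendsto_at s).mul_const (α * s ^ (α - 1))
    rwa [indicator_of_mem hs] at this

/-- Convergence of the trace term. -/
lemma IsBifBm.tendsto_trace (hB : IsBifBm P H K T B) {i : Fin d} (hp : IsParam (H i) (K i))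
    {t : ℝ} (ht : t ∈ Icc 0 T) {Y : ℕ → ℝ → ℝ} {Z : ℝ → ℝ}
    (hY : TendstoUniformlyOn Y Z atTop (Icc 0 t)) (hZ : ContinuousOn Z (Icc 0 t)) :
    Tendsto (fun n => ∑ l ∈ Finset.range (n + 1), Y n (node t n l) *
      (cov (H i) (K i) (node t n l) (node t n (l + 1)) -
        cov (H i) (K i) (node t n l) (node t n l))) atTop
      (𝓝 (H i * K i * ∫ s in (0 : ℝ)..t, Z s * s ^ (2 * H i * K i - 1))) := by
  set α := 2 * H i * K i with hα
  obtain ⟨C, hC0, -, hC⟩ := eventually_bound_of_tendstoUniformlyOn hY hZ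
  have h1 := (tendsto_sum_mul_rpow_sub ht.1 hp.one_lt hY hZ).const_mul (1 / 2)
  -- E n l is the variance of an increment, and R(a,b) − R(a,a) = ½(b^α − a^α) − ½E. The variances
  -- contribute nothing in the limit.
  let E : ℕ → ℕ → ℝ := fun n l => cov (H i) (K i) (node t n l) (node t n l) +
    cov (H i) (K i) (node t n (l + 1)) (node t n (l + 1)) -
    2 * cov (H i) (K i) (node t n l) (node t n (l + 1))
  have hE : ∀ n, ∀ l ∈ Finset.range (n + 1), |E n l| ≤ 2 * (t / ((n : ℝ) + 1)) ^ α := by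
    intro n l hl
    have hl' := Finset.mem_range.1 hl
    have m0 := node_mem_of_mem ht (n := n) (k := l) (by omega)
    have m1 := node_mem_of_mem ht (n := n) (k := l + 1) (by omega)
    have h0 : 0 ≤ E n l := by
      simp only [E]
      rw [← hB.integral_increment_sq i m0 m1]
      exact integral_nonneg fun _ => sq_nonneg _
    rw [abs_of_nonneg h0]
    have := cov_increment_le hp.pos hp.mem m0.1 m1.1
    rwa [abs_sub_comm, node_succ_sub, abs_of_nonneg (by have := ht.1; positivity)] at this
  have h2 : Tendsto (fun n => ∑ l ∈ Finset.range (n + 1), Y n (node t n l) * E n l) atTop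
      (𝓝 0) := by
    have h3 := (tendsto_mesh_rpow ht.1 hp.one_lt).const_mul (C * 2)
    rw [mul_zero] at h3
    refine squeeze_zero_norm' ?_ h3
    filter_upwards [hC] with n hn
    calc _ ≤ ∑ _l ∈ Finset.range (n + 1), C * (2 * (t / ((n : ℝ) + 1)) ^ α) := by
          refine (norm_sum_le _ _).trans (Finset.sum_le_sum fun l hl => ?_)
          have hl' := Finset.mem_range.1 hl
          rw [norm_mul]
          exact mul_le_mul (hn _ (node_mem ht.1 (by omega))) (hE n l hl) (norm_nonneg _) hC0
      _ = _ := by simp; ring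
  have h4 := h1.sub (h2.const_mul (1 / 2))
  have hl : 1 / 2 * ∫ s in (0 : ℝ)..t, Z s * (α * s ^ (α - 1)) =
      H i * K i * ∫ s in (0 : ℝ)..t, Z s * s ^ (α - 1) := by
    rw [← intervalIntegral.integral_const_mul, ← intervalIntegral.integral_const_mul]
    congr 1; ext s; rw [hα]; ring
  rw [mul_zero, sub_zero, hl] at h4
  refine h4.congr fun n => ?_
  rw [Finset.mul_sum, Finset.mul_sum, ← Finset.sum_sub_distrib]
  refine Finset.sum_congr rfl fun l hl => ?_
  have hl' := Finset.mem_range.1 hl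
  have m0 := node_mem_of_mem ht (n := n) (k := l) (by omega)
  have m1 := node_mem_of_mem ht (n := n) (k := l + 1) (by omega)
  simp only [E]
  rw [cov_self hp.pos hp.mem.1 m0.1, cov_self hp.pos hp.mem.1 m1.1]
  ring

lemma IsBifBm.ae_path_zero (hB : IsBifBm P H K T B) (hp : ∀ j, IsParam (H j) (K j))
    (hT : 0 ≤ T) : ∀ᵐ ω ∂P, path B ω 0 = 0 := by
  have h0 : (0 : ℝ) ∈ Icc 0 T := ⟨le_rfl, hT⟩
  have h : ∀ j, ∀ᵐ ω ∂P, B j 0 ω = 0 := by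
    intro j
    have h1 : ∫ ω, B j 0 ω * B j 0 ω ∂P = 0 := by
      rw [hB.covariance j 0 h0 0 h0, cov_zero_left (hp j).pos le_rfl]
    have h2 := (integral_eq_zero_iff_of_nonneg (fun ω => mul_self_nonneg (B j 0 ω))
      ((hB.memLp_two j h0).integrable_mul (hB.memLp_two j h0))).1 h1
    filter_upwards [h2] with ω hω
    exact mul_self_eq_zero.1 hω
  filter_upwards [ae_all_iff.2 h] with ω hω
  exact funext hω

/-- The quadratic variation along the partition vanishes in the limit. -/
lemma IsBifBm.tendsto_integral_quadVar (hB : IsBifBm P H K T B) {i : Fin d}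
    (hp : IsParam (H i) (K i)) {t : ℝ} (ht : t ∈ Icc 0 T) :
    (∀ n, Integrable (fun ω => ∑ l ∈ Finset.range (n + 1),
      (B i (node t n (l + 1)) ω - B i (node t n l) ω) ^ 2) P) ∧
    Tendsto (fun n => ∫ ω, ‖∑ l ∈ Finset.range (n + 1),
      (B i (node t n (l + 1)) ω - B i (node t n l) ω) ^ 2‖ ∂P) atTop (𝓝 0) := by
  have hi : ∀ n, ∀ l ∈ Finset.range (n + 1), Integrable (fun ω =>
      (B i (node t n (l + 1)) ω - B i (node t n l) ω) ^ 2) P := by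
    intro n l hl
    have hl' := Finset.mem_range.1 hl
    exact ((hB.memLp_two i (node_mem_of_mem ht (by omega))).sub
      (hB.memLp_two i (node_mem_of_mem ht (by omega)))).integrable_sq
  refine ⟨fun n => integrable_finsetSum _ (hi n), ?_⟩
  have h3 := (tendsto_mesh_rpow ht.1 hp.one_lt).const_mul 2
  rw [mul_zero] at h3
  refine squeeze_zero (fun n => integral_nonneg fun _ => norm_nonneg _) (fun n => ?_) h3
  simp only [Real.norm_of_nonneg (Finset.sum_nonneg fun l _ =>
    sq_nonneg (B i (node t n (l + 1)) _ - B i (node t n l) _))]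
  rw [integral_finsetSum _ (hi n)]
  calc _ ≤ ∑ _l ∈ Finset.range (n + 1), (2 * (t / ((n : ℝ) + 1)) ^ (2 * H i * K i)) := by
        refine Finset.sum_le_sum fun l hl => ?_
        have hl' := Finset.mem_range.1 hl
        have m0 := node_mem_of_mem ht (n := n) (k := l) (by omega)
        have m1 := node_mem_of_mem ht (n := n) (k := l + 1) (by omega)
        rw [hB.integral_increment_sq i m0 m1]
        have := cov_increment_le hp.pos hp.mem m0.1 m1.1
        rwa [abs_sub_comm, node_succ_sub, abs_of_nonneg (by have := ht.1; positivity)] at this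
    _ = _ := by simp; ring

lemma norm_sq_le_sum_sq (v : Fin d → ℝ) : ‖v‖ ^ 2 ≤ ∑ j, v j ^ 2 := by
  have h0 : 0 ≤ ∑ j, v j ^ 2 := Finset.sum_nonneg fun _ _ => sq_nonneg _
  refine (Real.le_sqrt (norm_nonneg _) h0).1 ((pi_norm_le_iff_of_nonneg (Real.sqrt_nonneg _)).2
    fun j => Real.abs_le_sqrt ?_)
  exact Finset.single_le_sum (f := fun j => v j ^ 2) (fun _ _ => sq_nonneg _) (Finset.mem_univ j)

/-- Itô's formula for functions with bounded second derivatives. -/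
theorem IsBifBm.ito_formula (hB : IsBifBm P H K T B)
    (hp : ∀ j, IsParam (H j) (K j)) {t : ℝ} (ht : t ∈ Icc 0 T)
    {f : (Fin d → ℝ) → ℝ} (hf : ContDiff ℝ 2 f) {C : ℝ}
    (hC : ∀ x i j, |partialDeriv j (partialDeriv i f) x| ≤ C) {G : Fin d → Ω → ℝ}
    (hi : ∀ i n, Integrable (fun ω =>
      divSum (H i) (K i) B i t n (moll n (partialDeriv i f)) ω - G i ω) P)
    (hG : ∀ i, Tendsto (fun n => ∫ ω,
      ‖divSum (H i) (K i) B i t n (moll n (partialDeriv i f)) ω - G i ω‖ ∂P) atTop (𝓝 0)) :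
    ∀ᵐ ω ∂P, f (path B ω t) = f 0 + ∑ i, G i ω + ∑ i, H i * K i * ∫ s in (0 : ℝ)..t,
      partialDeriv i (partialDeriv i f) (path B ω s) * s ^ (2 * H i * K i - 1) := by
  have hT : 0 ≤ T := ht.1.trans ht.2
  have hsub : Icc 0 t ⊆ Icc 0 T := Icc_subset_Icc_right ht.2
  have hf1 : ContDiff ℝ 1 f := hf.of_le (by norm_num)
  have hd1 : ∀ i, ContDiff ℝ 1 (partialDeriv i f) := fun i =>
    contDiff_partialDeriv hf (by norm_num) i
  have hd2 : ∀ i j, Continuous (partialDeriv j (partialDeriv i f)) := fun i j =>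
    (contDiff_partialDeriv (hd1 i) (m := 0) (by norm_num) j).continuous
  -- One subsequence for the d divergence errors and the d quadratic variations together.
  obtain ⟨ns, hns, hae⟩ := exists_seq_tendsto_ae_of_integral_norm (P := P) (ι := Fin d ⊕ Fin d)
    (X := fun n j => Sum.elim
      (fun i ω => divSum (H i) (K i) B i t n (moll n (partialDeriv i f)) ω - G i ω)
      (fun i ω => ∑ l ∈ Finset.range (n + 1),
        (B i (node t n (l + 1)) ω - B i (node t n l) ω) ^ 2) j)
    (by
      rintro n (i | i)
      · exact hi i n
      · exact (hB.tendsto_integral_quadVar (hp i) ht).1 n)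
    (by
      rintro (i | i)
      · exact hG i
      · exact (hB.tendsto_integral_quadVar (hp i) ht).2)
  filter_upwards [hae, hB.ae_continuousOn_path, hB.ae_path_zero hp hT] with ω hω hcont h0
  have hc := hcont.mono hsub
  have hns' := hns.tendsto_atTop
  -- the remainder in the discrete Taylor expansion
  let R : ℕ → ℝ := fun n => ∑ l ∈ Finset.range (n + 1),
    (moll n f (path B ω (node t n (l + 1))) - moll n f (path B ω (node t n l)) -
      ∑ i, partialDeriv i (moll n f) (path B ω (node t n l)) *
        (path B ω (node t n (l + 1)) i - path B ω (node t n l) i))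
  have hRb : ∀ n, ‖R n‖ ≤ (d * (d * |C|)) * ∑ i, ∑ l ∈ Finset.range (n + 1),
      (B i (node t n (l + 1)) ω - B i (node t n l) ω) ^ 2 := by
    intro n
    have hsm : ContDiff ℝ 2 (moll n f) := contDiff_infty.1 (contDiff_moll n hf.continuous) 2
    -- Mollification preserves the bound on second derivatives, so the Taylor constant does not
    -- depend on n; |C| is taken because C may be negative when d = 0.
    have hC' : ∀ x i j, |partialDeriv j (partialDeriv i (moll n f)) x| ≤ |C| := by
      intro x i j
      rw [partialDeriv_moll n hf1, partialDeriv_moll n (hd1 i)]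
      exact abs_moll_le (fun x => (hC x i j).trans (le_abs_self _)) x
    rw [Finset.sum_comm, Finset.mul_sum]
    refine norm_sum_le_of_le _ fun l _ => ?_
    have h1 := abs_taylor_le hsm hC' (path B ω (node t n l)) (path B ω (node t n (l + 1)))
    have h2 := norm_sq_le_sum_sq (path B ω (node t n (l + 1)) - path B ω (node t n l))
    exact h1.trans (mul_le_mul_of_nonneg_left h2 (by positivity))
  have hR : Tendsto (fun k => R (ns k)) atTop (𝓝 0) := by
    have h1 : Tendsto (fun k => (d * (d * |C|)) * ∑ i, ∑ l ∈ Finset.range (ns k + 1),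
        (B i (node t (ns k) (l + 1)) ω - B i (node t (ns k) l) ω) ^ 2) atTop (𝓝 0) := by
      have := (tendsto_finsetSum (Finset.univ : Finset (Fin d))
        fun i _ => hω (Sum.inr i)).const_mul (d * (d * |C|))
      simpa using this
    exact squeeze_zero_norm (fun k => hRb (ns k)) h1
  have hS : ∀ i, Tendsto (fun k => divSum (H i) (K i) B i t (ns k)
      (moll (ns k) (partialDeriv i f)) ω) atTop (𝓝 (G i ω)) := by
    intro i
    simpa using (hω (Sum.inl i)).add_const (G i ω)
  have hTr : ∀ i, Tendsto (fun k => ∑ l ∈ Finset.range (ns k + 1),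
      moll (ns k) (partialDeriv i (partialDeriv i f)) (path B ω (node t (ns k) l)) *
      (cov (H i) (K i) (node t (ns k) l) (node t (ns k) (l + 1)) -
        cov (H i) (K i) (node t (ns k) l) (node t (ns k) l))) atTop
      (𝓝 (H i * K i * ∫ s in (0 : ℝ)..t,
        partialDeriv i (partialDeriv i f) (path B ω s) * s ^ (2 * H i * K i - 1))) := fun i =>
    (hB.tendsto_trace (hp i) ht (tendstoUniformlyOn_moll_comp (hd2 i i) hc)
      ((hd2 i i).comp_continuousOn hc)).comp hns'
  have hL : ∀ x, Tendsto (fun k => moll (ns k) f x) atTop (𝓝 (f x)) := by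
    intro x
    -- Pointwise convergence is read off from a constant path on [0,0].
    have h2 := tendstoUniformlyOn_moll_comp hf.continuous (γ := fun _ => x) (t := 0)
      continuousOn_const
    exact (h2.tendsto_at (x := 0) (by simp)).comp hns'
  have hl := (hL (path B ω t)).sub (hL (path B ω 0))
  have hr := (hR.add (tendsto_finsetSum (Finset.univ : Finset (Fin d)) fun i _ => hS i)).add
    (tendsto_finsetSum (Finset.univ : Finset (Fin d)) fun i _ => hTr i)
  -- The increments telescope. The correction subtracted in `divSum` is exactly the trace sum,
  -- because mollification commutes with partial derivatives.
  have hdec : ∀ n, moll n f (path B ω t) - moll n f (path B ω 0) = R n +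
      ∑ i, divSum (H i) (K i) B i t n (moll n (partialDeriv i f)) ω +
      ∑ i, ∑ l ∈ Finset.range (n + 1), moll n (partialDeriv i (partialDeriv i f))
          (path B ω (node t n l)) * (cov (H i) (K i) (node t n l) (node t n (l + 1)) -
            cov (H i) (K i) (node t n l) (node t n l)) := by
    intro n
    have e1 := Finset.sum_range_sub (fun l => moll n f (path B ω (node t n l))) (n + 1)
    rw [node_last, node_zero] at e1
    rw [← e1, add_assoc, ← Finset.sum_add_distrib]
    have e2 : ∀ i, divSum (H i) (K i) B i t n (moll n (partialDeriv i f)) ω +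
        ∑ l ∈ Finset.range (n + 1), moll n (partialDeriv i (partialDeriv i f))
          (path B ω (node t n l)) * (cov (H i) (K i) (node t n l) (node t n (l + 1)) -
            cov (H i) (K i) (node t n l) (node t n l)) =
        ∑ l ∈ Finset.range (n + 1), partialDeriv i (moll n f) (path B ω (node t n l)) *
          (path B ω (node t n (l + 1)) i - path B ω (node t n l) i) := by
      intro i
      rw [divSum, ← Finset.sum_add_distrib]
      refine Finset.sum_congr rfl fun l _ => ?_
      rw [partialDeriv_moll n (hd1 i), partialDeriv_moll n hf1]
      simp only [path]
      ring
    simp only [e2, R]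
    rw [Finset.sum_comm, ← Finset.sum_add_distrib]
    exact Finset.sum_congr rfl fun l _ => by ring
  simp only [hdec] at hl
  have heq := tendsto_nhds_unique hl hr
  rw [h0] at heq
  linarith

end Ito
-- Cutoffs and localizing events.
section Localization

open Set Filter Topology

variable {Ω : Type*} [MeasurableSpace Ω] {P : Measure Ω} {d : ℕ} {H K : Fin d → ℝ} {T : ℝ}
  {B : Fin d → ℝ → Ω → ℝ}

lemma IsBifBm.exists_divergence_and_ito [IsProbabilityMeasure P] (hB : IsBifBm P H K T B)
    (hp : ∀ j, IsParam (H j) (K j)) {t : ℝ} (ht : t ∈ Icc 0 T)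
    {f : (Fin d → ℝ) → ℝ} (hf : ContDiff ℝ 2 f) {C : ℝ}
    (hC : ∀ x i j, |partialDeriv i f x| ≤ C ∧ |partialDeriv j (partialDeriv i f) x| ≤ C) :
    ∃ G : Fin d → Ω → ℝ,
      (∀ i, MemSobolev P T B i (integrand P B i t (partialDeriv i f)) ∧
        IsDivergence P T B i (integrand P B i t (partialDeriv i f)) (G i)) ∧
      (∀ i n, Integrable (fun ω =>
        divSum (H i) (K i) B i t n (moll n (partialDeriv i f)) ω - G i ω) P) ∧
      (∀ i, Tendsto (fun n => ∫ ω,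
        ‖divSum (H i) (K i) B i t n (moll n (partialDeriv i f)) ω - G i ω‖ ∂P) atTop (𝓝 0)) ∧
      ∀ᵐ ω ∂P, f (path B ω t) = f 0 + ∑ i, G i ω + ∑ i, H i * K i * ∫ s in (0 : ℝ)..t,
        partialDeriv i (partialDeriv i f) (path B ω s) * s ^ (2 * H i * K i - 1) := by
  have h := fun i => hB.exists_divergence hp ht i (contDiff_partialDeriv hf (by norm_num) i)
    (fun x => (hC x i i).1) (fun j x => (hC x i j).2)
  choose h1 h2 G h3 h4 using h
  have h5 : ∀ i n, Integrable (fun ω =>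
      divSum (H i) (K i) B i t n (moll n (partialDeriv i f)) ω - G i ω) P := fun i n =>
    (h2 i n).sub ((h3 i).memLp.integrable (by norm_num))
  exact ⟨G, fun i => ⟨h1 i, h3 i⟩, h5, h4,
    hB.ito_formula hp ht hf (fun x i j => (hC x i j).2) h5 h4⟩

/-- A smooth cutoff of `f` outside a large ball. -/
noncomputable def trunc (m : ℕ) (f : (Fin d → ℝ) → ℝ) (x : Fin d → ℝ) : ℝ :=
  -- The plateau has radius m + 2: the path stays within m, the mollifier reaches 1 further, and
  -- strict inequality leaves a neighbourhood on which derivatives agree.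
  (⟨m + 2, m + 3, by positivity, by linarith⟩ : ContDiffBump (0 : Fin d → ℝ)) x * f x

lemma contDiff_trunc (m : ℕ) {f : (Fin d → ℝ) → ℝ} (hf : ContDiff ℝ 2 f) :
    ContDiff ℝ 2 (trunc m f) :=
  (ContDiffBump.contDiff _).mul hf

lemma hasCompactSupport_trunc (m : ℕ) (f : (Fin d → ℝ) → ℝ) : HasCompactSupport (trunc m f) :=
  (ContDiffBump.hasCompactSupport _).mul_right

lemma trunc_eq (m : ℕ) (f : (Fin d → ℝ) → ℝ) {x : Fin d → ℝ} (hx : ‖x‖ < m + 2) :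
    trunc m f x = f x := by
  rw [trunc, ContDiffBump.one_of_mem_closedBall, one_mul]
  rw [mem_closedBall_zero_iff]
  exact hx.le

lemma partialDeriv_congr_of_ball {f g : (Fin d → ℝ) → ℝ} {r : ℝ} (h : ∀ x, ‖x‖ < r → f x = g x)
    (i : Fin d) {x : Fin d → ℝ} (hx : ‖x‖ < r) : partialDeriv i f x = partialDeriv i g x := by
  have : f =ᶠ[𝓝 x] g := by
    filter_upwards [Metric.isOpen_ball.mem_nhds (mem_ball_zero_iff.2 hx)] with y hy
    exact h y (mem_ball_zero_iff.1 hy)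
  rw [partialDeriv, this.fderiv_eq, partialDeriv]

lemma hasCompactSupport_partialDeriv {f : (Fin d → ℝ) → ℝ} (hs : HasCompactSupport f) (i : Fin d) :
    HasCompactSupport (partialDeriv i f) :=
  (hs.fderiv ℝ).comp_left (g := fun L : (Fin d → ℝ) →L[ℝ] ℝ => L (Pi.single i 1)) rfl

lemma exists_bound_partialDeriv {f : (Fin d → ℝ) → ℝ} (hf : ContDiff ℝ 2 f)
    (hs : HasCompactSupport f) :
    ∃ C, ∀ x i j, |partialDeriv i f x| ≤ C ∧ |partialDeriv j (partialDeriv i f) x| ≤ C := by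
  have hd1 : ∀ i, ContDiff ℝ 1 (partialDeriv i f) := fun i =>
    contDiff_partialDeriv hf (by norm_num) i
  choose C hC using fun i => (hd1 i).continuous.bounded_above_of_compact_support
    (hasCompactSupport_partialDeriv hs i)
  choose C' hC' using fun i j =>
    (contDiff_partialDeriv (hd1 i) (m := 0) (by norm_num) j).continuous
      |>.bounded_above_of_compact_support
        (hasCompactSupport_partialDeriv (hasCompactSupport_partialDeriv hs i) j)
  have h0 : 0 ≤ ∑ i, |C i| := Finset.sum_nonneg fun _ _ => abs_nonneg _
  have h0' : 0 ≤ ∑ p : Fin d × Fin d, |C' p.1 p.2| := Finset.sum_nonneg fun _ _ => abs_nonneg _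
  refine ⟨∑ i, |C i| + ∑ p : Fin d × Fin d, |C' p.1 p.2|, fun x i j => ⟨?_, ?_⟩⟩
  · have h1 := Finset.single_le_sum (f := fun i => |C i|) (fun _ _ => abs_nonneg _)
      (Finset.mem_univ i)
    have h2 : |partialDeriv i f x| ≤ C i := hC i x
    linarith [le_abs_self (C i)]
  · have h1 := Finset.single_le_sum (f := fun p : Fin d × Fin d => |C' p.1 p.2|)
      (fun _ _ => abs_nonneg _) (Finset.mem_univ (i, j))
    have h2 : |partialDeriv j (partialDeriv i f) x| ≤ C' i j := hC' i j x
    simp only at h1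
    linarith [le_abs_self (C' i j)]

/-- The event that the process stays in the ball of radius `m`. -/
def locEvent (T : ℝ) (B : Fin d → ℝ → Ω → ℝ) (m : ℕ) : Set Ω :=
  -- Rational times keep the event measurable.
  {ω | ∀ q : ℚ, (q : ℝ) ∈ Icc 0 T → ∀ j, |B j q ω| ≤ m}

lemma IsBifBm.measurableSet_locEvent (hB : IsBifBm P H K T B) (m : ℕ) :
    MeasurableSet (locEvent T B m) := by
  have e : locEvent T B m = ⋂ (q : ℚ) (_ : (q : ℝ) ∈ Icc 0 T) (j : Fin d),
      {ω | |B j q ω| ≤ m} := by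
    ext ω; simp [locEvent]
  rw [e]
  exact .iInter fun q => .iInter fun hq => .iInter fun j =>
    measurableSet_le (hB.measurable j q hq).abs measurable_const

lemma monotone_locEvent {Ω : Type*} {B : Fin d → ℝ → Ω → ℝ} :
    Monotone (locEvent T B) := fun _ _ hmn _ hω q hq j =>
  (hω q hq j).trans (mod_cast hmn)

lemma exists_mem_locEvent {Ω : Type*} {B : Fin d → ℝ → Ω → ℝ} {ω : Ω}
    (hc : ContinuousOn (path B ω) (Icc 0 T)) :
    ∃ m, ω ∈ locEvent T B m := by
  obtain ⟨C, hC⟩ := isCompact_Icc.exists_bound_of_continuousOn hc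
  obtain ⟨m, hm⟩ := exists_nat_ge C
  exact ⟨m, fun q hq j => (norm_le_pi_norm (path B ω q) j).trans ((hC q hq).trans hm)⟩

/-- Rational points are dense in (0,T), whose closure is [0,T] as T > 0, and for a continuous path
the bound is a closed condition on time. -/
lemma norm_path_le {Ω : Type*} {B : Fin d → ℝ → Ω → ℝ} (hT : 0 < T) {ω : Ω}
    (hc : ContinuousOn (path B ω) (Icc 0 T)) {m : ℕ}
    (hω : ω ∈ locEvent T B m) {s : ℝ} (hs : s ∈ Icc 0 T) : ‖path B ω s‖ ≤ m := by
  have hcl : IsClosed (Icc 0 T ∩ path B ω ⁻¹' Metric.closedBall 0 m) :=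
    hc.preimage_isClosed_of_isClosed isClosed_Icc Metric.isClosed_closedBall
  have h1 : Icc 0 T ⊆ closure (Ioo 0 T ∩ range ((↑) : ℚ → ℝ)) := by
    rw [← closure_Ioo hT.ne]
    exact closure_minimal (Dense.open_subset_closure_inter Rat.denseRange_cast isOpen_Ioo)
      isClosed_closure
  have h2 := closure_minimal (t := Icc 0 T ∩ path B ω ⁻¹' Metric.closedBall 0 m) ?_ hcl (h1 hs)
  · exact mem_closedBall_zero_iff.1 h2.2
  · rintro _ ⟨hq, q, rfl⟩
    refine ⟨Ioo_subset_Icc_self hq, mem_closedBall_zero_iff.2 ?_⟩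
    exact (pi_norm_le_iff_of_nonneg m.cast_nonneg).2 fun j => hω q (Ioo_subset_Icc_self hq) j

end Localization
end BifBm

/-! ### Assembly of the theorem. -/

open BifBm in
theorem mainTheorem3 {Ω : Type*} [MeasurableSpace Ω] (P : Measure Ω) [IsProbabilityMeasure P]
    {d : ℕ} (H K : Fin d → ℝ) (hH : ∀ i, H i ∈ Set.Icc (0 : ℝ) 1)
    (hK : ∀ i, K i ∈ Set.Ioc (0 : ℝ) 1) (hHK : ∀ i, 1 < 2 * H i * K i)
    (T : ℝ) (hT : 0 < T) (B : Fin d → ℝ → Ω → ℝ) (hB : BifBm.IsBifBm P H K T B)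
    (f : (Fin d → ℝ) → ℝ) (hf : ContDiff ℝ 2 f) (t : ℝ) (ht : t ∈ Set.Icc 0 T) :
    -- `u i` is the process `s ↦ 1_{[0,t]}(s) ∂ᵢf(B_s)` as a random element of the Hilbert space
    -- of the `i`-th component, and `G i` is its divergence integral with respect to `B i`
    ∃ (u : Fin d → Ω → Lp ℝ 2 P) (G : Fin d → Ω → ℝ),
      (∀ i, ∀ᵐ ω ∂P, BifBm.IsFunction P T B H K i
        ((Set.Icc 0 t).indicator fun s => BifBm.partialDeriv i f (fun j => B j s ω)) (u i ω)) ∧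
      (∀ i, BifBm.IsLocalDivergence P T B i (u i) (G i)) ∧
      -- no localization is needed when the derivatives of order one and two are bounded
      ((∃ C : ℝ, ∀ x i j, |BifBm.partialDeriv i f x| ≤ C ∧
          |BifBm.partialDeriv j (BifBm.partialDeriv i f) x| ≤ C) →
        ∀ i, BifBm.MemSobolev P T B i (u i) ∧ BifBm.IsDivergence P T B i (u i) (G i)) ∧
      (∀ᵐ ω ∂P, f (fun j => B j t ω) = f 0 + ∑ i, G i ω +
        ∑ i, H i * K i * ∫ s in (0 : ℝ)..t,
          BifBm.partialDeriv i (BifBm.partialDeriv i f) (fun j => B j s ω) *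
            s ^ (2 * H i * K i - 1)) := by
  have hp : ∀ i, IsParam (H i) (K i) := fun i => isParam_of (hH i) (hK i) (hHK i)
  have hsub : Set.Icc 0 t ⊆ Set.Icc 0 T := Set.Icc_subset_Icc_right ht.2
  have hcf : ∀ i, Continuous (partialDeriv i f) := fun i =>
    (contDiff_partialDeriv hf (m := 0) (by norm_num) i).continuous
  have hpath := hB.ae_continuousOn_path
  have hfun : ∀ i, ∀ᵐ ω ∂P, IsFunction P T B H K i
      ((Set.Icc 0 t).indicator fun s => partialDeriv i f (fun j => B j s ω))
      (integrand P B i t (partialDeriv i f) ω) := by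
    intro i
    filter_upwards [hpath] with ω hc
    exact hB.isFunction_toHilb (hp i) ht ((hcf i).comp_continuousOn (hc.mono hsub))
  refine ⟨fun i => integrand P B i t (partialDeriv i f), ?_⟩
  -- The split precedes the choice of G, because the unlocalized statement concerns the same G.
  -- Bounded derivatives allow the trivial localization by the whole space; otherwise that statement
  -- is vacuous.
  by_cases hbd : ∃ C : ℝ, ∀ x i j, |partialDeriv i f x| ≤ C ∧
      |partialDeriv j (partialDeriv i f) x| ≤ C
  · obtain ⟨C, hC⟩ := hbd
    obtain ⟨G, hG, -, -, hito⟩ := hB.exists_divergence_and_ito hp ht hf hC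
    refine ⟨G, hfun, fun i => ⟨fun _ => Set.univ,
      fun _ => integrand P B i t (partialDeriv i f), fun _ => G i, fun _ => .univ,
      monotone_const, .of_forall fun ω => ⟨0, trivial⟩, fun _ => (hG i).1, fun _ => (hG i).2,
      fun _ => .of_forall fun ω _ => ⟨rfl, rfl⟩⟩, fun _ => hG, hito⟩
  · have hbdm := fun m => exists_bound_partialDeriv (contDiff_trunc m hf)
      (hasCompactSupport_trunc m f)
    choose C hC using hbdm
    have hex := fun m => hB.exists_divergence_and_ito hp ht (contDiff_trunc m hf) (hC m)
    choose G hG hGi hGl hito using hex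
    have hd1 : ∀ m i, ContDiff ℝ 1 (partialDeriv i (trunc m f)) := fun m i =>
      contDiff_partialDeriv (contDiff_trunc m hf) (by norm_num) i
    have e1 : ∀ (m : ℕ) i x, ‖x‖ < (m : ℝ) + 2 →
        partialDeriv i (trunc m f) x = partialDeriv i f x := fun m i x hx =>
      partialDeriv_congr_of_ball (fun y hy => trunc_eq m f hy) i hx
    have e2 : ∀ (m : ℕ) i x, ‖x‖ < (m : ℝ) + 2 → partialDeriv i (partialDeriv i (trunc m f)) x =
        partialDeriv i (partialDeriv i f) x := fun m i x hx =>
      partialDeriv_congr_of_ball (fun y hy => e1 m i y hy) i hx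
    -- Every node value lies within m and the mollifier sees only points within m + 1, where both
    -- cutoffs equal f.
    have hdiv : ∀ m m' : ℕ, m ≤ m' → ∀ ω ∈ locEvent T B m,
        ContinuousOn (path B ω) (Set.Icc 0 T) → ∀ i n,
        divSum (H i) (K i) B i t n (moll n (partialDeriv i (trunc m' f))) ω =
        divSum (H i) (K i) B i t n (moll n (partialDeriv i (trunc m f))) ω := by
      intro m m' hmm ω hω hc i n
      have hmm' : (m : ℝ) ≤ m' := mod_cast hmm
      refine Finset.sum_congr rfl fun l hl => ?_
      have hl' := Finset.mem_range.1 hl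
      have hx := norm_path_le hT hc hω (node_mem_of_mem ht (n := n) (k := l) (by omega))
      have hy : ∀ y, ‖y - path B ω (node t n l)‖ ≤ 1 → ‖y‖ < (m : ℝ) + 2 := fun y hy => by
        have := norm_le_norm_add_norm_sub' y (path B ω (node t n l))
        linarith
      rw [partialDeriv_moll n (hd1 m i), partialDeriv_moll n (hd1 m' i),
        moll_congr (f := partialDeriv i (trunc m' f)) (g := partialDeriv i (trunc m f))
          fun y h => by rw [e1 m i y (hy y h), e1 m' i y (by linarith [hy y h])],
        moll_congr (f := partialDeriv i (partialDeriv i (trunc m' f)))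
          (g := partialDeriv i (partialDeriv i (trunc m f)))
          fun y h => by rw [e2 m i y (hy y h), e2 m' i y (by linarith [hy y h])]]
    -- Along a common subsequence both divergences are limits of the same numbers.
    have hcons : ∀ᵐ ω ∂P, ∀ i (m m' : ℕ), m ≤ m' → ω ∈ locEvent T B m → G m' i ω = G m i ω := by
      refine ae_all_iff.2 fun i => ae_all_iff.2 fun m => ae_all_iff.2 fun m' => ?_
      obtain ⟨ns, -, hns⟩ := exists_seq_tendsto_ae_of_integral_norm (P := P) (ι := Bool)
        (X := fun n b ω => divSum (H i) (K i) B i t n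
          (moll n (partialDeriv i (trunc (bif b then m else m') f))) ω -
            G (bif b then m else m') i ω)
        (fun n b => hGi _ i n) (fun b => hGl _ i)
      filter_upwards [hns, hpath] with ω h hc hmm hω
      have a := (h true).add_const (G m i ω)
      have b := (h false).add_const (G m' i ω)
      simp only [cond_true, cond_false, sub_add_cancel, zero_add] at a b
      simp only [hdiv m m' hmm ω hω hc] at b
      exact tendsto_nhds_unique b a
    -- The divergence of the first cutoff whose event contains ω. Outside all events `sInf ∅ = 0` is
    -- a harmless default, since this set is null.
    let G' : Fin d → Ω → ℝ := fun i ω => G (sInf {m | ω ∈ locEvent T B m}) i ω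
    have hG' : ∀ᵐ ω ∂P, ∀ (m : ℕ), ω ∈ locEvent T B m → ∀ i, G m i ω = G' i ω := by
      filter_upwards [hcons] with ω h m hm i
      exact h i _ m (Nat.sInf_le hm) (Nat.sInf_mem (s := {m | ω ∈ locEvent T B m}) ⟨m, hm⟩)
    refine ⟨G', hfun, fun i => ⟨locEvent T B,
      fun m => integrand P B i t (partialDeriv i (trunc m f)), fun m => G m i,
      hB.measurableSet_locEvent, monotone_locEvent, ?_, fun m => (hG m i).1,
      fun m => (hG m i).2, fun m => ?_⟩, fun h => absurd h hbd, ?_⟩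
    · filter_upwards [hpath] with ω hc
      exact exists_mem_locEvent hc
    · filter_upwards [hG', hpath] with ω h hc hω
      -- The integrands coincide because `toHilb` is built pathwise from the values on [0,t].
      refine ⟨toHilb_congr ht.1 i fun s hs => e1 m i _ ?_, h m hω i⟩
      linarith [norm_path_le hT hc hω (hsub hs)]
    · filter_upwards [ae_all_iff.2 hito, hG', hpath] with ω h hg hc
      obtain ⟨m, hm⟩ := exists_mem_locEvent hc
      have hn : ∀ s ∈ Set.Icc 0 T, ‖path B ω s‖ < (m : ℝ) + 2 := fun s hs => by
        linarith [norm_path_le hT hc hm hs]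
      have h1 := h m
      rw [trunc_eq m f (hn t ht), trunc_eq m f (by rw [norm_zero]; positivity)] at h1
      simp only [hg m hm] at h1
      refine h1.trans ?_
      congr 1
      refine Finset.sum_congr rfl fun i _ => ?_
      congr 1
      refine intervalIntegral.integral_congr fun s hs => ?_
      rw [Set.uIcc_of_le ht.1] at hs
      rw [e2 m i _ (hn s (hsub hs))]
      rfl
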